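/- Notation. Let $\overline\psi(\hbar^2,z)=\sum_{d\ge 0}\hbar^{2d}\psi_{2d}(z)$ and $\overline y(\hbar^2,z)=\sum_{d\ge 0}\hbar^{2d}y_d(z)$, where each $\psi_{2d}\in\mathbb C[[z]]$ is even and each $y_d\in\mathbb C[[z]]$ is odd; put $\psi=\psi_0$, $y=y_0$. Let $\phi_k$, $k\in\mathbb Z$, be the neutral fermions, $\phi_k\phi_m+\phi_m\phi_k=(-1)^k\delta_{k+m,0}$, acting on the Fock space with basis $\phi_{k_1}\cdots\phi_{k_m}|0\rangle$, $k_1>\dots>k_m\ge 0$, where $\phi_m|0\rangle=0$ for $m<0$; let $\langle 0|a|0\rangle$ be the coefficient of $|0\rangle$ in $a|0\rangle$, and $:\!\phi_k\phi_m\!:\;=\phi_k\phi_m-\langle 0|\phi_k\phi_m|0\rangle$. For odd $k$ let $J_k=\frac12\sum_{m\in\mathbb Z}(-1)^{m+1}:\!\phi_m\phi_{-m-k}\!:$, and let $J_+(\mathbf t)=\sum_{k}t_kJ_k$, $J_-(\mathbf s)=\sum_{k}s_kJ_{-k}$ (sums over odd $k>0$). Define $T_k$, $k\in\mathbb Z$,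 by $T_0=0$, $T_{k+1}-T_k=\overline\psi(\hbar^2,\hbar(k+\tfrac12))$, so that $T_{-k}=-T_k$, and let $\mathcal D=\exp\big(\sum_{k\in\mathbb Z}(-1)^kT_k:\!\phi_k\phi_{-k}\!:\big)$. The hypergeometric 2-BKP tau-function is $$\tau(\mathbf t,\mathbf s)=\langle 0|e^{J_+(\mathbf t)}\,\mathcal D\,e^{J_-(\mathbf s)}|0\rangle .$$ With $s_k=\frac1k[z^k]\overline y(\hbar^2,z)$ for odd $k>0$, put $$H_n^\bullet=\sum_{k_1,\dots,k_n>0\ \mathrm{odd}}\frac{\partial^n\tau(\mathbf t,\hbar^{-1}\mathbf s)}{\partial t_{k_1}\cdots\partial t_{k_n}}\Big|_{\mathbf t=0}\frac{X_1^{k_1}}{k_1}\cdots\frac{X_n^{k_n}}{k_n},$$ let $H_n$, $n\ge1$, be the connected functions obtained from the $H_n^\bullet$ by inclusion-exclusion, put $W_n=D_1\cdots D_nH_n$ with $D_i=X_i\partial_{X_i}$, and let $W_{g,n}\in\mathbb C[[X_1,\dots,X_n]]$ be the coefficient of $\hbar^{2g-2+n}$ in $W_n$. Let $X(z)=z\,e^{-2\psi(y(z))}\in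 z\,\mathbb C[[z]]$, $X_i=X(z_i)$, $Q_i=\frac{z_i}{X_i}\frac{dX_i}{dz_i}$ and $B(z,w)=\frac{zw}{(z-w)^2}+\frac{zw}{(z+w)^2}$, and let $$\omega_{g,n}=2^{1-g}\,W_{g,n}(X_1,\dots,X_n)\prod_{i=1}^n d\log X_i+\delta_{g,0}\delta_{n,2}\,\tfrac12B(X_1,X_2)\,d\log X_1\,d\log X_2 .$$ Theorem. The following identities hold, where both sides are elements (respectively, formal differentials with coefficients) of the field of fractions of $\mathbb C[[z]]$ (for $n=1$, $z=z_1$) or of $\mathbb C[[z_1,z_2]]$ (for $n=2$): $$W_{0,1}(X(z))=\tfrac12\,y(z),\qquad W_{0,2}(X(z_1),X(z_2))=\frac{1}{4Q_1Q_2}B(z_1,z_2)-\frac14B(X_1,X_2),$$ $$\omega_{0,1}=y(z)\,d\log X(z),\qquad \omega_{0,2}=\frac12\left(\frac1{(z_1-z_2)^2}+\frac1{(z_1+z_2)^2}\right)dz_1\,dz_2 .$$ -/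

import Mathlib

namespace BKP

noncomputable section

open scoped Nat

/-! ### Neutral fermions -/

section Fermions

variable (K : Type*) [Field K]

/-- The neutral fermion Fock space. The basis vector indexed by `S = {k₁ > k₂ > ⋯ > kₘ ≥ 0}` is
`φ_{k₁} φ_{k₂} ⋯ φ_{kₘ} |0⟩`. -/
abbrev Fock : Type _ := Finset ℕ →₀ K

/-- The basis vector `φ_{k₁} ⋯ φ_{kₘ} |0⟩` of `S = {k₁ > ⋯ > kₘ}`. -/
def basisVec (S : Finset ℕ) : Fock K := Finsupp.single S 1

/-- The sign picked up when `φ_{±j}` is anticommuted past all `φ_i`, `i ∈ S`, `i > j`. -/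
def fermionSign (j : ℕ) (S : Finset ℕ) : K := (-1) ^ (S.filter (fun i => j < i)).card

/-- The action of `φ_k` on the basis vectors, obtained from `φ_k φ_m + φ_m φ_k = (-1)^k δ_{k+m,0}`
(so `φ_0 ^ 2 = 1/2`) and `φ_m |0⟩ = 0` for `m < 0`. -/
def fermionOnBasis (k : ℤ) (S : Finset ℕ) : Fock K :=
  if 0 < k then
    if k.natAbs ∈ S then 0
    else fermionSign K k.natAbs S • basisVec K (insert k.natAbs S)
  else if k = 0 then
    if 0 ∈ S then ((1 / 2 : K) * fermionSign K 0 S) • basisVec K (S.erase 0)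
    else fermionSign K 0 S • basisVec K (insert 0 S)
  else
    if k.natAbs ∈ S then
      ((-1) ^ k.natAbs * fermionSign K k.natAbs S) • basisVec K (S.erase k.natAbs)
    else 0

/-- The neutral fermion `φ_k`, `k ∈ ℤ`, as an operator on the Fock space. -/
def fermion (k : ℤ) : Module.End K (Fock K) := Finsupp.linearCombination K (fermionOnBasis K k)

/-- The vacuum expectation value `⟨0| a |0⟩`. -/
def vev (a : Module.End K (Fock K)) : K := a (basisVec K ∅) ∅

/-- The normal ordering `:φ_k φ_m: = φ_k φ_m - ⟨0| φ_k φ_m |0⟩`. -/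
def normalOrd (k m : ℤ) : Module.End K (Fock K) :=
  fermion K k * fermion K m - vev K (fermion K k * fermion K m) • 1

/-- The bosonic operator `J_k = ½ ∑_{m ∈ ℤ} (-1)^{m+1} :φ_m φ_{-m-k}:`. On each basis vector only
finitely many summands are nonzero. It is used for odd `k` only. -/
def boson (k : ℤ) : Module.End K (Fock K) :=
  Finsupp.linearCombination K fun S =>
    (1 / 2 : K) • ∑ᶠ m : ℤ, ((-1 : K) ^ (m + 1)) • normalOrd K m (-m - k) (basisVec K S)

variable {K}

/-- The diagonal group element `D = exp (∑_{k ∈ ℤ} (-1)^k T_k :φ_k φ_{-k}:)`, `T_{-k} = -T_k`, in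
terms of the weights `w k = e^{2 T_k}`, `k ≥ 0`. The exponent equals
`2 ∑_{k > 0} (-1)^k T_k φ_k φ_{-k}`, and for `k > 0` the operator `(-1)^k φ_k φ_{-k}` is `1` on the
basis vector of `S` if `k ∈ S` and `0` otherwise; moreover `w 0 = 1` as `T_0 = 0`. -/
def diagonalElement (w : ℕ → K) : Module.End K (Fock K) :=
  Finsupp.linearCombination K fun S => (∏ k ∈ S, w k) • basisVec K S

/-- The coefficient of `∏ u_j ^ (a j)` in `exp (∑_j u_j A_j)`: the sum of `A_{j₁} ⋯ A_{jₗ}` over all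
lists `j₁, …, jₗ` with content `a`, divided by `l!`. -/
def expCoeff (A : ℕ → Module.End K (Fock K)) (a : ℕ →₀ ℕ) : Module.End K (Fock K) :=
  (((Finsupp.toMultiset a).card ! : K)⁻¹) •
    ∑ L ∈ (Finsupp.toMultiset a).lists.toFinset, (L.map A).prod

/-- The hypergeometric tau-function of the 2-BKP hierarchy,
`τ(t, s) = ⟨0| e^{J₊(t)} D e^{J₋(s)} |0⟩`, where `J₊(t) = ∑ t_k J_k` and `J₋(s) = ∑ s_k J_{-k}`
(`k` odd positive). The variables `t_{2j+1}` and `s_{2j+1}` are `Sum.inl j` and `Sum.inr j`. -/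
def tau (w : ℕ → K) : MvPowerSeries (ℕ ⊕ ℕ) K := fun c =>
  vev K (expCoeff (fun j => boson K (2 * j + 1)) (Finsupp.sumFinsuppEquivProdFinsupp c).1 *
    diagonalElement w *
    expCoeff (fun j => boson K (-(2 * j + 1))) (Finsupp.sumFinsuppEquivProdFinsupp c).2)

/-- The power series `τ(t, s)` in `t` alone, for given values `s j` of the variables `s_{2j+1}`.
For a fixed monomial in `t` only finitely many monomials in `s` contribute. -/
def tauAt (w : ℕ → K) (s : ℕ → K) : MvPowerSeries ℕ K := fun a =>
  ∑ᶠ b : ℕ →₀ ℕ,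
    MvPowerSeries.coeff (Finsupp.sumFinsuppEquivProdFinsupp.symm (a, b)) (tau w) *
      b.prod fun j e => s j ^ e

/-- The iterated derivative of a series in `t` with respect to `t_{2j+1}`, `j ∈ L`, at `t = 0`. -/
def derivAtZero (f : MvPowerSeries ℕ K) (L : List ℕ) : K :=
  MvPowerSeries.constantCoeff (L.foldr (fun j g => MvPowerSeries.pderiv K j g) f)

end Fermions

/-! ### The parameters and the correlators -/

/-- Formal Laurent series in `ħ`. -/
abbrev HSeries : Type := LaurentSeries ℂ

/-- The exponential of a formal power series (with arbitrary constant term). -/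
def expSeries (f : PowerSeries ℂ) : PowerSeries ℂ :=
  PowerSeries.C (Complex.exp (PowerSeries.constantCoeff f)) *
    (PowerSeries.exp ℂ).subst (f - PowerSeries.C (PowerSeries.constantCoeff f))

/-- The series `ψ̄(ħ², ħ c)` in `ħ`, where `ψ̄(ħ², z) = ∑_d ħ^{2d} ψ_{2d}(z)` and `psi d = ψ_{2d}`. -/
def psiBarAt (psi : ℕ → PowerSeries ℂ) (c : ℂ) : PowerSeries ℂ :=
  PowerSeries.mk fun N =>
    ∑ d ∈ Finset.range (N / 2 + 1), PowerSeries.coeff (N - 2 * d) (psi d) * c ^ (N - 2 * d)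

/-- `T_k` for `k ≥ 0`: the solution of `T_{k+1} - T_k = ψ̄(ħ², ħ (k + 1/2))`, `T_0 = 0`. -/
def T (psi : ℕ → PowerSeries ℂ) (k : ℕ) : PowerSeries ℂ :=
  ∑ j ∈ Finset.range k, psiBarAt psi ((j : ℂ) + 1 / 2)

/-- The weights `e^{2 T_k}`. -/
def weight (psi : ℕ → PowerSeries ℂ) (k : ℕ) : HSeries :=
  ((expSeries (2 * T psi k) : PowerSeries ℂ) : HSeries)

/-- `s_{2j+1} = (1/(2j+1)) [z^{2j+1}] ȳ(ħ², z)`, where `ȳ(ħ², z) = ∑_d ħ^{2d} y_d(z)`. -/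
def sTime (y : ℕ → PowerSeries ℂ) (j : ℕ) : PowerSeries ℂ :=
  PowerSeries.mk fun N =>
    if Even N then PowerSeries.coeff (2 * j + 1) (y (N / 2)) / (2 * j + 1) else 0

/-- `ħ⁻¹ s_{2j+1}`. -/
def sTimeRescaled (y : ℕ → PowerSeries ℂ) (j : ℕ) : HSeries :=
  HahnSeries.single (-1 : ℤ) (1 : ℂ) * ((sTime y j : PowerSeries ℂ) : HSeries)

variable (psi y : ℕ → PowerSeries ℂ)

/-- The coefficient of `∏_{i ∈ B} X_i^{m i}` in the disconnected function `H^•` of the variables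
`X_i`, `i ∈ B`, where
`H^•_n = ∑_{k₁, …, kₙ odd} (∂ⁿ τ(t, ħ⁻¹ s) / ∂t_{k₁} ⋯ ∂t_{kₙ})|_{t = 0} ∏ X_i^{k_i} / k_i`. -/
def HdiscCoeff {n : ℕ} (B : Finset (Fin n)) (m : Fin n →₀ ℕ) : HSeries :=
  if ∀ i ∈ B, Odd (m i) then
    derivAtZero (tauAt (weight psi) (sTimeRescaled y))
        (((List.finRange n).filter (fun i => i ∈ B)).map fun i => m i / 2) /
      ∏ i ∈ B, (m i : HSeries)
  else 0

/-- The connected `n`-point function `H_n`, `n ≥ 1`, obtained from the disconnected ones by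
inclusion-exclusion over the set partitions of the index set of the variables. -/
def Hconn (n : ℕ) : MvPowerSeries (Fin n) HSeries := fun m =>
  ∑ P : Finpartition (Finset.univ : Finset (Fin n)),
    (-1) ^ (P.parts.card - 1) * ((P.parts.card - 1)! : HSeries) *
      ∏ B ∈ P.parts, HdiscCoeff psi y B m

/-- `W_n = D_1 ⋯ D_n H_n`, `D_i = X_i ∂/∂X_i`. -/
def Wconn (n : ℕ) : MvPowerSeries (Fin n) HSeries := fun m =>
  (∏ i, (m i : HSeries)) * MvPowerSeries.coeff m (Hconn psi y n)

/-- The correlator `W_{g,n}`, defined by `W_n = ∑_g ħ^{2g-2+n} W_{g,n}`. -/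
def W (g n : ℕ) : MvPowerSeries (Fin n) ℂ := fun m =>
  (MvPowerSeries.coeff m (Wconn psi y n)).coeff (2 * (g : ℤ) - 2 + n)

/-! ### The change of variables and the differentials -/

/-- `X(z) = z e^{-2 ψ(y(z))}`, where `ψ = ψ_0` and `y = y_0`. -/
def Xser : PowerSeries ℂ :=
  PowerSeries.X * expSeries (-2 * (psi 0).subst (y 0))

/-- `W_{g,n}(X(z_1), …, X(z_n))` as a power series in `z_1, …, z_n`. -/
def WofZ (g n : ℕ) : MvPowerSeries (Fin n) ℂ :=
  (W psi y g n).subst fun i => (Xser psi y).subst (MvPowerSeries.X i : MvPowerSeries (Fin n) ℂ)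

/-- The field of fractions of `ℂ⟦z_1, …, z_n⟧`. -/
abbrev Frac (n : ℕ) : Type := FractionRing (MvPowerSeries (Fin n) ℂ)

/-- A power series in one variable, evaluated at `z_i`, as an element of the field of fractions. -/
def atZ {n : ℕ} (f : PowerSeries ℂ) (i : Fin n) : Frac n :=
  algebraMap (MvPowerSeries (Fin n) ℂ) (Frac n)
    (f.subst (MvPowerSeries.X i : MvPowerSeries (Fin n) ℂ))

/-- The variable `z_i`. -/
def zVar {n : ℕ} (i : Fin n) : Frac n := atZ PowerSeries.X i

/-- `X_i = X(z_i)`. -/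
def XVar {n : ℕ} (i : Fin n) : Frac n := atZ (Xser psi y) i

/-- `(d log X / dz)(z_i) = X'(z_i) / X(z_i)`. -/
def dlogX {n : ℕ} (i : Fin n) : Frac n :=
  atZ (PowerSeries.derivative ℂ (Xser psi y)) i / XVar psi y i

/-- `Q_i = (z ∂_z log X)(z_i)`. -/
def Q {n : ℕ} (i : Fin n) : Frac n := zVar i * dlogX psi y i

/-- `B(z, w) = zw / (z - w)² + zw / (z + w)²`. -/
def B {F : Type*} [Field F] (z w : F) : F := z * w / (z - w) ^ 2 + z * w / (z + w) ^ 2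

/-- The term `δ_{g,0} δ_{n,2} ½ B(X_1, X_2)`. -/
def omegaShift : (g n : ℕ) → Frac n
  | 0, 2 => 1 / 2 * B (XVar psi y 0) (XVar psi y 1)
  | _, _ => 0

/-- The coefficient of `dz_1 ⋯ dz_n` in the `n`-differential
`ω_{g,n} = (2^{1-g} W_{g,n}(X_1, …, X_n) + δ_{g,0} δ_{n,2} ½ B(X_1, X_2)) d log X_1 ⋯ d log X_n`. -/
def omega (g n : ℕ) : Frac n :=
  ((2 : Frac n) ^ (1 - (g : ℤ)) * algebraMap (MvPowerSeries (Fin n) ℂ) (Frac n) (WofZ psi y g n) +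
      omegaShift psi y g n) * ∏ i, dlogX psi y i

end

end BKP

/-! Each correlator is a vacuum expectation value of operators that act on the fermions by
commutation, so it is governed by one-particle matrices indexed by ℤ (`IsQuad`). The matrix of J_k
is the shift by k. Conjugation by 𝒟 multiplies its entries by e^{2(T_j - T_{j-k})}. Since ⟨0|𝒟 = ⟨0|
and ⟨0|J_- = 0, the factor e^{J_-} turns into nested commutators (`vev_mul_pow`, `vev_mul_mul_pow`),
and Wick's theorem (`IsQuad.vev_mul`) evaluates what remains.

Genus zero is the semiclassical limit. The matrix entries are functions of ħ and ħj with a symbol at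
ħ = 0 (`HasSymbol`), initially e^{2kψ}. A commutator with ħ⁻¹ s_m J_{-m} is a finite difference of
step m, hence ħ m d/dx to leading order. It absorbs the ħ⁻¹ and the 1/m of s_m and leaves the
coefficient of z^m in y (`HasMatrixSymbol.nested_succ`). After l commutators the symbol is [z^{k-n}]
y^l times the l-th derivative of e^{2kψ} (`hasMatrixSymbol_nested`), and summing with 1/l!
substitutes y(z) for x. The pairings of modes a, b with a + b = n add up to n/2 (`sum_pairing`).
With v = z/X = e^{2ψ(y)} and odd k, m, [X^k] W_{0,1} = ½ [z^k] F_k(y), F_k' = e^{2kψ}, F_k(0) = 0,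
and [X_1^k X_2^m] W_{0,2} = ∑_{n odd} (n/2) [z^{k-n}] v^k [z^{m+n}] v^m.

Lagrange inversion (`lagrange_inversion`) says that H has the coefficients [z^k] Q H v^k in powers
of X. It gives W_{0,1} = y/2. In W_{0,2} the first factors sum to z_1^n / Q_1, and the second to
z_2^{-n} / Q_2 minus its principal part in X_2. Now ∑_{n odd} n t^n is ½ B(z,w) at t = z/w. The
terms z_1^n z_2^{-n} therefore produce B(z_1,z_2), and the principal parts produce B(X_1,X_2)
through z (X^j)' = j Q X^j (`sum_oddSeries_mul_coeff`). In ω_{0,2} the two terms B(X_1,X_2) cancel.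
-/

namespace BKP

noncomputable section

open scoped Nat

/-! ### Canonical anticommutation relations. -/

section CAR

variable {K : Type*} [Field K]

/-- The sign `(-1)^{#{i ∈ S : i > j}}` changes when a larger element is inserted. -/
theorem fermionSign_insert {i j : ℕ} {S : Finset ℕ} (h : i ∉ S) :
    fermionSign K j (insert i S) = (if j < i then -1 else 1) * fermionSign K j S := by
  unfold fermionSign
  rw [Finset.filter_insert]
  split_ifs with hji
  · rw [Finset.card_insert_of_notMem (by simp [h]), pow_succ]; ring
  · simp

theorem fermionSign_erase {i j : ℕ} {S : Finset ℕ} (h : i ∈ S) :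
    fermionSign K j (S.erase i) = (if j < i then -1 else 1) * fermionSign K j S := by
  conv_rhs => rw [← Finset.insert_erase h]
  rw [fermionSign_insert (Finset.notMem_erase i S), ← mul_assoc]
  split_ifs <;> simp

theorem fermionSign_mul_self (j : ℕ) (S : Finset ℕ) :
    fermionSign K j S * fermionSign K j S = 1 := by
  unfold fermionSign
  rw [← mul_pow]; simp

variable (K)

/-- The creation operator of the mode `j`. -/
def create (j : ℕ) : Module.End K (Fock K) :=
  Finsupp.linearCombination K fun S =>
    if j ∈ S then 0 else fermionSign K j S • basisVec K (insert j S)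

/-- The annihilation operator of the mode `j`. -/
def annihilate (j : ℕ) : Module.End K (Fock K) :=
  Finsupp.linearCombination K fun S =>
    if j ∈ S then fermionSign K j S • basisVec K (S.erase j) else 0

variable {K}

theorem create_basisVec (j : ℕ) (S : Finset ℕ) : create K j (basisVec K S) =
    if j ∈ S then 0 else fermionSign K j S • basisVec K (insert j S) := by
  simp [create, basisVec]

theorem annihilate_basisVec (j : ℕ) (S : Finset ℕ) : annihilate K j (basisVec K S) =
    if j ∈ S then fermionSign K j S • basisVec K (S.erase j) else 0 := by
  simp [annihilate, basisVec]

theorem end_ext {P Q : Module.End K (Fock K)}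
    (h : ∀ S, P (basisVec K S) = Q (basisVec K S)) : P = Q := by
  refine Finsupp.lhom_ext fun S c => ?_
  have : Finsupp.single S c = c • basisVec K S := by simp [basisVec]
  rw [this, map_smul, map_smul, h]

/-- For distinct modes both orders insert the same pair, and the sign of the second insertion sees
the first one only if that index is larger. Hence exactly one of the two orders acquires an extra
-1. The next two relations rest on the same count. -/
theorem create_mul_create_add (i j : ℕ) :
    create K i * create K j + create K j * create K i = 0 := by
  refine end_ext fun S => ?_
  simp only [LinearMap.add_apply, Module.End.mul_apply, create_basisVec, LinearMap.zero_apply]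
  rcases eq_or_ne i j with rfl | hij
  · by_cases hi : i ∈ S <;> simp [hi, create_basisVec]
  · by_cases hi : i ∈ S <;> by_cases hj : j ∈ S <;>
      simp [hi, hj, create_basisVec, hij, hij.symm, fermionSign_insert]
    rw [Finset.insert_comm]
    rcases lt_or_gt_of_ne hij with h | h <;> simp [h, not_lt.2 h.le, smul_smul, mul_comm (fermionSign K i S)]

theorem annihilate_mul_annihilate_add (i j : ℕ) :
    annihilate K i * annihilate K j + annihilate K j * annihilate K i = 0 := by
  refine end_ext fun S => ?_
  simp only [LinearMap.add_apply, Module.End.mul_apply, annihilate_basisVec, LinearMap.zero_apply]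
  rcases eq_or_ne i j with rfl | hij
  · by_cases hi : i ∈ S <;> simp [hi, annihilate_basisVec]
  · by_cases hi : i ∈ S <;> by_cases hj : j ∈ S <;>
      simp [hi, hj, annihilate_basisVec, hij, hij.symm, fermionSign_erase]
    rw [Finset.erase_right_comm]
    rcases lt_or_gt_of_ne hij with h | h <;> simp [h, not_lt.2 h.le, smul_smul, mul_comm (fermionSign K i S)]

theorem create_mul_annihilate_add (i j : ℕ) :
    create K i * annihilate K j + annihilate K j * create K i = if i = j then 1 else 0 := by
  refine end_ext fun S => ?_
  simp only [LinearMap.add_apply, Module.End.mul_apply, annihilate_basisVec, create_basisVec]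
  rcases eq_or_ne i j with rfl | hij
  · by_cases hi : i ∈ S <;> simp [hi, annihilate_basisVec, create_basisVec, fermionSign_erase,
      fermionSign_insert, smul_smul, fermionSign_mul_self]
  · by_cases hi : i ∈ S <;> by_cases hj : j ∈ S <;>
      simp [hi, hj, annihilate_basisVec, create_basisVec, hij, hij.symm, fermionSign_erase,
        fermionSign_insert]
    rw [Finset.erase_insert_of_ne hij]
    rcases lt_or_gt_of_ne hij with h | h <;> simp [h, not_lt.2 h.le, smul_smul, mul_comm (fermionSign K i S)]

theorem fermion_basisVec (k : ℤ) (S : Finset ℕ) :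
    fermion K k (basisVec K S) = fermionOnBasis K k S := by
  simp [fermion, basisVec]

theorem fermion_natCast {k : ℕ} (hk : 0 < k) : fermion K k = create K k := by
  refine end_ext fun S => ?_
  simp [fermion_basisVec, create_basisVec, fermionOnBasis, hk]

/-- The mode 0 is its own conjugate, so φ_0 both creates and annihilates it; the coefficient 1/2 is
what makes φ_0² = 1/2. -/
theorem fermion_zero : fermion K 0 = create K 0 + (1 / 2 : K) • annihilate K 0 := by
  refine end_ext fun S => ?_
  by_cases h : 0 ∈ S <;>
    simp [fermion_basisVec, create_basisVec, annihilate_basisVec, fermionOnBasis, h, smul_smul]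

theorem fermion_neg_natCast {k : ℕ} (hk : 0 < k) :
    fermion K (-(k : ℤ)) = (-1 : K) ^ k • annihilate K k := by
  refine end_ext fun S => ?_
  by_cases h : k ∈ S <;>
    simp [fermion_basisVec, annihilate_basisVec, fermionOnBasis, h, smul_smul, hk.ne']

theorem int_trichotomy (k : ℤ) :
    (∃ n : ℕ, 0 < n ∧ k = n) ∨ k = 0 ∨ ∃ n : ℕ, 0 < n ∧ k = -(n : ℤ) := by
  rcases lt_trichotomy k 0 with h | h | h
  · exact .inr (.inr ⟨k.natAbs, by omega, by omega⟩)
  · exact .inr (.inl h)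
  · exact .inl ⟨k.natAbs, by omega, by omega⟩

/-- The canonical anticommutation relations of the neutral fermions. -/
theorem fermion_anticomm [NeZero (2 : K)] (k m : ℤ) :
    fermion K k * fermion K m + fermion K m * fermion K k =
      if k + m = 0 then (-1 : K) ^ k • 1 else 0 := by
  have cc := create_mul_create_add (K := K)
  have aa := annihilate_mul_annihilate_add (K := K)
  have ca := create_mul_annihilate_add (K := K)
  have ac : ∀ i j, annihilate K i * create K j + create K j * annihilate K i =
      if i = j then 1 else 0 := fun i j => by
    rw [add_comm, ca]; simp [eq_comm]
  have two : (2 : K) ≠ 0 := NeZero.ne 2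
  rcases int_trichotomy k with ⟨a, ha, rfl⟩ | rfl | ⟨a, ha, rfl⟩ <;>
    rcases int_trichotomy m with ⟨b, hb, rfl⟩ | rfl | ⟨b, hb, rfl⟩
  · rw [fermion_natCast ha, fermion_natCast hb, cc, if_neg (by omega)]
  · rw [fermion_natCast ha, fermion_zero, if_neg (by omega)]
    have h1 := cc a 0; have h2 := ca a 0
    rw [if_neg (by omega)] at h2
    simp only [mul_add, add_mul, mul_smul_comm, smul_mul_assoc]
    rw [add_add_add_comm, h1, ← smul_add, h2]; simp
  · rw [fermion_natCast ha, fermion_neg_natCast hb]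
    simp only [mul_smul_comm, smul_mul_assoc]
    rw [← smul_add, ca]
    by_cases h : a = b
    · subst h; simp
    · rw [if_neg h, if_neg (by omega)]; simp
  · rw [fermion_natCast hb, fermion_zero, if_neg (by omega)]
    have h1 := cc 0 b; have h2 := ac 0 b
    rw [if_neg (by omega)] at h2
    simp only [mul_add, add_mul, mul_smul_comm, smul_mul_assoc]
    rw [add_add_add_comm, h1, ← smul_add, h2]; simp
  · have h1 := cc 0 0; have h2 := aa 0 0; have h3 := ca 0 0; have h4 := ac 0 0
    rw [fermion_zero]
    simp only [mul_add, add_mul, mul_smul_comm, smul_mul_assoc]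
    have hc : create K 0 * create K 0 = 0 := by
      refine end_ext fun S => ?_
      by_cases h : 0 ∈ S <;> simp [create_basisVec, h]
    have hd : annihilate K 0 * annihilate K 0 = 0 := by
      refine end_ext fun S => ?_
      by_cases h : 0 ∈ S <;> simp [annihilate_basisVec, h]
    rw [if_pos rfl] at h3
    simp only [hc, hd, smul_zero, add_zero, zero_add]
    rw [← smul_add, add_comm (annihilate K 0 * create K 0), h3, ← add_smul]
    rw [add_halves]; simp
  · rw [fermion_zero, fermion_neg_natCast hb, if_neg (by omega)]
    have h1 := ca 0 b; have h2 := aa 0 b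
    rw [if_neg (by omega)] at h1
    simp only [mul_add, add_mul, mul_smul_comm, smul_mul_assoc, smul_add]
    rw [add_add_add_comm, ← smul_add, h1, smul_smul, smul_smul, mul_comm (1 / 2 : K), ← smul_add,
      h2]; simp
  · rw [fermion_natCast hb, fermion_neg_natCast ha]
    simp only [mul_smul_comm, smul_mul_assoc]
    rw [← smul_add, ac]
    by_cases h : a = b
    · subst h; simp [← inv_pow]
    · rw [if_neg h, if_neg (by omega)]; simp
  · rw [fermion_zero, fermion_neg_natCast ha, if_neg (by omega)]
    have h1 := ac a 0; have h2 := aa a 0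
    rw [if_neg (by omega)] at h1
    simp only [mul_add, add_mul, mul_smul_comm, smul_mul_assoc, smul_add]
    rw [add_add_add_comm, ← smul_add, h1, smul_smul, smul_smul, mul_comm (1 / 2 : K), ← smul_add,
      h2]; simp
  · rw [fermion_neg_natCast hb, fermion_neg_natCast ha, if_neg (by omega)]
    simp only [mul_smul_comm, smul_mul_assoc]
    rw [smul_smul, smul_smul, mul_comm, ← smul_add, aa]; simp

end CAR

/-! ### Operators acting on the fermions through a one-particle matrix, and Wick's theorem. -/

section Quadratic

variable {K : Type*} [Field K]

theorem fock_linear_ext {M : Type*} [AddCommMonoid M] [Module K M] {f g : Fock K →ₗ[K] M}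
    (h : ∀ S, f (basisVec K S) = g (basisVec K S)) : f = g := by
  refine Finsupp.lhom_ext fun S c => ?_
  have : Finsupp.single S c = c • basisVec K S := by simp [basisVec]
  rw [this, map_smul, map_smul, h]

theorem end_sub_mul (P Q R : Module.End K (Fock K)) : (P - Q) * R = P * R - Q * R := sub_mul P Q R

theorem end_mul_sub (P Q R : Module.End K (Fock K)) : P * (Q - R) = P * Q - P * R := mul_sub P Q R

/-- Reads off one coefficient for arbitrary v: both sides are linear functionals of v, so basis
vectors suffice. The sign may be taken on S rather than on `insert j S`, because only elements
strictly above j are counted. -/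
theorem annihilate_apply (j : ℕ) (v : Fock K) (S : Finset ℕ) :
    annihilate K j v S = if j ∈ S then 0 else fermionSign K j S * v (insert j S) := by
  have key : (Finsupp.lapply S ∘ₗ annihilate K j : Fock K →ₗ[K] K) =
      (if j ∈ S then (0 : K) else fermionSign K j S) • Finsupp.lapply (insert j S) := by
    refine fock_linear_ext fun U => ?_
    simp only [LinearMap.comp_apply, annihilate_basisVec, Finsupp.lapply_apply,
      LinearMap.smul_apply, smul_eq_mul]
    by_cases hU : j ∈ U
    · by_cases hS : j ∈ S
      · have : U.erase j ≠ S := fun h => by rw [← h] at hS; simp at hS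
        simp [hU, hS, basisVec, Finsupp.single_apply, this]
      · by_cases h : U = insert j S
        · subst h
          simp [hS, basisVec, fermionSign_insert]
        · have : U.erase j ≠ S := fun h' => h (by rw [← h', Finset.insert_erase hU])
          simp [hU, hS, basisVec, this, h]
    · have : U ≠ insert j S := fun h => hU (by simp [h])
      simp [hU, basisVec, this]
  have := LinearMap.congr_fun key v
  simp only [LinearMap.comp_apply, Finsupp.lapply_apply, LinearMap.smul_apply, smul_eq_mul] at this
  rw [this]
  split_ifs <;> simp

theorem create_apply_empty (j : ℕ) (v : Fock K) : create K j v ∅ = 0 := by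
  have key : (Finsupp.lapply ∅ ∘ₗ create K j : Fock K →ₗ[K] K) = 0 := by
    refine fock_linear_ext fun U => ?_
    simp only [LinearMap.comp_apply, create_basisVec, Finsupp.lapply_apply, LinearMap.zero_apply]
    by_cases hU : j ∈ U <;> simp [hU, basisVec]
  exact LinearMap.congr_fun key v

theorem fermion_apply_empty_of_pos {k : ℤ} (hk : 0 < k) (v : Fock K) : fermion K k v ∅ = 0 := by
  lift k to ℕ using hk.le
  rw [fermion_natCast (by exact_mod_cast hk), create_apply_empty]

theorem fermion_basisVec_of_neg {k : ℤ} {S : Finset ℕ} (hk : k < 0) (h : k.natAbs ∉ S) :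
    fermion K k (basisVec K S) = 0 := by
  rw [fermion_basisVec, fermionOnBasis, if_neg (by omega), if_neg (by omega), if_neg h]

/-- A mode above all occupied ones passes no fermion and produces no sign, so basis vectors can be
peeled from the top. -/
theorem basisVec_insert {a : ℕ} {S : Finset ℕ} (ha : 0 < a) (h : ∀ i ∈ S, i < a) :
    basisVec K (insert a S) = fermion K a (basisVec K S) := by
  have h1 : a ∉ S := fun h' => lt_irrefl _ (h a h')
  have h2 : S.filter (fun i => a < i) = ∅ :=
    Finset.filter_eq_empty_iff.2 fun i hi => not_lt.2 (h i hi).le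
  rw [fermion_natCast ha, create_basisVec, if_neg h1, fermionSign, h2]
  simp

/-- The value `⟨0| φ_{-b} φ_b |0⟩`, `b ≥ 0`. -/
def pairing (K : Type*) [Field K] (b : ℕ) : K := if b = 0 then 1 / 2 else (-1) ^ b

theorem fermion_basisVec_apply_empty (i : ℤ) (S : Finset ℕ) :
    fermion K i (basisVec K S) ∅ = if i ≤ 0 ∧ S = {i.natAbs} then pairing K i.natAbs else 0 := by
  rcases int_trichotomy i with ⟨a, ha, rfl⟩ | rfl | ⟨a, ha, rfl⟩
  · rw [fermion_apply_empty_of_pos (by omega), if_neg (by omega)]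
  · rw [fermion_zero, LinearMap.add_apply, Finsupp.add_apply, create_apply_empty,
      LinearMap.smul_apply, Finsupp.smul_apply, annihilate_apply]
    by_cases h : S = {0} <;> simp [h, basisVec, pairing, fermionSign]
  · rw [fermion_neg_natCast ha, LinearMap.smul_apply, Finsupp.smul_apply, annihilate_apply]
    by_cases h : S = {a} <;>
      simp [h, basisVec, pairing, fermionSign, ha.ne']

theorem fermion_vacuum_apply_singleton (i : ℤ) (b : ℕ) :
    fermion K i (basisVec K ∅) {b} = if i = b then 1 else 0 := by
  rcases int_trichotomy i with ⟨a, ha, rfl⟩ | rfl | ⟨a, ha, rfl⟩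
  · rw [fermion_natCast ha, create_basisVec]
    by_cases h : a = b <;> simp [h, basisVec, fermionSign]
  · rw [fermion_zero, LinearMap.add_apply, LinearMap.smul_apply, create_basisVec,
      annihilate_basisVec]
    by_cases h : 0 = b
    · subst h; simp [basisVec, fermionSign]
    · have : (0 : ℤ) ≠ b := by omega
      simp [h, this, basisVec, fermionSign]
  · rw [fermion_basisVec_of_neg (by omega) (by simp), if_neg (by omega)]; rfl

/-- The field `∑ x_j φ_j` of a finitely supported sequence. -/
def field : (ℤ →₀ K) →ₗ[K] Module.End K (Fock K) := Finsupp.linearCombination K (fermion K)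

theorem field_single (j : ℤ) (c : K) : field (Finsupp.single j c) = c • fermion K j := by
  simp [field]

theorem field_basisVec_apply_empty (x : ℤ →₀ K) (S : Finset ℕ) :
    field x (basisVec K S) ∅ = x.sum fun i c =>
      c * if i ≤ 0 ∧ S = {i.natAbs} then pairing K i.natAbs else 0 := by
  simp [field, Finsupp.linearCombination_apply, Finsupp.sum, fermion_basisVec_apply_empty,
    Finsupp.finsetSum_apply]

theorem field_singleton_apply_empty (x : ℤ →₀ K) (b : ℕ) :
    field x (basisVec K {b}) ∅ = x (-b) * pairing K b := by
  rw [field_basisVec_apply_empty, Finsupp.sum_eq_single (-(b : ℤ))]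
  · simp
  · intro i _ hi
    rw [if_neg, mul_zero]
    rintro ⟨h1, h2⟩
    rw [Finset.singleton_inj] at h2
    omega
  · simp

theorem field_vacuum_apply_singleton (x : ℤ →₀ K) (b : ℕ) :
    field x (basisVec K ∅) {b} = x b := by
  have : field x (basisVec K ∅) {b} = x.sum fun i c => c * if i = b then 1 else 0 := by
    simp [field, Finsupp.linearCombination_apply, Finsupp.sum, fermion_vacuum_apply_singleton,
      Finsupp.finsetSum_apply]
  rw [this, Finsupp.sum_eq_single (b : ℤ)] <;> simp +contextual

/-- The diagonal operator with eigenvalue `f S` on the basis vector of `S`. -/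
def diagonalOp (f : Finset ℕ → K) : Module.End K (Fock K) :=
  Finsupp.linearCombination K fun S => f S • basisVec K S

theorem diagonalOp_basisVec (f : Finset ℕ → K) (S : Finset ℕ) :
    diagonalOp f (basisVec K S) = f S • basisVec K S := by
  simp [diagonalOp, basisVec]

theorem diagonalOp_apply (f : Finset ℕ → K) (v : Fock K) (S : Finset ℕ) :
    diagonalOp f v S = f S * v S := by
  have key : (Finsupp.lapply S ∘ₗ diagonalOp f : Fock K →ₗ[K] K) = f S • Finsupp.lapply S := by
    refine fock_linear_ext fun U => ?_
    simp only [LinearMap.comp_apply, diagonalOp_basisVec, Finsupp.lapply_apply,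
      LinearMap.smul_apply, map_smul]
    by_cases h : U = S <;> simp [basisVec, h]
  exact LinearMap.congr_fun key v

/-- The fermion parity `(-1)^{|S|}`. -/
def parityOp (K : Type*) [Field K] : Module.End K (Fock K) := diagonalOp fun S => (-1 : K) ^ S.card

/-- The energy `∑_{i ∈ S} i`. -/
def energyOp (K : Type*) [Field K] : Module.End K (Fock K) :=
  diagonalOp fun S => ((∑ i ∈ S, i : ℕ) : K)

theorem parityOp_mul_fermion (k : ℤ) : parityOp K * fermion K k = -(fermion K k * parityOp K) := by
  refine end_ext fun S => ?_
  simp only [parityOp, Module.End.mul_apply, diagonalOp_basisVec, LinearMap.neg_apply, map_smul,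
    fermion_basisVec, fermionOnBasis]
  split_ifs with h1 h2 h3 h4 h5
  · simp
  · simp [diagonalOp_basisVec, Finset.card_insert_of_notMem h2, pow_succ, smul_smul, mul_comm]
  · have := Finset.card_erase_add_one h4
    simp [diagonalOp_basisVec, ← this, pow_succ, smul_smul, mul_comm]
  · simp [diagonalOp_basisVec, Finset.card_insert_of_notMem h4, pow_succ, smul_smul, mul_comm]
  · have := Finset.card_erase_add_one h5
    simp [diagonalOp_basisVec, ← this, pow_succ, smul_smul, mul_comm]
  · simp

theorem energyOp_mul_fermion (k : ℤ) :
    energyOp K * fermion K k = fermion K k * energyOp K + (k : K) • fermion K k := by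
  refine end_ext fun S => ?_
  simp only [energyOp, Module.End.mul_apply, diagonalOp_basisVec, LinearMap.add_apply, map_smul,
    fermion_basisVec, LinearMap.smul_apply, fermionOnBasis]
  split_ifs with h1 h2 h3 h4 h5
  · simp
  · have hk : ((k.natAbs : ℕ) : K) = k := by
      rw [← Int.cast_natCast, Int.natAbs_of_nonneg h1.le]
    simp only [map_smul, diagonalOp_basisVec, Finset.sum_insert h2, smul_smul, ← add_smul,
      Nat.cast_add, hk]
    ring_nf
  · have := Finset.add_sum_erase S id h4
    simp only [id] at this
    simp only [map_smul, diagonalOp_basisVec, smul_smul, ← add_smul, ← this, h3]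
    push_cast; ring_nf
  · simp only [map_smul, diagonalOp_basisVec, smul_smul, ← add_smul, Finset.sum_insert h4, h3]
    push_cast; ring_nf
  · have := Finset.add_sum_erase S id h5
    simp only [id] at this
    have hk : ((k.natAbs : ℕ) : K) = -k := by
      rw [← Int.cast_natCast, show ((k.natAbs : ℕ) : ℤ) = -k by omega, Int.cast_neg]
    simp only [map_smul, diagonalOp_basisVec, smul_smul, ← add_smul, ← this, Nat.cast_add, hk]
    ring_nf
  · simp

/-- `P` is even and `[P, ∑ x_j φ_j] = ∑ (A x)_j φ_j`. -/
structure IsQuad (P : Module.End K (Fock K)) (A : Module.End K (ℤ →₀ K)) : Prop where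
  comm : ∀ x, P * field x = field x * P + field (A x)
  even : parityOp K * P = P * parityOp K

theorem IsQuad.mk' {P : Module.End K (Fock K)} {A : Module.End K (ℤ →₀ K)}
    (h : ∀ j, P * fermion K j = fermion K j * P + field (A (Finsupp.single j 1)))
    (h' : parityOp K * P = P * parityOp K) : IsQuad P A := by
  refine ⟨fun x => ?_, h'⟩
  induction x using Finsupp.induction_linear with
  | zero => simp
  | add x y hx hy => simp only [map_add, mul_add, add_mul, hx, hy]; abel
  | single j c =>
    have : Finsupp.single j c = c • Finsupp.single j (1 : K) := by simp
    rw [this, map_smul, map_smul, map_smul, field_single, one_smul, mul_smul_comm, h, smul_add,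
      smul_mul_assoc]

theorem IsQuad.comm_fermion {P : Module.End K (Fock K)} {A : Module.End K (ℤ →₀ K)}
    (h : IsQuad P A) (j : ℤ) :
    P * fermion K j = fermion K j * P + field (A (Finsupp.single j 1)) := by
  have := h.comm (Finsupp.single j 1)
  rwa [field_single, one_smul] at this

theorem IsQuad.add {P P' : Module.End K (Fock K)} {A A' : Module.End K (ℤ →₀ K)}
    (h : IsQuad P A) (h' : IsQuad P' A') : IsQuad (P + P') (A + A') :=
  ⟨fun x => by simp only [add_mul, mul_add, LinearMap.add_apply, map_add, h.comm, h'.comm]; abel,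
    by rw [add_mul, mul_add, h.even, h'.even]⟩

theorem IsQuad.smul {P : Module.End K (Fock K)} {A : Module.End K (ℤ →₀ K)}
    (h : IsQuad P A) (c : K) : IsQuad (c • P) (c • A) :=
  ⟨fun x => by
    simp only [smul_mul_assoc, mul_smul_comm, LinearMap.smul_apply, map_smul, h.comm, smul_add],
    by rw [smul_mul_assoc, mul_smul_comm, h.even]⟩

theorem isQuad_zero : IsQuad (0 : Module.End K (Fock K)) 0 := ⟨fun x => by simp, by simp⟩

theorem IsQuad.sum {ι : Type*} (s : Finset ι) {P : ι → Module.End K (Fock K)}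
    {A : ι → Module.End K (ℤ →₀ K)} (h : ∀ i ∈ s, IsQuad (P i) (A i)) :
    IsQuad (∑ i ∈ s, P i) (∑ i ∈ s, A i) := by
  classical
  induction s using Finset.induction_on with
  | empty => simpa using isQuad_zero
  | insert i s hi ih =>
    rw [Finset.sum_insert hi, Finset.sum_insert hi]
    exact (h i (by simp)).add (ih fun j hj => h j (by simp [hj]))

/-- The Jacobi identity: commutators of operators correspond to commutators of their one-particle
matrices. -/
theorem IsQuad.commutator {P P' : Module.End K (Fock K)} {A A' : Module.End K (ℤ →₀ K)}
    (h : IsQuad P A) (h' : IsQuad P' A') : IsQuad (P * P' - P' * P) (A * A' - A' * A) := by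
  refine ⟨fun x => ?_, ?_⟩
  · have e1 : P * P' * field x = field x * P * P' + field (A x) * P' + field (A' x) * P +
        field (A (A' x)) := by
      rw [mul_assoc, h'.comm, mul_add, h.comm (A' x), ← mul_assoc, h.comm x]; noncomm_ring
    have e2 : P' * P * field x = field x * P' * P + field (A' x) * P + field (A x) * P' +
        field (A' (A x)) := by
      rw [mul_assoc, h.comm, mul_add, h'.comm (A x), ← mul_assoc, h'.comm x]; noncomm_ring
    rw [end_sub_mul, e1, e2, end_mul_sub]
    simp only [LinearMap.sub_apply, Module.End.mul_apply, map_sub]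
    noncomm_ring
  · rw [end_mul_sub, end_sub_mul, ← mul_assoc, ← mul_assoc, h.even, h'.even, mul_assoc, mul_assoc, h.even,
      h'.even]
    noncomm_ring

/-- As φ_{-a} kills the vacuum, the commutation relation gives φ_{-a} P|0⟩ = -∑ (A e_{-a})_j φ_j
|0⟩. Up to (-1)^a, the coefficient of the left side at {b} is that of P|0⟩ at {a, b}; there is no
further sign because b < a. -/
theorem IsQuad.vacuum_apply [NeZero (2 : K)] {P : Module.End K (Fock K)}
    {A : Module.End K (ℤ →₀ K)} (h : IsQuad P A) {a b : ℕ} (hab : b < a) :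
    P (basisVec K ∅) (insert a {b}) = -(-1) ^ a * A (Finsupp.single (-a : ℤ) 1) b := by
  have ha : 0 < a := by omega
  have h1 := LinearMap.congr_fun (h.comm_fermion (-a)) (basisVec K ∅)
  simp only [Module.End.mul_apply, LinearMap.add_apply] at h1
  rw [fermion_basisVec_of_neg (by omega) (by simp), map_zero] at h1
  have h2 := DFunLike.congr_fun h1 {b}
  rw [Finsupp.add_apply, field_vacuum_apply_singleton, fermion_neg_natCast ha,
    LinearMap.smul_apply, Finsupp.smul_apply, annihilate_apply, if_neg (by simp; omega),
    fermionSign, Finset.filter_singleton, if_neg (by omega)] at h2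
  simp only [Finset.card_empty, pow_zero, one_mul, Finsupp.coe_zero, Pi.zero_apply,
    smul_eq_mul] at h2
  have h3 : ((-1 : K) ^ a) * (-1) ^ a = 1 := by rw [← mul_pow]; simp
  linear_combination (-1) ^ a * h2.symm - P (basisVec K ∅) (insert a {b}) * h3

/-- Parity excludes the set {0}, which peeling the top mode cannot reach since that requires a
positive mode. -/
theorem IsQuad.vacuum_apply_zero [NeZero (2 : K)] {P : Module.End K (Fock K)}
    {A : Module.End K (ℤ →₀ K)} (h : IsQuad P A) : P (basisVec K ∅) {0} = 0 := by
  have h1 := DFunLike.congr_fun (LinearMap.congr_fun h.even (basisVec K ∅)) {0}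
  simp only [Module.End.mul_apply, parityOp, diagonalOp_basisVec, diagonalOp_apply] at h1
  simp only [Finset.card_singleton, pow_one, Finset.card_empty, pow_zero, one_smul] at h1
  have : (2 : K) * P (basisVec K ∅) {0} = 0 := by linear_combination -h1
  exact (mul_eq_zero.1 this).resolve_left (NeZero.ne 2)

/-- Commute P past the top fermion φ_a and use ⟨0|φ_a = 0 for a > 0. -/
theorem IsQuad.apply_empty {P : Module.End K (Fock K)} {A : Module.End K (ℤ →₀ K)}
    (h : IsQuad P A) {a : ℕ} (ha : 0 < a) {S : Finset ℕ} (hS : ∀ i ∈ S, i < a) :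
    P (basisVec K (insert a S)) ∅ = field (A (Finsupp.single (a : ℤ) 1)) (basisVec K S) ∅ := by
  have h1 := LinearMap.congr_fun (h.comm_fermion a) (basisVec K S)
  rw [basisVec_insert ha hS]
  simp only [Module.End.mul_apply, LinearMap.add_apply] at h1
  rw [h1, Finsupp.add_apply, fermion_apply_empty_of_pos (by omega), zero_add]

/-- Wick's theorem for two quadratic operators. -/
theorem IsQuad.vev_mul [NeZero (2 : K)] {P P' : Module.End K (Fock K)}
    {A A' : Module.End K (ℤ →₀ K)} (h : IsQuad P A) (h' : IsQuad P' A') (N : ℕ)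
    (hN : ∀ a b : ℕ, N ≤ a → A' (Finsupp.single (-a : ℤ) 1) b = 0) :
    vev K (P * P') = vev K P * vev K P' + ∑ a ∈ Finset.range N, ∑ b ∈ Finset.range a,
      -(-1) ^ a * pairing K b *
        (A (Finsupp.single (a : ℤ) 1) (-b) * A' (Finsupp.single (-a : ℤ) 1) b) := by
  classical
  set v := P' (basisVec K ∅) with hv
  let pair : (Σ _ : ℕ, ℕ) → Finset ℕ := fun p => insert p.1 {p.2}
  let I : Finset (Σ _ : ℕ, ℕ) := (Finset.range N).sigma fun a => Finset.range a
  have hI : ∀ p, p ∈ I ↔ p.1 < N ∧ p.2 < p.1 := fun p => by simp [I]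
  -- A complete set of states is inserted between the two factors; the sum is finite because P'|0⟩
  -- has finite support.
  have e0 : vev K (P * P') = ∑ S ∈ v.support, v S * P (basisVec K S) ∅ := by
    have : v = ∑ S ∈ v.support, v S • basisVec K S := by
      conv_lhs => rw [← Finsupp.sum_single v]
      simp [Finsupp.sum, basisVec]
    rw [vev, Module.End.mul_apply, ← hv]
    conv_lhs => rw [this]
    simp [Finsupp.finsetSum_apply]
  have hinj : Set.InjOn pair I := by
    rintro ⟨a, b⟩ hp ⟨c, d⟩ hq heq
    have hp' := (hI _).1 hp; have hq' := (hI _).1 hq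
    simp only [pair] at heq hp' hq'
    have h1 : a ∈ ({c, d} : Finset ℕ) := heq ▸ (by simp)
    have h2 : b ∈ ({c, d} : Finset ℕ) := heq ▸ (by simp)
    have h3 : c ∈ ({a, b} : Finset ℕ) := heq ▸ (by simp)
    have h4 : d ∈ ({a, b} : Finset ℕ) := heq ▸ (by simp)
    simp only [Finset.mem_insert, Finset.mem_singleton] at h1 h2 h3 h4
    obtain rfl : a = c := by omega
    obtain rfl : b = d := by omega
    rfl
  have hemp : ∅ ∉ I.image pair := by simp [pair]
  have hsum : ∑ a ∈ Finset.range N, ∑ b ∈ Finset.range a, -(-1) ^ a * pairing K b *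
        (A (Finsupp.single (a : ℤ) 1) (-b) * A' (Finsupp.single (-a : ℤ) 1) b) =
      ∑ S ∈ I.image pair, v S * P (basisVec K S) ∅ := by
    rw [Finset.sum_image hinj, Finset.sum_sigma]
    refine Finset.sum_congr rfl fun a _ => Finset.sum_congr rfl fun b hb => ?_
    have hb := Finset.mem_range.1 hb
    simp only [pair]
    rw [hv, h'.vacuum_apply hb, h.apply_empty (by omega) (by simpa using hb),
      field_singleton_apply_empty]
    ring
  have hvac : vev K P * vev K P' = v ∅ * P (basisVec K ∅) ∅ := by rw [vev, vev, mul_comm]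
  rw [e0, hvac, hsum, ← Finset.sum_insert (f := fun S => v S * P (basisVec K S) ∅) hemp]
  refine Finset.sum_congr_of_eq_on_inter ?_ ?_ fun _ _ _ => rfl
  -- States other than the vacuum and the listed pairs contribute nothing. Once the top mode is
  -- peeled off, a single field remains, and its vacuum coefficient requires exactly one remaining
  -- mode; pairs with top mode at least N are killed by `hN`.
  · intro S _ hS
    rw [Finset.mem_insert, not_or] at hS
    have hne : S.Nonempty := Finset.nonempty_iff_ne_empty.2 hS.1
    set a := S.max' hne with ha
    have hSa : insert a (S.erase a) = S := Finset.insert_erase (S.max'_mem hne)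
    have hlt : ∀ i ∈ S.erase a, i < a := fun i hi => S.lt_max'_of_mem_erase_max' hne hi
    rcases Nat.eq_zero_or_pos a with h0 | hpos
    · have : S = {0} := by
        rw [← hSa, h0, ← insert_empty_eq 0]
        congr 1
        exact Finset.eq_empty_of_forall_notMem fun i hi => by have := hlt i (h0 ▸ hi); omega
      rw [this, hv, h'.vacuum_apply_zero, zero_mul]
    · rw [← hSa, h.apply_empty hpos hlt]
      by_cases hs : ∃ b, S.erase a = {b}
      · obtain ⟨b, hb⟩ := hs
        have hba : b < a := hlt b (by simp [hb])
        have haN : N ≤ a := by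
          by_contra hN'
          exact hS.2 (Finset.mem_image.2 ⟨⟨a, b⟩, (hI _).2 ⟨by simp; omega, hba⟩, by
            simp only [pair]; rw [← hb, hSa]⟩)
        rw [hb, hv, h'.vacuum_apply hba, hN a b haN]; ring
      · rw [field_basisVec_apply_empty]
        simp only [Finsupp.sum]
        rw [Finset.sum_eq_zero, mul_zero]
        intro i _
        rw [if_neg, mul_zero]
        exact fun hi => hs ⟨_, hi.2⟩
  · intro S _ hS
    rw [Finsupp.notMem_support_iff.1 hS, zero_mul]

end Quadratic

/-! ### The bosons J_k, the energy grading and conjugation by 𝒟. -/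

section Bosons

variable {K : Type*} [Field K]

theorem end_neg_mul (P Q : Module.End K (Fock K)) : -P * Q = -(P * Q) :=
  LinearMap.ext fun v => by simp

theorem end_neg_neg (P : Module.End K (Fock K)) : - -P = P := neg_neg P

theorem end_mul_neg (P Q : Module.End K (Fock K)) : P * -Q = -(P * Q) :=
  LinearMap.ext fun v => by simp

theorem end_eq_add_neg_smul {P Q R : Module.End K (Fock K)} (h : P + Q = R) :
    P = R + (-1 : K) • Q := by
  rw [← h]
  exact LinearMap.ext fun v => by simp

theorem fermion_mul_swap [NeZero (2 : K)] {k m : ℤ} (h : k + m ≠ 0) :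
    fermion K k * fermion K m = -(fermion K m * fermion K k) := by
  have := fermion_anticomm (K := K) k m
  rw [if_neg h] at this
  rw [end_eq_add_neg_smul this, zero_add]
  exact neg_one_smul K (fermion K m * fermion K k)

theorem vev_fermion_mul_fermion [NeZero (2 : K)] {k m : ℤ} (h : k + m ≠ 0) :
    vev K (fermion K k * fermion K m) = 0 := by
  rw [vev, Module.End.mul_apply]
  rcases lt_or_ge 0 k with hk | hk
  · rw [fermion_apply_empty_of_pos hk]
  rcases lt_or_ge m 0 with hm | hm
  · rw [fermion_basisVec_of_neg hm (by simp)]; simp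
  · have : fermion K m (basisVec K ∅) = basisVec K {m.natAbs} := by
      rcases hm.eq_or_lt with rfl | hm
      · simp [fermion_basisVec, fermionOnBasis, fermionSign]
      · simp [fermion_basisVec, fermionOnBasis, fermionSign, hm]
    rw [this, fermion_basisVec_apply_empty, if_neg]
    rintro ⟨_, h2⟩
    rw [Finset.singleton_inj] at h2
    omega

theorem normalOrd_eq [NeZero (2 : K)] {k m : ℤ} (h : k + m ≠ 0) :
    normalOrd K k m = fermion K k * fermion K m := by
  rw [normalOrd, vev_fermion_mul_fermion h, zero_smul]
  exact sub_zero (fermion K k * fermion K m)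

/-- The truncation of `J_k` to the summands with `|m| ≤ M`. -/
def bosonTrunc (K : Type*) [Field K] (k : ℤ) (M : ℕ) : Module.End K (Fock K) :=
  (1 / 2 : K) • ∑ m ∈ Finset.Icc (-M : ℤ) M,
    ((-1 : K) ^ (m + 1)) • (fermion K m * fermion K (-m - k))

/-- For |m| this large one of the two factors annihilates a mode that S does not contain. If m < 0
that factor stands on the left; it can be moved to the right because the indices sum to -k ≠ 0. -/
theorem fermion_mul_fermion_basisVec [NeZero (2 : K)] {k m : ℤ} {S : Finset ℕ} (hk : k ≠ 0)
    (hm : k.natAbs + S.sup id < m.natAbs) :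
    fermion K m (fermion K (-m - k) (basisVec K S)) = 0 := by
  have key : ∀ n : ℤ, n < 0 → S.sup id < n.natAbs → fermion K n (basisVec K S) = 0 := by
    intro n hn hS
    refine fermion_basisVec_of_neg hn fun h => ?_
    have : n.natAbs ≤ S.sup id := Finset.le_sup (f := id) h
    omega
  rcases lt_or_ge m 0 with h | h
  · have := LinearMap.congr_fun (fermion_mul_swap (K := K) (k := m) (m := -m - k) (by omega))
      (basisVec K S)
    simp only [Module.End.mul_apply, LinearMap.neg_apply] at this
    rw [this, key m h (by omega), map_zero, neg_zero]
  · rw [key (-m - k) (by omega) (by omega), map_zero]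

theorem boson_basisVec [NeZero (2 : K)] {k : ℤ} (hk : k ≠ 0) (S : Finset ℕ) {M : ℕ}
    (hM : k.natAbs + S.sup id ≤ M) : boson K k (basisVec K S) = bosonTrunc K k M (basisVec K S) := by
  have h1 : boson K k (basisVec K S) =
      (1 / 2 : K) • ∑ᶠ m : ℤ, ((-1 : K) ^ (m + 1)) • normalOrd K m (-m - k) (basisVec K S) := by
    simp [boson, basisVec]
  have h2 : ∀ m : ℤ, normalOrd K m (-m - k) = fermion K m * fermion K (-m - k) := fun m =>
    normalOrd_eq (by omega)
  simp only [h2] at h1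
  rw [h1, finsum_eq_sum_of_support_subset (s := Finset.Icc (-M : ℤ) M)]
  · simp [bosonTrunc]
  · intro m hm
    by_contra hm'
    simp only [Finset.coe_Icc, Set.mem_Icc, not_and_or, not_le] at hm'
    exact hm (by
      simp only [Module.End.mul_apply]
      rw [fermion_mul_fermion_basisVec hk (by omega), smul_zero])

/-- All large truncations agree with J_k on a given vector, so identities between truncations pass
to J_k. -/
theorem exists_boson_eq [NeZero (2 : K)] {k : ℤ} (hk : k ≠ 0) (v : Fock K) :
    ∃ M₀ : ℕ, ∀ M ≥ M₀, boson K k v = bosonTrunc K k M v := by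
  induction v using Finsupp.induction_linear with
  | zero => exact ⟨0, fun M _ => by simp⟩
  | add x y hx hy =>
    obtain ⟨a, ha⟩ := hx; obtain ⟨b, hb⟩ := hy
    exact ⟨max a b, fun M hM => by
      rw [map_add, map_add, ha M (le_trans (le_max_left _ _) hM),
        hb M (le_trans (le_max_right _ _) hM)]⟩
  | single S c =>
    refine ⟨k.natAbs + S.sup id, fun M hM => ?_⟩
    have : Finsupp.single S c = c • basisVec K S := by simp [basisVec]
    rw [this, map_smul, map_smul, boson_basisVec hk S hM]

/-- Only the summands m = j - k and m = -j contract with φ_j. For odd k both yield +φ_{j-k}, and the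
prefactor 1/2 averages them. The bound on M keeps both indices inside the window. -/
theorem bosonTrunc_mul_fermion [NeZero (2 : K)] {k : ℤ} (hk : Odd k) (j : ℤ) {M : ℕ}
    (hM : j.natAbs + k.natAbs ≤ M) :
    bosonTrunc K k M * fermion K j = fermion K j * bosonTrunc K k M + fermion K (j - k) := by
  have h1 : ∀ m : ℤ, fermion K m * fermion K (-m - k) * fermion K j =
      fermion K j * (fermion K m * fermion K (-m - k)) +
        ((if m = j - k then (-1 : K) ^ (-m - k) • fermion K m else 0) +
          (if m = -j then (-((-1 : K) ^ m)) • fermion K (-m - k) else 0)) := by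
    intro m
    have a1 := fermion_anticomm (K := K) (-m - k) j
    have a2 := fermion_anticomm (K := K) m j
    have e1 : fermion K (-m - k) * fermion K j = (if -m - k + j = 0 then (-1 : K) ^ (-m - k) • 1
      else 0) + (-1 : K) • (fermion K j * fermion K (-m - k)) := end_eq_add_neg_smul a1
    have e2 : fermion K m * fermion K j = (if m + j = 0 then (-1 : K) ^ m • 1
      else 0) + (-1 : K) • (fermion K j * fermion K m) := end_eq_add_neg_smul a2
    rw [mul_assoc, e1, mul_add, mul_smul_comm, ← mul_assoc, e2, add_mul, smul_add, smul_mul_assoc,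
      smul_smul, mul_assoc]
    have c1 : -m - k + j = 0 ↔ m = j - k := by omega
    have c2 : m + j = 0 ↔ m = -j := by omega
    simp only [c1, c2]
    rw [add_left_comm, add_comm (_ • _), ← add_assoc]
    split_ifs <;> simp only [mul_smul_comm, mul_one, smul_mul_assoc, one_mul, mul_zero, zero_mul,
      smul_zero, smul_smul, mul_neg, neg_mul, neg_neg, one_smul, add_zero, add_comm]
  have z1 : (-1 : K) ^ (j - k + 1) * (-1) ^ (-(j - k) - k) = 1 := by
    rw [← zpow_add₀ (by simp), Even.neg_one_zpow]
    obtain ⟨c, rfl⟩ := hk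
    exact ⟨-c, by ring⟩
  have z2 : (-1 : K) ^ (-j + 1) * -(-1) ^ (-j) = 1 := by
    rw [mul_neg, ← zpow_add₀ (by simp), Odd.neg_one_zpow]
    · simp
    · exact ⟨-j, by ring⟩
  have i1 : (j - k) ∈ Finset.Icc (-M : ℤ) M := by rw [Finset.mem_Icc]; omega
  have i2 : (-j) ∈ Finset.Icc (-M : ℤ) M := by rw [Finset.mem_Icc]; omega
  simp only [bosonTrunc, smul_mul_assoc, mul_smul_comm, Finset.sum_mul, Finset.mul_sum, h1,
    smul_add, Finset.sum_add_distrib, smul_ite, smul_zero, Finset.sum_ite_eq']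
  rw [if_pos i1, if_pos i2]
  simp only [smul_smul]
  have : -(-j) - k = j - k := by ring
  simp only [z1, z2, mul_one, this]
  rw [← add_smul, add_halves, one_smul]

theorem boson_mul_fermion [NeZero (2 : K)] {k : ℤ} (hk : Odd k) (j : ℤ) :
    boson K k * fermion K j = fermion K j * boson K k + fermion K (j - k) := by
  have hk0 : k ≠ 0 := by rintro rfl; simp at hk
  refine LinearMap.ext fun v => ?_
  obtain ⟨a, ha⟩ := exists_boson_eq hk0 v
  obtain ⟨b, hb⟩ := exists_boson_eq hk0 (fermion K j v)
  set M := max (max a b) (j.natAbs + k.natAbs) with hM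
  have := LinearMap.congr_fun (bosonTrunc_mul_fermion (K := K) hk j (M := M) (le_max_right _ _)) v
  simp only [Module.End.mul_apply, LinearMap.add_apply] at this ⊢
  rw [ha M (by omega), hb M (by omega), this]

/-- An operator that is homogeneous for all bilinears `φ_m φ_{-m-k}` is so for `J_k`. -/
theorem mul_boson_of_bilinear [NeZero (2 : K)] {k : ℤ} (hk : k ≠ 0) (X : Module.End K (Fock K))
    (c : K) (h : ∀ m, X * (fermion K m * fermion K (-m - k)) =
      fermion K m * fermion K (-m - k) * X + c • (fermion K m * fermion K (-m - k))) :
    X * boson K k = boson K k * X + c • boson K k := by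
  refine LinearMap.ext fun v => ?_
  obtain ⟨a, ha⟩ := exists_boson_eq hk v
  obtain ⟨b, hb⟩ := exists_boson_eq hk (X v)
  have key : ∀ M, X * bosonTrunc K k M = bosonTrunc K k M * X + c • bosonTrunc K k M := by
    intro M
    simp only [bosonTrunc, smul_mul_assoc, mul_smul_comm, Finset.sum_mul, Finset.mul_sum, h,
      smul_add, Finset.sum_add_distrib, Finset.smul_sum, smul_smul]
    congr 1
    refine Finset.sum_congr rfl fun m _ => ?_
    congr 1; ring
  have := LinearMap.congr_fun (key (max a b)) v
  simp only [Module.End.mul_apply, LinearMap.add_apply, LinearMap.smul_apply] at this ⊢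
  rw [ha _ (le_max_left a b), hb _ (le_max_right a b), this]

theorem parityOp_mul_boson [NeZero (2 : K)] {k : ℤ} (hk : k ≠ 0) :
    parityOp K * boson K k = boson K k * parityOp K := by
  have := mul_boson_of_bilinear hk (parityOp K) 0 fun m => by
    rw [← mul_assoc, parityOp_mul_fermion, end_neg_mul, mul_assoc, parityOp_mul_fermion, end_mul_neg,
      end_neg_neg, mul_assoc, zero_smul, add_zero]
  rwa [zero_smul, add_zero] at this

/-- `P` changes the energy by `c`. -/
def HasEnergy (P : Module.End K (Fock K)) (c : K) : Prop :=
  energyOp K * P = P * energyOp K + c • P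

theorem HasEnergy.mul {P Q : Module.End K (Fock K)} {c d : K} (hP : HasEnergy P c)
    (hQ : HasEnergy Q d) : HasEnergy (P * Q) (c + d) := by
  unfold HasEnergy at *
  rw [← mul_assoc, hP, add_mul, mul_assoc, hQ, mul_add, smul_mul_assoc, mul_smul_comm, mul_assoc,
    add_smul]
  abel

theorem HasEnergy.one : HasEnergy (1 : Module.End K (Fock K)) 0 := by simp [HasEnergy]

theorem HasEnergy.add {P Q : Module.End K (Fock K)} {c : K} (hP : HasEnergy P c)
    (hQ : HasEnergy Q c) : HasEnergy (P + Q) c := by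
  unfold HasEnergy at *
  rw [mul_add, hP, hQ, add_mul, smul_add]; abel

theorem HasEnergy.smul {P : Module.End K (Fock K)} {c : K} (hP : HasEnergy P c) (d : K) :
    HasEnergy (d • P) c := by
  unfold HasEnergy at *
  rw [mul_smul_comm, hP, smul_mul_assoc, smul_add, smul_comm]

/-- The vacuum has energy 0, so an operator shifting the energy has no vacuum-to-vacuum entry. -/
theorem HasEnergy.vev_eq_zero {P : Module.End K (Fock K)} {c : K} (hP : HasEnergy P c)
    (hc : c ≠ 0) : vev K P = 0 := by
  have h1 := DFunLike.congr_fun (LinearMap.congr_fun hP (basisVec K ∅)) ∅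
  simp only [Module.End.mul_apply, LinearMap.add_apply, LinearMap.smul_apply, energyOp,
    diagonalOp_basisVec, diagonalOp_apply, Finsupp.add_apply, Finsupp.smul_apply, map_smul] at h1
  simp only [Finset.sum_empty, Nat.cast_zero, zero_mul,
    zero_add, smul_eq_mul] at h1
  exact (mul_eq_zero.1 h1.symm).resolve_left hc

theorem hasEnergy_boson [NeZero (2 : K)] {k : ℤ} (hk : k ≠ 0) :
    HasEnergy (boson K k) (-k : K) := by
  refine mul_boson_of_bilinear hk (energyOp K) (-k : K) fun m => ?_
  have h1 : HasEnergy (fermion K m) (m : K) := energyOp_mul_fermion m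
  have h2 : HasEnergy (fermion K (-m - k)) ((-m - k : ℤ) : K) := energyOp_mul_fermion _
  have := h1.mul h2
  rw [HasEnergy] at this
  rw [this]
  congr 2
  push_cast; ring

theorem hasEnergy_diagonalElement (w : ℕ → K) : HasEnergy (diagonalElement w) 0 := by
  rw [HasEnergy, zero_smul, add_zero]
  refine end_ext fun S => ?_
  have : ∀ S, diagonalElement w (basisVec K S) = (∏ k ∈ S, w k) • basisVec K S := fun S =>
    diagonalOp_basisVec _ S
  simp only [Module.End.mul_apply, this, energyOp, map_smul, diagonalOp_basisVec]
  rw [smul_comm]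

/-- The two indices of each bilinear sum to -k > 0, so one of them is positive; moved to the left,
it is killed by ⟨0|. -/
theorem boson_apply_empty [NeZero (2 : K)] {k : ℤ} (hk : k < 0) (v : Fock K) :
    boson K k v ∅ = 0 := by
  obtain ⟨a, ha⟩ := exists_boson_eq hk.ne v
  rw [ha a le_rfl, bosonTrunc, LinearMap.smul_apply, LinearMap.sum_apply, Finsupp.smul_apply,
    Finsupp.finsetSum_apply, Finset.sum_eq_zero, smul_zero]
  intro m _
  rw [LinearMap.smul_apply, Finsupp.smul_apply]
  rcases lt_or_ge 0 m with h | h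
  · rw [Module.End.mul_apply, fermion_apply_empty_of_pos h, smul_zero]
  · rw [fermion_mul_swap (by omega), LinearMap.neg_apply, Finsupp.neg_apply, Module.End.mul_apply,
      fermion_apply_empty_of_pos (by omega), neg_zero, smul_zero]

/-- The operator `z^j ↦ f j z^{j-k}` on sequences. -/
def shiftOp (f : ℤ → K) (k : ℤ) : Module.End K (ℤ →₀ K) :=
  Finsupp.linearCombination K fun j => Finsupp.single (j - k) (f j)

theorem shiftOp_single (f : ℤ → K) (k j : ℤ) :
    shiftOp f k (Finsupp.single j 1) = Finsupp.single (j - k) (f j) := by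
  simp [shiftOp]

theorem isQuad_boson [NeZero (2 : K)] {k : ℤ} (hk : Odd k) :
    IsQuad (boson K k) (shiftOp 1 k) := by
  refine IsQuad.mk' (fun j => ?_) (parityOp_mul_boson (by rintro rfl; simp at hk))
  rw [shiftOp_single, field_single, boson_mul_fermion hk]; simp

/-- The weights extended to all integers by `w (-k) = (w k)⁻¹`. -/
def weightInt (w : ℕ → K) (j : ℤ) : K := if 0 ≤ j then w j.natAbs else (w j.natAbs)⁻¹

theorem diagonalElement_basisVec (w : ℕ → K) (S : Finset ℕ) :
    diagonalElement w (basisVec K S) = (∏ k ∈ S, w k) • basisVec K S := diagonalOp_basisVec _ S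

/-- Inserting a mode multiplies the eigenvalue of 𝒟 by its weight and removing it divides, which is
T_{-k} = -T_k. A single weight serves φ_0, which does both, because w 0 = 1. -/
theorem diagonalElement_mul_fermion {w : ℕ → K} (h0 : w 0 = 1) (hw : ∀ k, w k ≠ 0) (j : ℤ) :
    diagonalElement w * fermion K j = weightInt w j • (fermion K j * diagonalElement w) := by
  refine end_ext fun S => ?_
  simp only [Module.End.mul_apply, LinearMap.smul_apply, diagonalElement_basisVec, map_smul,
    fermion_basisVec, fermionOnBasis, weightInt]
  split_ifs with h1 h2 h3 h4 h5 h6 h7 h8 h9 h10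
  all_goals try omega
  all_goals try simp
  all_goals have hz : j = 0 → w j.natAbs = 1 := (by rintro rfl; simpa using h0)
  · rw [diagonalElement_basisVec, Finset.prod_insert h2]
    simp only [smul_smul]; congr 1; ring
  · rw [diagonalElement_basisVec, ← Finset.mul_prod_erase S w (by assumption), h0, hz (by assumption)]
    simp only [smul_smul]; congr 1; ring
  · rw [diagonalElement_basisVec, Finset.prod_insert (by assumption), h0, hz (by assumption)]
    simp only [smul_smul]; congr 1; ring
  · rw [diagonalElement_basisVec, ← Finset.mul_prod_erase S w (by assumption)]
    simp only [smul_smul]; congr 1; field_simp [hw]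

end Bosons

/-! ### The coefficients of the tau-function as finite sums of vacuum expectation values. -/

section Tau

variable {K : Type*} [Field K]

theorem vev_add (P Q : Module.End K (Fock K)) : vev K (P + Q) = vev K P + vev K Q := by
  simp [vev]

theorem vev_smul (c : K) (P : Module.End K (Fock K)) : vev K (c • P) = c * vev K P := by
  simp [vev]

theorem vev_sum {ι : Type*} (s : Finset ι) (P : ι → Module.End K (Fock K)) :
    vev K (∑ i ∈ s, P i) = ∑ i ∈ s, vev K (P i) := by
  simp [vev, Finsupp.finsetSum_apply]

theorem vev_diagonalElement_mul (w : ℕ → K) (P : Module.End K (Fock K)) :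
    vev K (diagonalElement w * P) = vev K P := by
  have : diagonalElement w (P (basisVec K ∅)) ∅ = (∏ k ∈ ∅, w k) * P (basisVec K ∅) ∅ :=
    diagonalOp_apply _ _ _
  simpa [vev] using this

theorem diagonalElement_mul (w w' : ℕ → K) :
    diagonalElement w * diagonalElement w' = diagonalElement (fun k => w k * w' k) := by
  refine end_ext fun S => ?_
  simp [diagonalElement_basisVec, smul_smul, Finset.prod_mul_distrib, mul_comm]

theorem diagonalElement_one : diagonalElement (fun _ => (1 : K)) = 1 := by
  refine end_ext fun S => ?_
  simp [diagonalElement_basisVec]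

theorem parityOp_mul_diagonalElement (w : ℕ → K) :
    parityOp K * diagonalElement w = diagonalElement w * parityOp K := by
  refine end_ext fun S => ?_
  simp only [Module.End.mul_apply, diagonalElement_basisVec, map_smul, parityOp,
    diagonalOp_basisVec]
  rw [smul_comm]

/-- The conjugate `D⁻¹ J_k D`. -/
def dressedBoson (w : ℕ → K) (k : ℤ) : Module.End K (Fock K) :=
  diagonalElement (fun i => (w i)⁻¹) * boson K k * diagonalElement w

theorem boson_mul_diagonalElement {w : ℕ → K} (hw : ∀ k, w k ≠ 0) (k : ℤ) :
    boson K k * diagonalElement w = diagonalElement w * dressedBoson w k := by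
  rw [dressedBoson, ← mul_assoc, ← mul_assoc, diagonalElement_mul]
  simp [hw, diagonalElement_one]

/-- Conjugation by 𝒟 rescales φ_j by its weight, so the entry of the shift from j to j - k acquires
the ratio of the two weights. -/
theorem isQuad_dressedBoson [NeZero (2 : K)] {w : ℕ → K} (h0 : w 0 = 1) (hw : ∀ k, w k ≠ 0)
    {k : ℤ} (hk : Odd k) :
    IsQuad (dressedBoson w k) (shiftOp (fun j => weightInt w j / weightInt w (j - k)) k) := by
  have hw' : ∀ j, weightInt w j ≠ 0 := fun j => by unfold weightInt; split_ifs <;> simp [hw]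
  refine IsQuad.mk' (fun j => ?_) ?_
  · have h1 := diagonalElement_mul_fermion h0 hw j
    have h2 : ∀ i, diagonalElement (fun i => (w i)⁻¹) * fermion K i =
        (weightInt w i)⁻¹ • (fermion K i * diagonalElement (fun i => (w i)⁻¹)) := fun i => by
      rw [diagonalElement_mul_fermion (by simp [h0]) (by simp [hw])]
      congr 1
      unfold weightInt; split_ifs <;> simp
    have h3 : diagonalElement (fun i => (w i)⁻¹) * diagonalElement w = 1 := by
      rw [diagonalElement_mul]; simp [hw, diagonalElement_one]
    rw [shiftOp_single, field_single, dressedBoson, mul_assoc, h1, mul_smul_comm, ← mul_assoc,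
      mul_assoc (diagonalElement _), boson_mul_fermion hk, mul_add, add_mul, ← mul_assoc, h2, h2,
      smul_add, smul_mul_assoc, smul_mul_assoc, smul_mul_assoc, smul_smul, smul_smul,
      mul_inv_cancel₀ (hw' j), one_smul,
      mul_assoc (fermion K (j - k)), h3, mul_one, div_eq_mul_inv, mul_assoc, mul_assoc, mul_assoc]
  · rw [dressedBoson, ← mul_assoc, ← mul_assoc, parityOp_mul_diagonalElement, mul_assoc _ (parityOp K),
      parityOp_mul_boson (by rintro rfl; simp at hk), mul_assoc, mul_assoc, mul_assoc, mul_assoc,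
      parityOp_mul_diagonalElement, ← mul_assoc]

/-- The lists of length `l` with entries less than `N`. -/
def listsBelow (N : ℕ) : ℕ → Finset (List ℕ)
  | 0 => {[]}
  | l + 1 => (Finset.range N ×ˢ listsBelow N l).image fun p => p.1 :: p.2

theorem mem_listsBelow {N l : ℕ} {L : List ℕ} :
    L ∈ listsBelow N l ↔ L.length = l ∧ ∀ x ∈ L, x < N := by
  induction l generalizing L with
  | zero => simp +contextual [listsBelow, List.length_eq_zero_iff]
  | succ l ih =>
    cases L with
    | nil => simp [listsBelow]
    | cons a L => simp [listsBelow, ih]; tauto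

theorem sum_listsBelow_succ {M : Type*} [AddCommMonoid M] (N l : ℕ) (f : List ℕ → M) :
    ∑ L ∈ listsBelow N (l + 1), f L = ∑ j ∈ Finset.range N, ∑ L ∈ listsBelow N l, f (j :: L) := by
  rw [listsBelow, Finset.sum_image, Finset.sum_product]
  rintro ⟨a, b⟩ _ ⟨c, d⟩ _ h
  simpa using h

theorem sum_pow_eq_sum_listsBelow {R : Type*} [Semiring R] (N l : ℕ) (A : ℕ → R) :
    (∑ j ∈ Finset.range N, A j) ^ l = ∑ L ∈ listsBelow N l, (L.map A).prod := by
  induction l with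
  | zero => simp [listsBelow]
  | succ l ih => simp [sum_listsBelow_succ, pow_succ', ih, Finset.sum_mul_sum]

/-- The operator `∑_{j < N} s_{2j+1} J_{-(2j+1)}`. -/
def bosonMinus (s : ℕ → K) (N : ℕ) : Module.End K (Fock K) :=
  ∑ j ∈ Finset.range N, s j • boson K (-(2 * j + 1))

theorem prod_map_smul (s : ℕ → K) (A : ℕ → Module.End K (Fock K)) (L : List ℕ) :
    (L.map fun j => s j • A j).prod = (L.map s).prod • (L.map A).prod := by
  induction L with
  | nil => simp
  | cons a L ih => simp [ih, smul_smul, mul_comm]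

theorem hasEnergy_prod_boson [NeZero (2 : K)] (L : List ℕ) :
    HasEnergy (L.map fun j : ℕ => boson K (-(2 * j + 1))).prod
      (((L.map fun j => 2 * j + 1).sum : ℕ) : K) := by
  induction L with
  | nil => simpa using HasEnergy.one
  | cons a L ih =>
    have h : HasEnergy (boson K (-(2 * a + 1))) ((2 * a + 1 : ℕ) : K) := by
      have := hasEnergy_boson (K := K) (k := -(2 * a + 1)) (by omega)
      convert this using 1
      push_cast; ring
    simpa using h.mul ih

/-- The energy of a product of bosons bounds both its length and its indices; energy conservation
then leaves finitely many lists. -/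
theorem list_le_sum (L : List ℕ) :
    L.length ≤ (L.map fun j => 2 * j + 1).sum ∧ ∀ x ∈ L, x < (L.map fun j => 2 * j + 1).sum := by
  induction L with
  | nil => simp
  | cons a L ih =>
    simp only [List.length_cons, List.map_cons, List.sum_cons, List.mem_cons, forall_eq_or_imp]
    exact ⟨by omega, by omega, fun x hx => by have := ih.2 x hx; omega⟩

/-- The coefficients of `tauAt` as vacuum expectation values of powers of a single operator. -/
theorem coeff_tauAt [CharZero K] (w s : ℕ → K) (a : ℕ →₀ ℕ) {e N Λ : ℕ}
    (he : HasEnergy (expCoeff (fun j => boson K (2 * j + 1)) a) (-e : K)) (hN : e ≤ N)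
    (hΛ : e < Λ) :
    tauAt w s a = ∑ l ∈ Finset.range Λ, ((l ! : K)⁻¹) *
      vev K (expCoeff (fun j => boson K (2 * j + 1)) a * diagonalElement w *
        bosonMinus s N ^ l) := by
  set E := expCoeff (fun j => boson K (2 * j + 1)) a * diagonalElement w with hE
  set J : ℕ → Module.End K (Fock K) := fun j => boson K (-(2 * j + 1)) with hJ
  let G : List ℕ → K := fun L =>
    (L.length ! : K)⁻¹ * ((L.map s).prod * vev K (E * (L.map J).prod))
  -- Energy conservation: the list must carry total energy e, so its length is below Λ and its
  -- entries are below N.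
  have hG : ∀ L, G L ≠ 0 → L ∈ (Finset.range Λ).biUnion (listsBelow N) := by
    intro L hL
    have h1 : HasEnergy (E * (L.map J).prod) (-e + 0 + ((L.map fun j => 2 * j + 1).sum : ℕ) : K) :=
      (he.mul (hasEnergy_diagonalElement w)).mul (hasEnergy_prod_boson L)
    have h2 : (L.map fun j => 2 * j + 1).sum = e := by
      by_contra hne
      refine hL ?_
      simp only [G]
      rw [h1.vev_eq_zero, mul_zero, mul_zero]
      intro h0
      exact hne (by exact_mod_cast (by linear_combination h0 :
        (((L.map fun j => 2 * j + 1).sum : ℕ) : K) = e))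
    have h3 := list_le_sum L
    rw [h2] at h3
    simp only [Finset.mem_biUnion, Finset.mem_range, mem_listsBelow]
    exact ⟨L.length, by omega, rfl, fun x hx => by have := h3.2 x hx; omega⟩
  -- A monomial in s is spread over all lists with content b, each weighted by the inverse factorial
  -- of its length.
  have hterm : ∀ b : ℕ →₀ ℕ,
      MvPowerSeries.coeff (Finsupp.sumFinsuppEquivProdFinsupp.symm (a, b)) (tau w) *
        b.prod (fun j e => s j ^ e) = ∑ L ∈ (Finsupp.toMultiset b).lists.toFinset, G L := by
    intro b
    have h1 : MvPowerSeries.coeff (Finsupp.sumFinsuppEquivProdFinsupp.symm (a, b)) (tau w) =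
        vev K (E * expCoeff J b) := by
      simp only [MvPowerSeries.coeff_apply, tau, Equiv.apply_symm_apply]
      rfl
    rw [h1, expCoeff, mul_smul_comm, vev_smul, Finset.mul_sum, vev_sum, Finset.mul_sum,
      Finset.sum_mul]
    refine Finset.sum_congr rfl fun L hL => ?_
    rw [Multiset.mem_toFinset, Multiset.mem_lists_iff] at hL
    have h2 : (L.map s).prod = b.prod fun j e => s j ^ e := by
      have : ((Finsupp.toMultiset b).map s).prod = b.prod fun j e => s j ^ e := by
        rw [Finsupp.toMultiset_map, Finsupp.prod_toMultiset, Finsupp.prod_mapDomain_index] <;>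
          simp [pow_add]
      rw [← this, hL]; simp
    have h3 : (Finsupp.toMultiset b).card = L.length := by rw [hL]; simp
    simp only [G]
    rw [h2, h3]; ring
  have hfin : tauAt w s a = ∑ L ∈ (Finset.range Λ).biUnion (listsBelow N), G L := by
    set U := (Finset.range Λ).biUnion (listsBelow N) with hU
    rw [tauAt]
    simp only [hterm]
    have hmem : ∀ (b : ℕ →₀ ℕ) (L : List ℕ), L ∈ (Finsupp.toMultiset b).lists.toFinset ↔
        Multiset.toFinsupp (L : Multiset ℕ) = b := by
      intro b L
      rw [Multiset.mem_toFinset, Multiset.mem_lists_iff]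
      constructor
      · intro h
        have h' : Finsupp.toMultiset b = (L : Multiset ℕ) := h
        rw [← h']; simp
      · rintro rfl
        rw [Multiset.toFinsupp_toMultiset]; rfl
    -- Each list has exactly one content, so the sums over b are the fibres of one finite sum over
    -- lists.
    have hinner : ∀ b : ℕ →₀ ℕ, ∑ L ∈ (Finsupp.toMultiset b).lists.toFinset, G L =
        ∑ L ∈ U.filter fun L : List ℕ => Multiset.toFinsupp (L : Multiset ℕ) = b, G L := by
      intro b
      refine Finset.sum_congr_of_eq_on_inter ?_ ?_ fun _ _ _ => rfl
      · intro L hL hL'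
        by_contra h0
        exact hL' (Finset.mem_filter.2 ⟨hG L h0, (hmem b L).1 hL⟩)
      · intro L hL hL'
        exact absurd ((hmem b L).2 (Finset.mem_filter.1 hL).2) hL'
    simp only [hinner]
    rw [finsum_eq_sum_of_support_subset
      (s := U.image fun L : List ℕ => Multiset.toFinsupp (L : Multiset ℕ))]
    · exact Finset.sum_fiberwise_of_maps_to (fun L hL => Finset.mem_image_of_mem _ hL) G
    · intro b hb
      obtain ⟨L, hL, _⟩ := Finset.exists_ne_zero_of_sum_ne_zero hb
      rw [Finset.mem_filter] at hL
      simp only [Finset.coe_image, Set.mem_image]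
      exact ⟨L, hL.1, hL.2⟩
  rw [hfin, Finset.sum_biUnion]
  · refine Finset.sum_congr rfl fun l _ => ?_
    rw [bosonMinus, sum_pow_eq_sum_listsBelow, Finset.mul_sum, vev_sum, Finset.mul_sum]
    refine Finset.sum_congr rfl fun L hL => ?_
    rw [prod_map_smul, mul_smul_comm, vev_smul, ← (mem_listsBelow.1 hL).1]
  · intro l _ l' _ hne
    refine Finset.disjoint_left.2 fun L hL hL' => hne ?_
    rw [← (mem_listsBelow.1 hL).1, (mem_listsBelow.1 hL').1]

end Tau

/-! ### Removing the exponential of J_- by nested commutators. -/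

section Correlators

variable {K : Type*} [Field K]

/-- The iterated commutator `[⋯[[P, J], J], ⋯, J]`. -/
def nested {α : Type*} (J P : Module.End K (α →₀ K)) : ℕ → Module.End K (α →₀ K)
  | 0 => P
  | i + 1 => nested J P i * J - J * nested J P i

theorem IsQuad.nested {J P : Module.End K (Fock K)} {S A : Module.End K (ℤ →₀ K)}
    (hP : IsQuad P A) (hJ : IsQuad J S) (i : ℕ) : IsQuad (nested J P i) (nested S A i) := by
  induction i with
  | zero => exact hP
  | succ i ih => exact ih.commutator hJ

theorem nested_mul (J P : Module.End K (Fock K)) (i : ℕ) :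
    nested J P i * J = nested J P (i + 1) + J * nested J P i :=
  LinearMap.ext fun v => by simp [nested]

theorem vev_mul_of_apply_empty {J : Module.End K (Fock K)} (hJ : ∀ v, J v ∅ = 0)
    (Q : Module.End K (Fock K)) : vev K (J * Q) = 0 := hJ _

/-- Moving a J to the left through P leaves its commutator with P, and the remaining term dies on
⟨0|J = 0. -/
theorem vev_mul_pow {J : Module.End K (Fock K)} (hJ : ∀ v, J v ∅ = 0)
    (P : Module.End K (Fock K)) (l : ℕ) : vev K (P * J ^ l) = vev K (nested J P l) := by
  have key : ∀ l i, vev K (nested J P i * J ^ l) = vev K (nested J P (i + l)) := by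
    intro l
    induction l with
    | zero => simp
    | succ l ih =>
      intro i
      rw [pow_succ', ← mul_assoc, nested_mul, add_mul, vev_add, ih, mul_assoc,
        vev_mul_of_apply_empty hJ, add_zero, add_right_comm, add_assoc]
  simpa [nested] using key l 0

/-- The Leibniz rule in abstract form: each unit of l is spent on the first or on the second slot.
-/
theorem eq_sum_antidiagonal_of_pascal {R : Type*} [CommSemiring R] (f : ℕ → ℕ → ℕ → R)
    (hf : ∀ i j l, f i j (l + 1) = f (i + 1) j l + f i (j + 1) l) (i j l : ℕ) :
    f i j l = ∑ p ∈ Finset.HasAntidiagonal.antidiagonal l, (l.choose p.1 : R) * f (i + p.1) (j + p.2) 0 := by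
  induction l generalizing i j with
  | zero => simp
  | succ l ih =>
    rw [hf, ih, ih, Finset.sum_antidiagonal_choose_succ_mul (fun p q => f (i + p) (j + q) 0),
      add_comm]
    simp only [add_assoc, add_comm 1]
    congr 1
    refine Finset.sum_congr rfl fun x hx => ?_
    rw [Nat.choose_symm_of_eq_add (Finset.HasAntidiagonal.mem_antidiagonal.1 hx).symm]

theorem vev_mul_mul_pow {J : Module.End K (Fock K)} (hJ : ∀ v, J v ∅ = 0)
    (P P' : Module.End K (Fock K)) (l : ℕ) :
    vev K (P * P' * J ^ l) = ∑ p ∈ Finset.HasAntidiagonal.antidiagonal l,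
      (l.choose p.1 : K) * vev K (nested J P p.1 * nested J P' p.2) := by
  have := eq_sum_antidiagonal_of_pascal
    (fun i j l => vev K (nested J P i * nested J P' j * J ^ l)) (fun i j l => by
      rw [pow_succ', ← mul_assoc, mul_assoc (nested J P i), nested_mul, mul_add,
        ← mul_assoc (nested J P i) J, nested_mul, add_mul, add_mul, add_mul, vev_add, vev_add,
        mul_assoc J, mul_assoc J, vev_mul_of_apply_empty hJ, add_zero, add_comm]) 0 0 l
  simpa [nested] using this

/-- An operator commuting with all fermions acts on ⟨0| as a scalar: peeling the top mode removes
every nonempty set except {0}, and parity removes that one. -/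
theorem IsQuad.apply_empty_eq_zero [NeZero (2 : K)] {P : Module.End K (Fock K)}
    (h : IsQuad P 0) (h0 : vev K P = 0) (v : Fock K) : P v ∅ = 0 := by
  have key : (Finsupp.lapply ∅ ∘ₗ P : Fock K →ₗ[K] K) = 0 := by
    refine fock_linear_ext fun S => ?_
    simp only [LinearMap.comp_apply, Finsupp.lapply_apply, LinearMap.zero_apply]
    rcases S.eq_empty_or_nonempty with rfl | hne
    · exact h0
    set a := S.max' hne with ha
    have hSa : insert a (S.erase a) = S := Finset.insert_erase (S.max'_mem hne)
    have hlt : ∀ i ∈ S.erase a, i < a := fun i hi => S.lt_max'_of_mem_erase_max' hne hi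
    rcases Nat.eq_zero_or_pos a with hz | hpos
    · have hS : S = {0} := by
        rw [← hSa, hz, ← insert_empty_eq 0]
        congr 1
        exact Finset.eq_empty_of_forall_notMem fun i hi => by have := hlt i (hz ▸ hi); omega
      have h1 := DFunLike.congr_fun (LinearMap.congr_fun h.even (basisVec K {0})) ∅
      simp only [Module.End.mul_apply, parityOp, diagonalOp_basisVec, diagonalOp_apply, map_smul,
        Finsupp.smul_apply, Finset.card_singleton, Finset.card_empty, smul_eq_mul] at h1
      have : (2 : K) * P (basisVec K {0}) ∅ = 0 := by linear_combination h1
      rw [hS]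
      exact (mul_eq_zero.1 this).resolve_left (NeZero.ne 2)
    · rw [← hSa, h.apply_empty hpos hlt]; simp
  exact LinearMap.congr_fun key v

theorem vev_boson [NeZero (2 : K)] {k : ℤ} (hk : k ≠ 0) [CharZero K] : vev K (boson K k) = 0 :=
  (hasEnergy_boson hk).vev_eq_zero (by simpa using hk)

/-- The shifts commute, so the one-particle matrix of [J_k, J_m] is 0; its vacuum expectation value
is 0 as well, so ⟨0| kills it. -/
theorem vev_boson_comm [CharZero K] {k m : ℤ} (hk : Odd k) (hm : Odd m) (hk0 : 0 < k)
    (hm0 : 0 < m) (Q : Module.End K (Fock K)) :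
    vev K (boson K k * boson K m * Q) = vev K (boson K m * boson K k * Q) := by
  -- The shift by m > 0 lowers the index -a further and never reaches b ≥ 0, so Wick's theorem holds
  -- with cutoff 0 and has no pair terms.
  have hq : ∀ {k m : ℤ}, Odd k → Odd m → 0 < k → 0 < m →
      vev K (boson K k * boson K m) = 0 := by
    intro k m hk hm hk0 hm0
    rw [(isQuad_boson hk).vev_mul (isQuad_boson hm) 0, vev_boson hk0.ne']
    · simp
    · intro a b _
      rw [shiftOp_single, Finsupp.single_eq_of_ne (by omega)]
  have h1 := (isQuad_boson (K := K) hk).commutator (isQuad_boson hm)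
  have h2 : (shiftOp (1 : ℤ → K) k * shiftOp 1 m - shiftOp 1 m * shiftOp 1 k) = 0 := by
    refine Finsupp.lhom_ext' fun j => LinearMap.ext_ring ?_
    simp [shiftOp, sub_right_comm]
  rw [h2] at h1
  have h3 := h1.apply_empty_eq_zero (by
    have : vev K (boson K k * boson K m - boson K m * boson K k) =
        vev K (boson K k * boson K m) - vev K (boson K m * boson K k) := rfl
    rw [this, hq hk hm hk0 hm0, hq hm hk hm0 hk0, sub_zero]) (Q (basisVec K ∅))
  rw [LinearMap.sub_apply, Finsupp.sub_apply, sub_eq_zero] at h3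
  exact h3

theorem bosonMinus_apply_empty [NeZero (2 : K)] (s : ℕ → K) (N : ℕ) (v : Fock K) :
    bosonMinus s N v ∅ = 0 := by
  rw [bosonMinus, LinearMap.sum_apply, Finsupp.finsetSum_apply]
  refine Finset.sum_eq_zero fun j _ => ?_
  rw [LinearMap.smul_apply, Finsupp.smul_apply, boson_apply_empty (by omega), smul_zero]

theorem expCoeff_single (A : ℕ → Module.End K (Fock K)) (j : ℕ) :
    expCoeff A (Finsupp.single j 1) = A j := by
  have : (Finsupp.toMultiset (Finsupp.single j 1)) = (([j] : List ℕ) : Multiset ℕ) := by simp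
  rw [expCoeff, this, Multiset.lists_coe]
  simp [List.permutations]

theorem expCoeff_single_add_single_self [CharZero K] (A : ℕ → Module.End K (Fock K)) (j : ℕ) :
    expCoeff A (Finsupp.single j 1 + Finsupp.single j 1) = (1 / 2 : K) • (A j * A j) := by
  have : (Finsupp.toMultiset (Finsupp.single j 1 + Finsupp.single j 1)) =
      (([j, j] : List ℕ) : Multiset ℕ) := by simp; rfl
  rw [expCoeff, this, Multiset.lists_coe]
  simp [List.permutations]

theorem expCoeff_single_add_single [CharZero K] (A : ℕ → Module.End K (Fock K)) {i j : ℕ}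
    (h : i ≠ j) :
    expCoeff A (Finsupp.single i 1 + Finsupp.single j 1) =
      (1 / 2 : K) • (A i * A j + A j * A i) := by
  have : (Finsupp.toMultiset (Finsupp.single i 1 + Finsupp.single j 1)) =
      (([i, j] : List ℕ) : Multiset ℕ) := by simp; rfl
  rw [expCoeff, this, Multiset.lists_coe]
  simp [List.permutations, h, h.symm]

theorem derivAtZero_singleton (f : MvPowerSeries ℕ K) (j : ℕ) :
    derivAtZero f [j] = f (Finsupp.single j 1) := by
  have := MvPowerSeries.coeff_pderiv f (i := j) 0
  rw [derivAtZero, ← MvPowerSeries.coeff_zero_eq_constantCoeff_apply]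
  simp only [List.foldr_cons, List.foldr_nil]
  rw [this]; simp; rfl

/-- The factor 2 for equal indices undoes the 1/2 of `expCoeff_single_add_single_self`. -/
theorem derivAtZero_pair (f : MvPowerSeries ℕ K) (i j : ℕ) :
    derivAtZero f [i, j] =
      f (Finsupp.single i 1 + Finsupp.single j 1) * (if i = j then 2 else 1) := by
  rw [derivAtZero, ← MvPowerSeries.coeff_zero_eq_constantCoeff_apply]
  simp only [List.foldr_cons, List.foldr_nil]
  rw [MvPowerSeries.coeff_pderiv, MvPowerSeries.coeff_pderiv]
  simp only [zero_add, Finsupp.coe_zero, Pi.zero_apply, Nat.cast_zero, mul_one]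
  rw [MvPowerSeries.coeff_apply]
  congr 1
  by_cases h : i = j
  · subst h; simp; norm_num
  · simp [h]

/-- Moving J_k to the right of 𝒟 dresses it, and ⟨0| absorbs 𝒟. The cutoffs N and Λ are free above
the energy, which later allows different ones to be compared. -/
theorem derivAtZero_tauAt_singleton [CharZero K] {w : ℕ → K} (hw : ∀ k, w k ≠ 0) (s : ℕ → K)
    (j : ℕ) {N Λ : ℕ} (hN : 2 * j + 1 ≤ N) (hΛ : 2 * j + 1 < Λ) :
    derivAtZero (tauAt w s) [j] = ∑ l ∈ Finset.range Λ,
      (l ! : K)⁻¹ * vev K (nested (bosonMinus s N) (dressedBoson w (2 * j + 1)) l) := by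
  have he : HasEnergy (boson K (2 * j + 1)) (-(2 * j + 1 : ℕ) : K) := by
    have := hasEnergy_boson (K := K) (k := 2 * j + 1) (by omega)
    convert this using 2; push_cast; ring
  rw [derivAtZero_singleton, coeff_tauAt w s _ (by rwa [expCoeff_single]) hN hΛ]
  refine Finset.sum_congr rfl fun l _ => ?_
  rw [expCoeff_single, boson_mul_diagonalElement hw, mul_assoc, vev_diagonalElement_mul,
    vev_mul_pow (bosonMinus_apply_empty s N)]

theorem derivAtZero_tauAt_pair [CharZero K] {w : ℕ → K} (hw : ∀ k, w k ≠ 0) (s : ℕ → K)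
    (i j : ℕ) {N Λ : ℕ} (hN : 2 * i + 1 + (2 * j + 1) ≤ N) (hΛ : 2 * i + 1 + (2 * j + 1) < Λ) :
    derivAtZero (tauAt w s) [i, j] = ∑ l ∈ Finset.range Λ, ∑ p ∈ Finset.HasAntidiagonal.antidiagonal l,
      ((p.1 ! : K)⁻¹ * (p.2 ! : K)⁻¹) *
        vev K (nested (bosonMinus s N) (dressedBoson w (2 * i + 1)) p.1 *
          nested (bosonMinus s N) (dressedBoson w (2 * j + 1)) p.2) := by
  have he : ∀ j : ℕ, HasEnergy (boson K (2 * j + 1)) (-(2 * j + 1 : ℕ) : K) := by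
    intro j
    have := hasEnergy_boson (K := K) (k := 2 * j + 1) (by omega)
    convert this using 2; push_cast; ring
  have he2 : ∀ i j : ℕ, HasEnergy (boson K (2 * i + 1) * boson K (2 * j + 1))
      (-((2 * i + 1 + (2 * j + 1) : ℕ)) : K) := by
    intro i j
    convert (he i).mul (he j) using 1; push_cast; ring
  set X : Module.End K (Fock K) := expCoeff (fun j => boson K (2 * j + 1))
    (Finsupp.single i 1 + Finsupp.single j 1) with hX
  -- Under ⟨0| the symmetrized coefficient can be replaced by one ordered product, because the
  -- annihilating bosons commute there.
  have hcomm : ∀ Q : Module.End K (Fock K), vev K (X * Q) * (if i = j then 2 else 1) =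
      vev K (boson K (2 * i + 1) * boson K (2 * j + 1) * Q) := by
    intro Q
    by_cases h : i = j
    · subst h
      rw [hX, expCoeff_single_add_single_self, smul_mul_assoc, vev_smul, if_pos rfl]; ring
    · rw [hX, expCoeff_single_add_single _ h, smul_mul_assoc, vev_smul, if_neg h, add_mul, vev_add,
        vev_boson_comm (k := 2 * j + 1) (m := 2 * i + 1) ⟨j, rfl⟩ ⟨i, rfl⟩ (by omega) (by omega)]
      ring
  have hXe : HasEnergy X (-((2 * i + 1 + (2 * j + 1) : ℕ)) : K) := by
    by_cases h : i = j
    · subst h; rw [hX, expCoeff_single_add_single_self]; exact (he2 _ _).smul _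
    · have he3 := he2 j i
      rw [add_comm (2 * j + 1)] at he3
      rw [hX, expCoeff_single_add_single _ h]
      exact ((he2 i j).add he3).smul _
  rw [derivAtZero_pair, coeff_tauAt w s _ hXe hN hΛ, Finset.sum_mul]
  refine Finset.sum_congr rfl fun l _ => ?_
  rw [mul_assoc, mul_assoc, hcomm, ← mul_assoc, mul_assoc (boson K _), boson_mul_diagonalElement hw,
    ← mul_assoc, boson_mul_diagonalElement hw, mul_assoc, mul_assoc, vev_diagonalElement_mul,
    ← mul_assoc, vev_mul_mul_pow (bosonMinus_apply_empty s N), Finset.mul_sum]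
  refine Finset.sum_congr rfl fun p hp => ?_
  rw [← mul_assoc]
  congr 1
  rw [← Finset.HasAntidiagonal.mem_antidiagonal.1 hp]
  have h0 := Nat.choose_mul_factorial_mul_factorial (Nat.le_add_right p.1 p.2)
  rw [Nat.add_sub_cancel_left] at h0
  have h1 : (p.1 ! : K) ≠ 0 := by exact_mod_cast Nat.factorial_ne_zero p.1
  have h2 : (p.2 ! : K) ≠ 0 := by exact_mod_cast Nat.factorial_ne_zero p.2
  have h3 : ((p.1 + p.2)! : K) ≠ 0 := by exact_mod_cast Nat.factorial_ne_zero (p.1 + p.2)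
  rw [← mul_inv, ← div_eq_inv_mul, div_eq_iff h3, ← h0]
  push_cast
  field_simp

end Correlators

/-! ### Exponentials and substitution of power series. -/

section Exponential

open PowerSeries

theorem hasSubst_sub_C_constantCoeff (f : PowerSeries ℂ) :
    HasSubst (f - C (constantCoeff f)) :=
  HasSubst.of_constantCoeff_zero' (by simp)

theorem constantCoeff_expSeries (f : PowerSeries ℂ) :
    constantCoeff (expSeries f) = Complex.exp (constantCoeff f) := by
  have h : constantCoeff ((exp ℂ).subst (f - C (constantCoeff f))) = 1 := by
    have h2 : (exp ℂ) = (exp ℂ - 1) + 1 := by ring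
    have h1 : constantCoeff ((exp ℂ - 1).subst (f - C (constantCoeff f))) = 0 :=
      constantCoeff_subst_eq_zero (by change constantCoeff _ = 0; simp) _ (by simp)
    have h3 : (1 : PowerSeries ℂ).subst (f - C (constantCoeff f)) = 1 := by
      rw [← coe_substAlgHom (hasSubst_sub_C_constantCoeff f), map_one]
    rw [h2, subst_add (hasSubst_sub_C_constantCoeff f), h3, map_add, h1]
    simp
  rw [expSeries, map_mul, h]
  simp

theorem derivative_expSeries (f : PowerSeries ℂ) :
    derivative ℂ (expSeries f) = derivative ℂ f * expSeries f := by
  rw [expSeries, Derivation.leibniz, derivative_subst (hasSubst_sub_C_constantCoeff f),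
    derivative_exp]
  simp only [map_sub, derivative_C, smul_eq_mul, sub_zero, mul_zero, add_zero]
  ring

/-- Exponential identities are checked on the derivative and the constant term, which determine a
series in characteristic zero. -/
theorem expSeries_mul_neg (f : PowerSeries ℂ) : expSeries f * expSeries (-f) = 1 := by
  refine derivative.ext ?_ ?_
  · rw [Derivation.leibniz, derivative_expSeries, derivative_expSeries]
    simp only [smul_eq_mul, map_neg, derivative_one]
    ring
  · rw [map_mul, constantCoeff_expSeries, constantCoeff_expSeries, map_neg, ← Complex.exp_add]
    simp

theorem expSeries_add (f g : PowerSeries ℂ) : expSeries (f + g) = expSeries f * expSeries g := by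
  have h : expSeries (f + g) * (expSeries (-f) * expSeries (-g)) = 1 := by
    refine derivative.ext ?_ ?_
    · simp only [Derivation.leibniz, derivative_expSeries, smul_eq_mul, map_neg, map_add,
        derivative_one]
      ring
    · simp only [map_mul, constantCoeff_expSeries, ← Complex.exp_add, map_neg, map_add]
      have : constantCoeff f + constantCoeff g + (-constantCoeff f + -constantCoeff g) = 0 := by ring
      simp [this]
  calc expSeries (f + g) = expSeries (f + g) * ((expSeries f * expSeries (-f)) *
        (expSeries g * expSeries (-g))) := by rw [expSeries_mul_neg, expSeries_mul_neg]; simp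
    _ = expSeries (f + g) * (expSeries (-f) * expSeries (-g)) * (expSeries f * expSeries g) := by
        ring
    _ = _ := by rw [h, one_mul]

theorem expSeries_zero : expSeries 0 = 1 := by
  refine derivative.ext ?_ ?_
  · rw [derivative_expSeries]; simp
  · rw [constantCoeff_expSeries]; simp

theorem expSeries_nsmul (n : ℕ) (f : PowerSeries ℂ) : expSeries (n • f) = expSeries f ^ n := by
  induction n with
  | zero => simp [expSeries_zero]
  | succ n ih => rw [succ_nsmul, expSeries_add, ih, pow_succ]

theorem expSeries_subst (f : PowerSeries ℂ) {g : PowerSeries ℂ} (hg : constantCoeff g = 0) :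
    (expSeries f).subst g = expSeries (f.subst g) := by
  have hg' : HasSubst g := HasSubst.of_constantCoeff_zero' hg
  have h0 : constantCoeff (f.subst g) = constantCoeff f := by
    have h1 : constantCoeff ((f - C (constantCoeff f)).subst g) = 0 :=
      constantCoeff_subst_eq_zero hg _ (by simp)
    rw [subst_sub hg'] at h1
    have h2 : (C (constantCoeff f)).subst g = C (constantCoeff f) := subst_C _
    rw [h2, map_sub, constantCoeff_C, sub_eq_zero] at h1
    exact h1
  have h2 : ∀ c : ℂ, (C c).subst g = C c := fun c => subst_C _
  rw [expSeries, subst_mul hg', h2, subst_comp_subst_apply (hasSubst_sub_C_constantCoeff f) hg',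
    subst_sub hg', h2, expSeries, h0]

theorem coeff_pow_eq_zero {R : Type*} [CommRing R] {g : PowerSeries R} (hg : constantCoeff g = 0) {N n : ℕ} (h : N < n) :
    coeff N (g ^ n) = 0 := by
  have : X ^ n ∣ g ^ n := pow_dvd_pow_of_dvd (X_dvd_iff.2 hg) n
  exact X_pow_dvd_iff.1 this N h

theorem coeff_subst_eq_sum {R : Type*} [CommRing R] (f : PowerSeries R) {g : PowerSeries R}
    (hg : constantCoeff g = 0)
    {N M : ℕ} (h : N < M) :
    coeff N (f.subst g) = ∑ n ∈ Finset.range M, coeff n f * coeff N (g ^ n) := by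
  rw [coeff_subst' (HasSubst.of_constantCoeff_zero' hg),
    finsum_eq_sum_of_support_subset (s := Finset.range M)]
  · simp
  · intro n hn
    by_contra hn'
    simp only [Finset.coe_range, Set.mem_Iio, not_lt] at hn'
    exact hn (by simp [coeff_pow_eq_zero hg (h.trans_le hn')])

end Exponential

/-! ### Semiclassical symbols. -/

section Symbols

open PowerSeries

/-- `h j = H(ħ, ħ j)` for a series `H(ħ, x)` with `H(0, x) = σ(x)`: the coefficient of `ħ ^ N` in
`h j` is a polynomial in `j` of degree at most `N`, whose coefficient at `j ^ N` is that of `σ`. -/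
def HasSymbol (h : ℤ → PowerSeries ℂ) (σ : PowerSeries ℂ) : Prop :=
  ∀ N, ∃ p : Polynomial ℂ, p.natDegree ≤ N ∧ p.coeff N = coeff N σ ∧
    ∀ j : ℤ, coeff N (h j) = p.eval (j : ℂ)

theorem HasSymbol.constantCoeff {h : ℤ → PowerSeries ℂ} {σ : PowerSeries ℂ} (hh : HasSymbol h σ)
    (j : ℤ) : constantCoeff (h j) = constantCoeff σ := by
  obtain ⟨p, h1, h2, h3⟩ := hh 0
  rw [← coeff_zero_eq_constantCoeff_apply, ← coeff_zero_eq_constantCoeff_apply, h3, ← h2,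
    Polynomial.eq_C_of_natDegree_le_zero h1]
  simp

theorem hasSymbol_const (c : PowerSeries ℂ) :
    HasSymbol (fun _ => c) (C (PowerSeries.constantCoeff c)) := by
  intro N
  refine ⟨Polynomial.C (coeff N c), by simp, ?_, by simp⟩
  rcases N with _ | N <;> simp [Polynomial.coeff_C]

theorem HasSymbol.add {h h' : ℤ → PowerSeries ℂ} {σ σ' : PowerSeries ℂ} (hh : HasSymbol h σ)
    (hh' : HasSymbol h' σ') : HasSymbol (fun j => h j + h' j) (σ + σ') := by
  intro N
  obtain ⟨p, h1, h2, h3⟩ := hh N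
  obtain ⟨q, h4, h5, h6⟩ := hh' N
  exact ⟨p + q, Polynomial.natDegree_add_le_of_degree_le h1 h4, by simp [h2, h5],
    fun j => by simp [h3, h6]⟩

theorem HasSymbol.sum {ι : Type*} (s : Finset ι) {h : ι → ℤ → PowerSeries ℂ}
    {σ : ι → PowerSeries ℂ} (hh : ∀ i ∈ s, HasSymbol (h i) (σ i)) :
    HasSymbol (fun j => ∑ i ∈ s, h i j) (∑ i ∈ s, σ i) := by
  classical
  induction s using Finset.induction_on with
  | empty => simpa using hasSymbol_const 0
  | insert i s hi ih =>
    simp only [Finset.sum_insert hi]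
    exact (hh i (by simp)).add (ih fun j hj => hh j (by simp [hj]))

theorem HasSymbol.mul {h h' : ℤ → PowerSeries ℂ} {σ σ' : PowerSeries ℂ} (hh : HasSymbol h σ)
    (hh' : HasSymbol h' σ') : HasSymbol (fun j => h j * h' j) (σ * σ') := by
  intro N
  choose p h1 h2 h3 using hh
  choose q h4 h5 h6 using hh'
  refine ⟨∑ x ∈ Finset.HasAntidiagonal.antidiagonal N, p x.1 * q x.2, ?_, ?_, fun j => ?_⟩
  · refine Polynomial.natDegree_sum_le_of_forall_le _ _ fun x hx => ?_
    rw [← Finset.HasAntidiagonal.mem_antidiagonal.1 hx]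
    exact Polynomial.natDegree_mul_le_of_le (h1 _) (h4 _)
  · rw [Polynomial.finsetSum_coeff, coeff_mul]
    refine Finset.sum_congr rfl fun x hx => ?_
    rw [← Finset.HasAntidiagonal.mem_antidiagonal.1 hx,
      Polynomial.coeff_mul_add_eq_of_natDegree_le (h1 _) (h4 _), h2, h5]
  · rw [coeff_mul, Polynomial.eval_finsetSum]
    exact Finset.sum_congr rfl fun x _ => by rw [h3, h6, Polynomial.eval_mul]

theorem HasSymbol.const_mul {h : ℤ → PowerSeries ℂ} {σ : PowerSeries ℂ} (hh : HasSymbol h σ)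
    (c : PowerSeries ℂ) :
    HasSymbol (fun j => c * h j) (C (PowerSeries.constantCoeff c) * σ) :=
  (hasSymbol_const c).mul hh

theorem HasSymbol.pow {h : ℤ → PowerSeries ℂ} {σ : PowerSeries ℂ} (hh : HasSymbol h σ) (n : ℕ) :
    HasSymbol (fun j => h j ^ n) (σ ^ n) := by
  induction n with
  | zero => simpa using hasSymbol_const 1
  | succ n ih => simpa only [pow_succ] using ih.mul hh

theorem coeff_taylor_of_natDegree_le {p : Polynomial ℂ} {N : ℕ} (h : p.natDegree ≤ N) (b : ℂ) :
    (p.taylor b).coeff N = p.coeff N := by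
  rcases h.eq_or_lt with rfl | h
  · rw [Polynomial.coeff_taylor_natDegree]; rfl
  · rw [Polynomial.coeff_eq_zero_of_natDegree_lt h,
      Polynomial.coeff_eq_zero_of_natDegree_lt (by rwa [Polynomial.natDegree_taylor])]

theorem coeff_taylor_of_natDegree_le_succ {p : Polynomial ℂ} {N : ℕ} (h : p.natDegree ≤ N + 1)
    (b : ℂ) : (p.taylor b).coeff N = p.coeff N + (N + 1) * b * p.coeff (N + 1) := by
  rw [Polynomial.taylor_coeff, Polynomial.eval_eq_sum_range' (n := 2)
    (Nat.lt_succ_of_le ((Polynomial.natDegree_hasseDeriv_le p N).trans (by omega)))]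
  simp only [Finset.sum_range_succ, Finset.sum_range_zero, Polynomial.hasseDeriv_coeff]
  have : (1 + N).choose N = N + 1 := by rw [add_comm]; simp
  rw [this, add_comm 1 N]
  simp; ring

/-- The order ħ^0 does not depend on j, so a finite difference is divisible by ħ. At order ħ^{N+1}
it is p(j + b) - p(j) with deg p ≤ N + 1. This has degree at most N, and its coefficient at j^N is b
(N + 1) p_{N+1}, that of b σ'. -/
theorem HasSymbol.difference {h : ℤ → PowerSeries ℂ} {σ : PowerSeries ℂ} (hh : HasSymbol h σ)
    (b : ℤ) : ∃ h' : ℤ → PowerSeries ℂ, (∀ j, h (j + b) = h j + X * h' j) ∧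
      HasSymbol h' (C (b : ℂ) * derivative ℂ σ) := by
  refine ⟨fun j => mk fun N => coeff (N + 1) (h (j + b) - h j), fun j => ?_, fun N => ?_⟩
  · ext N
    rcases N with _ | N
    · simp [hh.constantCoeff]
    · rw [map_add, coeff_succ_X_mul, coeff_mk, map_sub]; ring
  · obtain ⟨p, h1, h2, h3⟩ := hh (N + 1)
    refine ⟨p.taylor (b : ℂ) - p, ?_, ?_, fun j => ?_⟩
    · rw [Polynomial.natDegree_le_iff_coeff_eq_zero]
      intro m hm
      rw [Polynomial.coeff_sub, coeff_taylor_of_natDegree_le (by omega), sub_self]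
    · rw [Polynomial.coeff_sub, coeff_taylor_of_natDegree_le_succ h1, coeff_C_mul,
        coeff_derivative, ← h2]
      ring
    · rw [coeff_mk, map_sub, h3, h3, Polynomial.taylor_apply]; simp

/-- Only powers up to N of the part without constant term matter, so the symbol of an exponential
reduces to sums and products of symbols. -/
theorem coeff_expSeries (f : PowerSeries ℂ) (N : ℕ) :
    coeff N (expSeries f) = coeff N (C (Complex.exp (PowerSeries.constantCoeff f)) *
      ∑ n ∈ Finset.range (N + 1), C ((n ! : ℂ)⁻¹) * (f + C (-PowerSeries.constantCoeff f)) ^ n) := by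
  rw [expSeries, coeff_C_mul, coeff_C_mul, map_sum, coeff_subst_eq_sum _ (by simp) N.lt_succ_self]
  congr 1
  refine Finset.sum_congr rfl fun n _ => ?_
  rw [coeff_C_mul, coeff_exp, map_neg, sub_eq_add_neg]
  simp

theorem HasSymbol.exp {h : ℤ → PowerSeries ℂ} {σ : PowerSeries ℂ} (hh : HasSymbol h σ) :
    HasSymbol (fun j => expSeries (h j)) (expSeries σ) := by
  intro N
  set c := PowerSeries.constantCoeff σ with hc
  have h1 : HasSymbol (fun j => h j + C (-c)) (σ + C (-c)) := by
    simpa using hh.add (hasSymbol_const (C (-c)))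
  have h2 := (HasSymbol.sum (Finset.range (N + 1)) fun n _ =>
    (h1.pow n).const_mul (C ((n ! : ℂ)⁻¹))).const_mul (C (Complex.exp c))
  simp only [constantCoeff_C] at h2
  obtain ⟨p, h3, h4, h5⟩ := h2 N
  refine ⟨p, h3, ?_, fun j => ?_⟩
  · rw [h4, coeff_expSeries]
  · rw [← h5, coeff_expSeries, hh.constantCoeff]

/-- At order ħ^N the series ψ_{2d} contributes degree at most N - 2d in j, so only ψ_0 reaches the
top degree, where the shift c is invisible. -/
theorem hasSymbol_psiBarAt (psi : ℕ → PowerSeries ℂ) (c : ℂ) :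
    HasSymbol (fun j => psiBarAt psi (j + c)) (psi 0) := by
  intro N
  have hdeg : ∀ d, (Polynomial.C (coeff (N - 2 * d) (psi d)) *
      (Polynomial.X + Polynomial.C c) ^ (N - 2 * d)).natDegree ≤ N - 2 * d := fun d =>
    (Polynomial.natDegree_C_mul_le _ _).trans (by simp)
  refine ⟨∑ d ∈ Finset.range (N / 2 + 1), Polynomial.C (coeff (N - 2 * d) (psi d)) *
    (Polynomial.X + Polynomial.C c) ^ (N - 2 * d), ?_, ?_, fun j => ?_⟩
  · exact Polynomial.natDegree_sum_le_of_forall_le _ _ fun d _ => (hdeg d).trans (by omega)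
  · rw [Polynomial.finsetSum_coeff, Finset.sum_eq_single 0]
    · rw [Polynomial.coeff_C_mul, Polynomial.coeff_X_add_C_pow]; simp
    · intro d hd hd0
      rw [Finset.mem_range] at hd
      exact Polynomial.coeff_eq_zero_of_natDegree_lt ((hdeg d).trans_lt (by omega))
    · simp
  · simp only [psiBarAt, coeff_mk, Polynomial.eval_finsetSum]
    simp

theorem psiBarAt_neg {psi : ℕ → PowerSeries ℂ} (hpsi : ∀ d n, Odd n → coeff n (psi d) = 0)
    (c : ℂ) : psiBarAt psi (-c) = psiBarAt psi c := by
  ext N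
  simp only [psiBarAt, coeff_mk]
  refine Finset.sum_congr rfl fun d _ => ?_
  rcases Nat.even_or_odd (N - 2 * d) with h | h
  · rw [h.neg_pow]
  · rw [hpsi d _ h]; simp

/-- `T_k` for all integers `k`. -/
def TInt (psi : ℕ → PowerSeries ℂ) (j : ℤ) : PowerSeries ℂ :=
  if 0 ≤ j then T psi j.natAbs else -T psi j.natAbs

theorem T_succ (psi : ℕ → PowerSeries ℂ) (k : ℕ) :
    T psi (k + 1) = T psi k + psiBarAt psi (k + 1 / 2) := by
  rw [T, Finset.sum_range_succ]; rfl

/-- Evenness of ψ̄ makes the odd extension of T satisfy the same recursion at negative indices. -/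
theorem TInt_succ {psi : ℕ → PowerSeries ℂ} (hpsi : ∀ d n, Odd n → coeff n (psi d) = 0) (j : ℤ) :
    TInt psi (j + 1) = TInt psi j + psiBarAt psi (j + 1 / 2) := by
  rcases le_or_gt 0 j with h | h
  · lift j to ℕ using h
    have : ((j : ℤ) + 1).natAbs = j + 1 := by omega
    rw [TInt, if_pos (by omega), TInt, if_pos (by omega), this, T_succ]; simp
  · obtain ⟨n, rfl⟩ : ∃ n : ℕ, j = -(n + 1 : ℕ) := ⟨j.natAbs - 1, by omega⟩
    have e1 : ((-((n + 1 : ℕ) : ℤ) : ℤ) : ℂ) + 1 / 2 = -(n + 1 / 2) := by push_cast; ring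
    have e2 : TInt psi (-((n + 1 : ℕ) : ℤ) + 1) = -T psi n := by
      rcases Nat.eq_zero_or_pos n with rfl | hn
      · simp [TInt, T]
      · rw [TInt, if_neg (by omega), show (-((n + 1 : ℕ) : ℤ) + 1).natAbs = n by omega]
    rw [e1, e2, psiBarAt_neg hpsi, TInt, if_neg (by omega), Int.natAbs_neg, Int.natAbs_natCast,
      T_succ]
    ring

theorem TInt_sub {psi : ℕ → PowerSeries ℂ} (hpsi : ∀ d n, Odd n → coeff n (psi d) = 0) (j : ℤ)
    (k : ℕ) : TInt psi j - TInt psi (j - k) =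
      ∑ i ∈ Finset.range k, psiBarAt psi (j + (i - k + 1 / 2)) := by
  have := Finset.sum_range_sub (fun i : ℕ => TInt psi (j - k + i)) k
  simp only [Nat.cast_zero, add_zero, sub_add_cancel] at this
  rw [← this]
  refine Finset.sum_congr rfl fun i _ => ?_
  rw [Nat.cast_add, Nat.cast_one, ← add_assoc, TInt_succ hpsi]
  rw [add_sub_cancel_left]
  congr 1
  push_cast; ring

theorem weightInt_weight (psi : ℕ → PowerSeries ℂ) (j : ℤ) :
    weightInt (weight psi) j = ((expSeries (2 * TInt psi j) : PowerSeries ℂ) : HSeries) := by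
  rw [weightInt, TInt]
  split_ifs with h
  · rfl
  · rw [weight]
    refine inv_eq_of_mul_eq_one_right ?_
    rw [← PowerSeries.coe_mul, mul_neg, expSeries_mul_neg, PowerSeries.coe_one]

theorem weight_ne_zero (psi : ℕ → PowerSeries ℂ) (k : ℕ) : weight psi k ≠ 0 := by
  intro h
  have := congrArg (· * ((expSeries (-(2 * T psi k)) : PowerSeries ℂ) : HSeries)) h
  simp only [weight, ← PowerSeries.coe_mul, expSeries_mul_neg, zero_mul, PowerSeries.coe_one] at this
  exact one_ne_zero this

theorem weight_zero (psi : ℕ → PowerSeries ℂ) : weight psi 0 = 1 := by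
  simp [weight, T, expSeries_zero]

/-- T_j - T_{j-k} telescopes into k values of ψ̄, each with symbol ψ_0, so the ratio of weights has
symbol e^{2kψ}. -/
theorem exists_hasSymbol_weight_div {psi : ℕ → PowerSeries ℂ}
    (hpsi : ∀ d n, Odd n → coeff n (psi d) = 0) (k : ℕ) :
    ∃ h : ℤ → PowerSeries ℂ, HasSymbol h (expSeries (2 * psi 0) ^ k) ∧ ∀ j : ℤ,
      weightInt (weight psi) j / weightInt (weight psi) (j - k) = ((h j : PowerSeries ℂ) : HSeries) := by
  refine ⟨fun j => expSeries (C 2 * ∑ i ∈ Finset.range k, psiBarAt psi (j + (i - k + 1 / 2))), ?_,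
    fun j => ?_⟩
  · have := ((HasSymbol.sum (Finset.range k) fun i _ =>
      hasSymbol_psiBarAt psi (i - k + 1 / 2)).const_mul (C 2)).exp
    rw [← expSeries_nsmul]
    convert this using 2
    have : (C 2 : PowerSeries ℂ) = 2 := map_ofNat C 2
    rw [constantCoeff_C, this]
    simp [mul_left_comm]
  · have h1 : expSeries (2 * TInt psi j) = expSeries (2 * TInt psi (j - k)) *
        expSeries (C 2 * ∑ i ∈ Finset.range k, psiBarAt psi (j + (i - k + 1 / 2))) := by
      rw [← TInt_sub hpsi, ← expSeries_add]
      congr 1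
      have : (C 2 : PowerSeries ℂ) = 2 := map_ofNat C 2
      rw [this]; ring
    have h2 : weightInt (weight psi) (j - k) ≠ 0 := by
      unfold weightInt; split_ifs <;> simp [weight_ne_zero]
    rw [div_eq_iff h2, weightInt_weight, weightInt_weight, h1, PowerSeries.coe_mul, mul_comm]

end Symbols

/-! ### Symbols of the one-particle matrices of nested commutators. -/

section MatrixSymbols

open PowerSeries

theorem shiftOp_apply {K : Type*} [Field K] (f : ℤ → K) (k : ℤ) (v : ℤ →₀ K) (m : ℤ) :
    shiftOp f k v m = f (m + k) * v (m + k) := by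
  have key : (Finsupp.lapply m ∘ₗ shiftOp f k : (ℤ →₀ K) →ₗ[K] K) =
      f (m + k) • Finsupp.lapply (m + k) := by
    refine Finsupp.lhom_ext' fun j => LinearMap.ext_ring ?_
    simp only [LinearMap.comp_apply, Finsupp.lsingle_apply, shiftOp_single, Finsupp.lapply_apply,
      LinearMap.smul_apply, smul_eq_mul]
    by_cases h : j = m + k
    · subst h; simp
    · rw [Finsupp.single_eq_of_ne (by omega), Finsupp.single_eq_of_ne (by omega), mul_zero]
  exact LinearMap.congr_fun key v

/-- The one-particle operator of `bosonMinus`. -/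
def shiftMinus {K : Type*} [Field K] (s : ℕ → K) (N : ℕ) : Module.End K (ℤ →₀ K) :=
  ∑ j ∈ Finset.range N, s j • shiftOp 1 (-(2 * j + 1))

theorem isQuad_bosonMinus {K : Type*} [Field K] [NeZero (2 : K)] (s : ℕ → K) (N : ℕ) :
    IsQuad (bosonMinus s N) (shiftMinus s N) :=
  IsQuad.sum _ fun j _ => (isQuad_boson ⟨-(j + 1 : ℤ), by ring⟩).smul (s j)

theorem shiftMinus_apply {K : Type*} [Field K] (s : ℕ → K) (N : ℕ) (v : ℤ →₀ K) (m : ℤ) :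
    shiftMinus s N v m = ∑ j ∈ Finset.range N, s j * v (m - (2 * j + 1)) := by
  simp [shiftMinus, Finsupp.finsetSum_apply, shiftOp_apply, sub_eq_add_neg]

theorem shiftMinus_single {K : Type*} [Field K] (s : ℕ → K) (N : ℕ) (i : ℤ) :
    shiftMinus s N (Finsupp.single i 1) =
      ∑ j ∈ Finset.range N, s j • Finsupp.single (i + (2 * j + 1)) 1 := by
  simp only [shiftMinus, LinearMap.sum_apply, LinearMap.smul_apply, shiftOp_single, sub_neg_eq_add,
    Pi.one_apply]

theorem nested_shiftMinus_succ {K : Type*} [Field K] (s : ℕ → K) (N : ℕ)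
    (A : Module.End K (ℤ →₀ K)) (l : ℕ) (i m : ℤ) :
    nested (shiftMinus s N) A (l + 1) (Finsupp.single i 1) m = ∑ j ∈ Finset.range N, s j *
      (nested (shiftMinus s N) A l (Finsupp.single (i + (2 * j + 1)) 1) m -
        nested (shiftMinus s N) A l (Finsupp.single i 1) (m - (2 * j + 1))) := by
  have : nested (shiftMinus s N) A (l + 1) (Finsupp.single i 1) m =
      nested (shiftMinus s N) A l (shiftMinus s N (Finsupp.single i 1)) m -
        shiftMinus s N (nested (shiftMinus s N) A l (Finsupp.single i 1)) m := rfl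
  rw [this, shiftMinus_apply, shiftMinus_single, map_sum, Finsupp.finsetSum_apply,
    ← Finset.sum_sub_distrib]
  refine Finset.sum_congr rfl fun j _ => ?_
  rw [map_smul, Finsupp.smul_apply, smul_eq_mul, mul_sub]

/-- Linear operators on finitely supported sequences. -/
abbrev SeqEnd (K : Type*) [Field K] : Type _ := Module.End K (ℤ →₀ K)

/-- The matrix entries `A e_i ↦ e_{i-n}` are power series in `ħ` with symbol `σ n`. -/
def HasMatrixSymbol (A : SeqEnd HSeries) (σ : ℤ → PowerSeries ℂ) : Prop :=
  ∀ n : ℤ, ∃ h : ℤ → PowerSeries ℂ, HasSymbol h (σ n) ∧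
    ∀ i : ℤ, A (Finsupp.single i 1) (i - n) = ((h i : PowerSeries ℂ) : HSeries)

/-- The ħ gained by a finite difference pays for the ħ⁻¹ in the rescaled times, so commutators stay
in power series. -/
theorem sTimeRescaled_mul (y : ℕ → PowerSeries ℂ) (j : ℕ) (f : PowerSeries ℂ) :
    sTimeRescaled y j * ((X * f : PowerSeries ℂ) : HSeries) =
      ((sTime y j * f : PowerSeries ℂ) : HSeries) := by
  rw [sTimeRescaled, PowerSeries.coe_mul, PowerSeries.coe_mul, PowerSeries.coe_X]
  have : (HahnSeries.single (-1 : ℤ) (1 : ℂ)) * (HahnSeries.single (1 : ℤ) (1 : ℂ)) = 1 := by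
    rw [HahnSeries.single_mul_single]; simp
  linear_combination ((sTime y j : PowerSeries ℂ) : HSeries) * (f : HSeries) * this

theorem constantCoeff_sTime (y : ℕ → PowerSeries ℂ) (j : ℕ) :
    constantCoeff (sTime y j) = coeff (2 * j + 1) (y 0) / (2 * j + 1) := by
  rw [← coeff_zero_eq_constantCoeff_apply, sTime, coeff_mk]
  simp

/-- A commutator with the shift by -(2j+1) is a difference of step 2j+1 along a diagonal of the
matrix. The step cancels the denominator of s_{2j+1} and leaves the coefficient of y_0. -/
theorem HasMatrixSymbol.nested_succ {A : SeqEnd HSeries} {y : ℕ → PowerSeries ℂ} {N l : ℕ}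
    {σ : ℤ → PowerSeries ℂ}
    (hA : HasMatrixSymbol (nested (shiftMinus (sTimeRescaled y) N) A l) σ) :
    HasMatrixSymbol (nested (shiftMinus (sTimeRescaled y) N) A (l + 1))
      fun n => ∑ j ∈ Finset.range N,
        C (coeff (2 * j + 1) (y 0)) * derivative ℂ (σ (n + (2 * j + 1))) := by
  intro n
  choose h h1 h2 using hA
  choose h' h3 h4 using fun j : ℕ => (h1 (n + (2 * j + 1))).difference (2 * j + 1)
  refine ⟨fun i => ∑ j ∈ Finset.range N, sTime y j * h' j i, ?_, fun i => ?_⟩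
  · refine HasSymbol.sum _ fun j _ => ?_
    have := (h4 j).const_mul (sTime y j)
    rw [constantCoeff_sTime, ← mul_assoc, ← map_mul] at this
    have h0 : (2 * (j : ℂ) + 1) ≠ 0 := by exact_mod_cast Nat.succ_ne_zero (2 * j)
    convert this using 3
    push_cast
    rw [div_mul_cancel₀ _ h0]
  · rw [nested_shiftMinus_succ, map_sum]
    refine Finset.sum_congr rfl fun j _ => ?_
    have e2 := h2 (n + (2 * j + 1)) (i + (2 * j + 1))
    have e3 := h2 (n + (2 * j + 1)) i
    rw [show i + (2 * (j : ℤ) + 1) - (n + (2 * j + 1)) = i - n by ring] at e2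
    rw [show i - (n + (2 * (j : ℤ) + 1)) = i - n - (2 * j + 1) by ring] at e3
    rw [e2, e3, ← PowerSeries.coe_sub, h3, add_sub_cancel_left, sTimeRescaled_mul]

/-- The coefficient of `z ^ m`, `m ∈ ℤ`, of a power series. -/
def coeffInt (m : ℤ) (f : PowerSeries ℂ) : ℂ := if 0 ≤ m then coeff m.natAbs f else 0

theorem coeffInt_natCast (m : ℕ) (f : PowerSeries ℂ) : coeffInt m f = coeff m f := by
  simp [coeffInt]

/-- The truncation `∑_{j < N} y_{2j+1} z^{2j+1}` of an odd series. -/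
def oddTrunc (f : PowerSeries ℂ) (N : ℕ) : PowerSeries ℂ :=
  ∑ j ∈ Finset.range N, C (coeff (2 * j + 1) f) * X ^ (2 * j + 1)

theorem coeffInt_oddTrunc_mul (f g : PowerSeries ℂ) (N : ℕ) (m : ℤ) :
    coeffInt m (oddTrunc f N * g) =
      ∑ j ∈ Finset.range N, coeff (2 * j + 1) f * coeffInt (m - (2 * j + 1)) g := by
  unfold coeffInt
  split_ifs with h
  · rw [oddTrunc, Finset.sum_mul, map_sum]
    refine Finset.sum_congr rfl fun j _ => ?_
    rw [mul_assoc, coeff_C_mul, coeff_X_pow_mul']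
    by_cases h' : 2 * j + 1 ≤ m.natAbs
    · rw [if_pos h', if_pos (by omega), show (m - (2 * j + 1)).natAbs = m.natAbs - (2 * j + 1) by omega]
    · rw [if_neg h', if_neg (by omega)]
  · rw [Finset.sum_eq_zero]
    intro j _
    rw [if_neg (by omega), mul_zero]

/-- Each commutator differentiates the symbol once and convolves the diagonals with the coefficients
of y_0, which is multiplication of y^l by y. -/
theorem hasMatrixSymbol_nested {A : SeqEnd HSeries} {k : ℤ}
    {E : PowerSeries ℂ} (hA : HasMatrixSymbol A fun n => if n = k then E else 0)
    (y : ℕ → PowerSeries ℂ) (N l : ℕ) :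
    HasMatrixSymbol (nested (shiftMinus (sTimeRescaled y) N) A l)
      fun n => C (coeffInt (k - n) (oddTrunc (y 0) N ^ l)) * (derivative ℂ)^[l] E := by
  induction l with
  | zero =>
    refine (congrArg (HasMatrixSymbol A) (funext fun n => ?_)).mp hA
    rw [eq_comm, Function.iterate_zero, id]
    by_cases h : n = k
    · subst h; simp [coeffInt]
    · rw [if_neg h, pow_zero, coeffInt]
      split_ifs with h'
      · rw [coeff_one, if_neg (by omega)]; simp
      · simp
  | succ l ih =>
    refine (congrArg (HasMatrixSymbol _) (funext fun n => ?_)).mp ih.nested_succ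
    rw [eq_comm]
    rw [pow_succ', coeffInt_oddTrunc_mul, map_sum, Finset.sum_mul]
    refine Finset.sum_congr rfl fun j _ => ?_
    rw [Derivation.leibniz, derivative_C, smul_zero, add_zero, smul_eq_mul, map_mul,
      Function.iterate_succ_apply', ← mul_assoc]
    congr 4; ring

theorem shiftOp_weight_hasMatrixSymbol {psi : ℕ → PowerSeries ℂ}
    (hpsi : ∀ d n, Odd n → coeff n (psi d) = 0) (k : ℕ) :
    HasMatrixSymbol
      (shiftOp (fun j => weightInt (weight psi) j / weightInt (weight psi) (j - k)) k)
      fun n => if n = (k : ℤ) then expSeries (2 * psi 0) ^ k else 0 := by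
  intro n
  obtain ⟨h, h1, h2⟩ := exists_hasSymbol_weight_div hpsi k
  by_cases hn : n = k
  · subst hn
    refine ⟨h, by simpa using h1, fun i => ?_⟩
    rw [shiftOp_single, Finsupp.single_eq_same, h2]
  · refine ⟨fun _ => 0, by simpa [hn] using hasSymbol_const 0, fun i => ?_⟩
    rw [shiftOp_single, Finsupp.single_eq_of_ne (by omega)]; simp

/-- The coefficients of the nested commutators, divided by `l!`, at `ħ = 0`. -/
theorem exists_nested_entries {psi : ℕ → PowerSeries ℂ}
    (hpsi : ∀ d n, Odd n → coeff n (psi d) = 0) (y : ℕ → PowerSeries ℂ) (k N l : ℕ) :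
    ∃ h : ℤ → ℤ → PowerSeries ℂ,
      (∀ n i, nested (shiftMinus (sTimeRescaled y) N)
        (shiftOp (fun j => weightInt (weight psi) j / weightInt (weight psi) (j - k)) k) l
          (Finsupp.single i 1) (i - n) = ((h n i : PowerSeries ℂ) : HSeries)) ∧
      ∀ n i, constantCoeff (h n i) =
        (l ! : ℂ) * (coeffInt (k - n) (oddTrunc (y 0) N ^ l) *
          coeff l (expSeries (2 * psi 0) ^ k)) := by
  choose h h1 h2 using hasMatrixSymbol_nested (shiftOp_weight_hasMatrixSymbol hpsi k) y N l
  refine ⟨h, h2, fun n i => ?_⟩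
  rw [(h1 n).constantCoeff, map_mul, constantCoeff_C, constantCoeff_iterate_derivative]
  ring

end MatrixSymbols

/-! ### Leading order of the one-point function. -/

section Leading

open PowerSeries

/-- Group by n = a + b = 2r + 1 with b < a, so b runs from 0 to r. The term b = 0 has weight 1/2 and
the others have weight 1, in total r + 1/2 = n/2. -/
theorem sum_pairing (F : ℕ → ℂ) (M : ℕ) (hF : ∀ n, Even n → F n = 0) (hM : ∀ n, M ≤ n → F n = 0) :
    ∑ a ∈ Finset.range M, ∑ b ∈ Finset.range a, -(-1) ^ a * pairing ℂ b * F (a + b) =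
      ∑ n ∈ Finset.range M, (n / 2 : ℂ) * F n := by
  have h1 : ∀ n : ℕ, (n / 2 : ℂ) * F n =
      ∑ b ∈ Finset.range ((n + 1) / 2), -(-1) ^ (n - b) * pairing ℂ b * F n := by
    intro n
    rcases Nat.even_or_odd n with hn | ⟨r, rfl⟩
    · simp [hF n hn]
    · rw [← Finset.sum_mul]
      congr 1
      have : (2 * r + 1 + 1) / 2 = r + 1 := by omega
      rw [this, Finset.sum_range_succ']
      have h2 : ∀ b ∈ Finset.range r,
          -(-1 : ℂ) ^ (2 * r + 1 - (b + 1)) * pairing ℂ (b + 1) = 1 := by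
        intro b hb
        rw [Finset.mem_range] at hb
        rw [pairing, if_neg (by omega), neg_mul, ← pow_add, Odd.neg_one_pow, neg_neg]
        exact ⟨r, by omega⟩
      rw [Finset.sum_congr rfl h2]
      simp [pairing, pow_add, pow_mul]
      ring
  simp only [h1, Finset.sum_sigma']
  refine Finset.sum_bij_ne_zero (fun p _ _ => ⟨p.1 + p.2, p.2⟩) ?_ ?_ ?_ ?_
  · rintro ⟨a, b⟩ hp hne
    simp only [Finset.mem_sigma, Finset.mem_range] at hp ⊢
    have h2 : ¬ M ≤ a + b := fun h => hne (by simp [hM _ h])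
    omega
  · rintro ⟨a, b⟩ _ _ ⟨c, d⟩ _ _ h
    simp only [Sigma.mk.injEq, heq_eq_eq] at h ⊢
    omega
  · rintro ⟨n, b⟩ hp hne
    simp only [Finset.mem_sigma, Finset.mem_range] at hp
    refine ⟨⟨n - b, b⟩, ?_, ?_, ?_⟩
    · simp only [Finset.mem_sigma, Finset.mem_range]; omega
    · have : n - b + b = n := by omega
      simpa only [this] using hne
    · simp only [Sigma.mk.injEq, heq_eq_eq, and_true]; omega
  · rintro ⟨a, b⟩ _ _
    simp only [Nat.add_sub_cancel]

theorem sum_range_antidiagonal {R : Type*} [AddCommMonoid R] (F : ℕ → ℕ → R) {M Λ : ℕ}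
    (hΛ : 2 * M ≤ Λ) (h1 : ∀ p q, M ≤ p → F p q = 0) (h2 : ∀ p q, M ≤ q → F p q = 0) :
    ∑ l ∈ Finset.range Λ, ∑ x ∈ Finset.HasAntidiagonal.antidiagonal l, F x.1 x.2 =
      ∑ p ∈ Finset.range M, ∑ q ∈ Finset.range M, F p q := by
  rw [← Finset.sum_product' (Finset.range M) (Finset.range M) F,
    ← Finset.sum_fiberwise_of_maps_to (t := Finset.range Λ) (g := fun x : ℕ × ℕ => x.1 + x.2)]
  · refine Finset.sum_congr rfl fun l _ =>
      Finset.sum_congr_of_eq_on_inter ?_ ?_ fun _ _ _ => rfl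
    · rintro ⟨p, q⟩ hx hx'
      have hx := Finset.HasAntidiagonal.mem_antidiagonal.1 hx
      simp only [Finset.mem_filter, Finset.mem_product, Finset.mem_range, not_and_or, not_lt] at hx'
      rcases hx' with (h | h) | h
      · exact h1 _ _ h
      · exact h2 _ _ h
      · exact absurd hx h
    · rintro ⟨p, q⟩ hx hx'
      exact absurd (Finset.HasAntidiagonal.mem_antidiagonal.2 (Finset.mem_filter.1 hx).2) hx'
  · rintro ⟨p, q⟩ hx
    simp only [Finset.mem_product, Finset.mem_range] at hx ⊢
    omega

/-- Each commutator raises the index by at most 2N - 1; the bound provides the cutoff required by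
Wick's theorem. -/
theorem nested_shiftMinus_apply_eq_zero {K : Type*} [Field K] (s : ℕ → K) (N : ℕ) (f : ℤ → K)
    (k : ℤ) (l : ℕ) (i m : ℤ) (h : i - k + 2 * N * l < m) :
    nested (shiftMinus s N) (shiftOp f k) l (Finsupp.single i 1) m = 0 := by
  induction l generalizing i m with
  | zero =>
    simp only [nested, shiftOp_single]
    exact Finsupp.single_eq_of_ne (by push_cast at h; omega)
  | succ l ih =>
    rw [nested_shiftMinus_succ]
    refine Finset.sum_eq_zero fun j hj => ?_
    rw [Finset.mem_range] at hj
    have h' : i - k + 2 * (N : ℤ) * l + 2 * N < m := by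
      have : (2 : ℤ) * N * (l + 1 : ℕ) = 2 * N * l + 2 * N := by push_cast; ring
      linarith
    rw [ih _ _ (by linarith [(by exact_mod_cast hj : (j : ℤ) + 1 ≤ N)]),
      ih _ _ (by linarith [(by exact_mod_cast hj : (j : ℤ) + 1 ≤ N)]), sub_self, mul_zero]

/-- The constants as a subring of `HSeries`. -/
def constH : ℂ →+* HSeries := (HahnSeries.ofPowerSeries ℤ ℂ).comp (C : ℂ →+* PowerSeries ℂ)

instance charZero_hSeries : CharZero HSeries := charZero_of_injective_ringHom constH.injective

theorem constH_apply (c : ℂ) : constH c = ((C c : PowerSeries ℂ) : HSeries) := rfl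

theorem constH_pairing (a b : ℕ) :
    -(-1) ^ a * pairing HSeries b = constH (-(-1) ^ a * pairing ℂ b) := by
  rw [map_mul, map_neg, map_pow, map_neg, map_one]
  congr 1
  unfold pairing
  split_ifs
  · rw [map_div₀, map_one, map_ofNat]
  · rw [map_pow, map_neg, map_one]

theorem coeff_zero_coe (f : PowerSeries ℂ) :
    ((f : PowerSeries ℂ) : HSeries).coeff 0 = constantCoeff f := by
  have := LaurentSeries.coeff_coe_powerSeries f 0
  simpa using this

theorem coeff_constH_mul (c : ℂ) (x : HSeries) (n : ℤ) : (constH c * x).coeff n = c * x.coeff n := by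
  rw [constH_apply, PowerSeries.coe_C, HahnSeries.C_mul_eq_smul, HahnSeries.coeff_smul, smul_eq_mul]

theorem coeff_neg_one_coe_mul_sTimeRescaled (y : ℕ → PowerSeries ℂ) (j : ℕ) (f : PowerSeries ℂ) :
    (((f : PowerSeries ℂ) : HSeries) * sTimeRescaled y j).coeff (-1) =
      constantCoeff f * (coeff (2 * j + 1) (y 0) / (2 * j + 1)) := by
  have h := HahnSeries.coeff_single_mul_add (r := (1 : ℂ))
    (x := ((sTime y j * f : PowerSeries ℂ) : HSeries)) (a := 0) (b := -1)
  rw [zero_add, one_mul, coeff_zero_coe, map_mul constantCoeff, constantCoeff_sTime,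
    PowerSeries.coe_mul, ← mul_assoc] at h
  rw [mul_comm, sTimeRescaled, h, mul_comm]

theorem X_pow_dvd_sub_oddTrunc {f : PowerSeries ℂ} (hf : ∀ n, Even n → coeff n f = 0) (N : ℕ) :
    X ^ (2 * N + 1) ∣ f - oddTrunc f N := by
  rw [X_pow_dvd_iff]
  intro m hm
  have h : coeff m (oddTrunc f N) = ∑ j ∈ Finset.range N,
      if m = 2 * j + 1 then coeff m f else 0 := by
    rw [oddTrunc, map_sum]
    refine Finset.sum_congr rfl fun j _ => ?_
    rw [coeff_C_mul, coeff_X_pow]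
    split_ifs with h <;> simp [h]
  rw [map_sub, h, sub_eq_zero]
  rcases Nat.even_or_odd m with he | ⟨r, hr⟩
  · rw [hf m he]; simp
  · rw [Finset.sum_eq_single r]
    · rw [if_pos hr]
    · intro j _ hj; rw [if_neg (by omega)]
    · intro h'; rw [Finset.mem_range] at h'; omega

theorem coeff_oddTrunc_pow {f : PowerSeries ℂ} (hf : ∀ n, Even n → coeff n f = 0) {N m : ℕ}
    (hm : m < 2 * N + 1) (l : ℕ) : coeff m (oddTrunc f N ^ l) = coeff m (f ^ l) := by
  have := X_pow_dvd_iff.1 ((X_pow_dvd_sub_oddTrunc hf N).trans (sub_dvd_pow_sub_pow _ _ l)) m hm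
  rw [map_sub, sub_eq_zero] at this
  exact this.symm

theorem constantCoeff_oddTrunc (f : PowerSeries ℂ) (N : ℕ) : constantCoeff (oddTrunc f N) = 0 := by
  simp [oddTrunc]

/-- The parity of a series in terms of `z ↦ -z`. -/
theorem coeff_eq_zero_of_rescale {f : PowerSeries ℂ} {p m : ℕ}
    (h : rescale (-1 : ℂ) f = (-1) ^ p * f) (hpm : Odd (p + m)) : coeff m f = 0 := by
  have h1 := congrArg (coeff m) h
  have e : ((-1 : PowerSeries ℂ)) ^ p = C ((-1 : ℂ) ^ p) := by simp
  rw [coeff_rescale, e, coeff_C_mul] at h1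
  have h2 : (-1 : ℂ) ^ p * (-1) ^ m = -1 := by rw [← pow_add, hpm.neg_one_pow]
  have h3 : (-1 : ℂ) ^ p * (-1) ^ p = 1 := by rw [← mul_pow]; simp
  linear_combination (-1 / 2 * (-1 : ℂ) ^ p) * h1 + 1 / 2 * coeff m f * h2 -
    1 / 2 * coeff m f * h3

theorem rescale_of_odd {f : PowerSeries ℂ} (hf : ∀ n, Even n → coeff n f = 0) :
    rescale (-1 : ℂ) f = -f := by
  ext n
  rw [coeff_rescale, map_neg]
  rcases Nat.even_or_odd n with h | h
  · rw [hf n h]; simp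
  · rw [h.neg_one_pow]; simp

theorem rescale_of_even {f : PowerSeries ℂ} (hf : ∀ n, Odd n → coeff n f = 0) :
    rescale (-1 : ℂ) f = f := by
  ext n
  rw [coeff_rescale]
  rcases Nat.even_or_odd n with h | h
  · rw [h.neg_one_pow]; simp
  · rw [hf n h]; simp

theorem rescale_oddTrunc (f : PowerSeries ℂ) (N : ℕ) :
    rescale (-1 : ℂ) (oddTrunc f N) = -oddTrunc f N := by
  refine rescale_of_odd fun n hn => ?_
  rw [oddTrunc, map_sum]
  refine Finset.sum_eq_zero fun j _ => ?_
  rw [coeff_C_mul, coeff_X_pow, if_neg, mul_zero]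
  rintro rfl
  simp [parity_simps] at hn

theorem rescale_expSeries (f : PowerSeries ℂ) (r : ℂ) :
    rescale r (expSeries f) = expSeries (rescale r f) := by
  rw [rescale_eq_subst, rescale_eq_subst, expSeries_subst]
  simp

/-- The leading coefficient of the `1`-point function, contribution of `l + 1` operators. -/
theorem coeff_vev_nested_succ {psi : ℕ → PowerSeries ℂ}
    (hpsi : ∀ d n, Odd n → coeff n (psi d) = 0) (y : ℕ → PowerSeries ℂ) {k : ℕ} (hk : Odd k)
    (N l : ℕ) :
    (vev HSeries (nested (bosonMinus (sTimeRescaled y) N)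
      (dressedBoson (weight psi) k) (l + 1))).coeff (-1) =
      1 / 2 * ((l ! : ℂ) * (coeff l (expSeries (2 * psi 0) ^ k) *
        coeff k (oddTrunc (y 0) N ^ (l + 1)))) := by
  have hJ := isQuad_bosonMinus (sTimeRescaled y) N
  have hP := (isQuad_dressedBoson (weight_zero psi) (weight_ne_zero psi)
    (k := (k : ℤ)) (by exact_mod_cast hk)).nested hJ l
  obtain ⟨h, h1, h2⟩ := exists_nested_entries hpsi y k N l
  -- The last commutator is opened again, as the term with J on the left vanishes. This leaves a
  -- product of two quadratic operators, to which Wick's theorem applies.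
  have e0 : vev HSeries (nested (bosonMinus (sTimeRescaled y) N)
      (dressedBoson (weight psi) k) (l + 1)) = vev HSeries (nested (bosonMinus (sTimeRescaled y) N)
      (dressedBoson (weight psi) k) l * bosonMinus (sTimeRescaled y) N) := by
    rw [nested_mul, vev_add, vev_mul_of_apply_empty (bosonMinus_apply_empty _ _), add_zero]
  have e1 : vev HSeries (bosonMinus (sTimeRescaled y) N) = 0 := bosonMinus_apply_empty _ _ _
  have e2 : ∀ a b : ℕ, shiftMinus (sTimeRescaled y) N (Finsupp.single (-a : ℤ) 1) b =
      ∑ j ∈ Finset.range N, if a + b = 2 * j + 1 then sTimeRescaled y j else 0 := by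
    intro a b
    rw [shiftMinus_single, Finsupp.finsetSum_apply]
    refine Finset.sum_congr rfl fun j _ => ?_
    rw [Finsupp.smul_apply, Finsupp.single_apply]
    by_cases h : a + b = 2 * j + 1
    · rw [if_pos h, if_pos (by omega)]; simp
    · rw [if_neg h, if_neg (by omega)]; simp
  -- The entry of the shift from -a to b needs a + b = 2j + 1 with j < N, whence the cutoff 2N.
  rw [e0, hP.vev_mul hJ (2 * N), e1, mul_zero, zero_add]
  swap
  · intro a b hab
    rw [e2]
    refine Finset.sum_eq_zero fun j hj => ?_
    rw [Finset.mem_range] at hj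
    rw [if_neg (by omega)]
  let F : ℕ → ℂ := fun n => ∑ j ∈ Finset.range N, if n = 2 * j + 1 then
    constantCoeff (h n 0) * (coeff (2 * j + 1) (y 0) / (2 * j + 1)) else 0
  have e3 : ∀ a b : ℕ, (-(-1) ^ a * pairing HSeries b *
      (nested (shiftMinus (sTimeRescaled y) N)
        (shiftOp (fun j => weightInt (weight psi) j / weightInt (weight psi) (j - k)) k) l
          (Finsupp.single (a : ℤ) 1) (-b) *
        shiftMinus (sTimeRescaled y) N (Finsupp.single (-a : ℤ) 1) b)).coeff (-1) =
      -(-1) ^ a * pairing ℂ b * F (a + b) := by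
    intro a b
    have h3 := h1 (a + b : ℕ) a
    rw [show (a : ℤ) - (a + b : ℕ) = -b by push_cast; ring] at h3
    rw [constH_pairing, coeff_constH_mul, h3, e2, Finset.mul_sum, HahnSeries.coeff_sum]
    congr 1
    refine Finset.sum_congr rfl fun j _ => ?_
    split_ifs with hab
    · rw [coeff_neg_one_coe_mul_sTimeRescaled, h2, h2]
    · rw [mul_zero]; rfl
  rw [HahnSeries.coeff_sum]
  have e4 : ∀ a ∈ Finset.range (2 * N), (∑ b ∈ Finset.range a, -(-1) ^ a * pairing HSeries b *
      (nested (shiftMinus (sTimeRescaled y) N)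
        (shiftOp (fun j => weightInt (weight psi) j / weightInt (weight psi) (j - k)) k) l
          (Finsupp.single (a : ℤ) 1) (-b) *
        shiftMinus (sTimeRescaled y) N (Finsupp.single (-a : ℤ) 1) b)).coeff (-1) =
      ∑ b ∈ Finset.range a, -(-1) ^ a * pairing ℂ b * F (a + b) := by
    intro a _
    rw [HahnSeries.coeff_sum]
    exact Finset.sum_congr rfl fun b _ => e3 a b
  rw [Finset.sum_congr rfl e4, sum_pairing]
  · have e5 : ∀ n ∈ Finset.range (2 * N), (n / 2 : ℂ) * F n = ∑ j ∈ Finset.range N,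
        if n = 2 * j + 1 then 1 / 2 * (constantCoeff (h (2 * j + 1) 0) * coeff (2 * j + 1) (y 0))
          else 0 := by
      intro n _
      simp only [F, Finset.mul_sum]
      refine Finset.sum_congr rfl fun j _ => ?_
      split_ifs with hn
      · subst hn
        have : (2 * (j : ℂ) + 1) ≠ 0 := by exact_mod_cast Nat.succ_ne_zero (2 * j)
        push_cast
        field_simp
      · rw [mul_zero]
    rw [Finset.sum_congr rfl e5, Finset.sum_comm, pow_succ', ← coeffInt_natCast k,
      coeffInt_oddTrunc_mul, Finset.mul_sum, Finset.mul_sum, Finset.mul_sum]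
    refine Finset.sum_congr rfl fun j hj => ?_
    rw [Finset.mem_range] at hj
    rw [Finset.sum_ite_eq', if_pos (by rw [Finset.mem_range]; omega), h2]
    ring
  · intro n hn
    refine Finset.sum_eq_zero fun j _ => ?_
    rw [if_neg]
    rintro rfl
    simp [parity_simps] at hn
  · intro n hn
    refine Finset.sum_eq_zero fun j hj => ?_
    rw [Finset.mem_range] at hj
    rw [if_neg (by omega)]

end Leading

/-! ### Leading order of the connected two-point function. -/

section LeadingPair

open PowerSeries

theorem rescale_expSeries_two_mul_pow {f : PowerSeries ℂ} (hf : ∀ n, Odd n → coeff n f = 0)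
    (k : ℕ) : rescale (-1 : ℂ) (expSeries (2 * f) ^ k) = expSeries (2 * f) ^ k := by
  rw [map_pow, rescale_expSeries, map_mul, rescale_of_even hf, map_ofNat]

/-- The l-th power of an odd series has the parity of l, while the exponential of an even one is
even; a nonzero product forces l, and then m, to be even. -/
theorem coeffInt_oddTrunc_pow_mul_coeff_eq_zero {f g : PowerSeries ℂ}
    (hf : ∀ n, Odd n → coeff n f = 0) {N k l : ℕ} {m : ℤ} (hm : Odd m) :
    coeffInt m (oddTrunc g N ^ l) * coeff l (expSeries (2 * f) ^ k) = 0 := by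
  rcases Nat.even_or_odd l with hl | hl
  · unfold coeffInt
    split_ifs with h
    · rw [coeff_eq_zero_of_rescale (p := l), zero_mul]
      · rw [map_pow, rescale_oddTrunc, neg_pow]
      · exact hl.add_odd (Int.natAbs_odd.2 hm)
    · rw [zero_mul]
  · rw [coeff_eq_zero_of_rescale (p := 0) (f := expSeries (2 * f) ^ k), mul_zero]
    · rw [rescale_expSeries_two_mul_pow hf]; simp
    · simpa using hl

/-- The leading coefficient of the connected `2`-point function, contribution of `p + q`
operators. -/
theorem coeff_vev_nested_mul_nested {psi : ℕ → PowerSeries ℂ}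
    (hpsi : ∀ d n, Odd n → coeff n (psi d) = 0) (y : ℕ → PowerSeries ℂ) {k k' : ℕ} (hk : Odd k)
    (hk' : Odd k') (N p q : ℕ) :
    (vev HSeries (nested (bosonMinus (sTimeRescaled y) N) (dressedBoson (weight psi) k) p *
        nested (bosonMinus (sTimeRescaled y) N) (dressedBoson (weight psi) k') q) -
      vev HSeries (nested (bosonMinus (sTimeRescaled y) N) (dressedBoson (weight psi) k) p) *
        vev HSeries (nested (bosonMinus (sTimeRescaled y) N)
          (dressedBoson (weight psi) k') q)).coeff 0 =
      ∑ n ∈ Finset.range (k + 1), (n / 2 : ℂ) *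
        (((p ! : ℂ) * (coeffInt (k - n) (oddTrunc (y 0) N ^ p) *
          coeff p (expSeries (2 * psi 0) ^ k))) *
        ((q ! : ℂ) * (coeffInt (k' + n) (oddTrunc (y 0) N ^ q) *
          coeff q (expSeries (2 * psi 0) ^ k')))) := by
  have hJ := isQuad_bosonMinus (sTimeRescaled y) N
  have hP := (isQuad_dressedBoson (weight_zero psi) (weight_ne_zero psi)
    (k := (k : ℤ)) (by exact_mod_cast hk)).nested hJ p
  have hP' := (isQuad_dressedBoson (weight_zero psi) (weight_ne_zero psi)
    (k := (k' : ℤ)) (by exact_mod_cast hk')).nested hJ q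
  obtain ⟨h, h1, h2⟩ := exists_nested_entries hpsi y k N p
  obtain ⟨h', h1', h2'⟩ := exists_nested_entries hpsi y k' N q
  -- Large enough for the second factor to have no entries from -a with a ≥ M, and for all n ≤ k to
  -- occur.
  set M := k + 1 + 2 * N * q + 1 with hM
  have hMk : k + 1 ≤ M := by omega
  rw [hP.vev_mul hP' M, add_sub_cancel_left]
  swap
  · intro a b hab
    refine nested_shiftMinus_apply_eq_zero _ _ _ _ _ _ _ ?_
    have : (2 : ℤ) * N * q < a := by exact_mod_cast (by omega : 2 * N * q < a)
    omega
  let F : ℕ → ℂ := fun n => constantCoeff (h n 0) * constantCoeff (h' (-n) 0)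
  have e4 : ∀ a ∈ Finset.range M, (∑ b ∈ Finset.range a, -(-1) ^ a * pairing HSeries b *
      (nested (shiftMinus (sTimeRescaled y) N)
        (shiftOp (fun j => weightInt (weight psi) j / weightInt (weight psi) (j - k)) k) p
          (Finsupp.single (a : ℤ) 1) (-b) *
        nested (shiftMinus (sTimeRescaled y) N)
        (shiftOp (fun j => weightInt (weight psi) j / weightInt (weight psi) (j - k')) k') q
          (Finsupp.single (-a : ℤ) 1) b)).coeff 0 =
      ∑ b ∈ Finset.range a, -(-1) ^ a * pairing ℂ b * F (a + b) := by
    intro a _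
    rw [HahnSeries.coeff_sum]
    refine Finset.sum_congr rfl fun b _ => ?_
    have h3 := h1 (a + b : ℕ) a
    rw [show (a : ℤ) - (a + b : ℕ) = -b by push_cast; ring] at h3
    have h4 := h1' (-(a + b : ℕ)) (-a)
    rw [show -(a : ℤ) - -((a + b : ℕ) : ℤ) = b by push_cast; ring] at h4
    rw [constH_pairing, coeff_constH_mul, h3, h4, ← PowerSeries.coe_mul, coeff_zero_coe, map_mul]
    simp only [F, h2, h2']
  rw [HahnSeries.coeff_sum, Finset.sum_congr rfl e4, sum_pairing]
  · rw [← Finset.sum_subset (Finset.range_subset_range.2 hMk)]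
    · refine Finset.sum_congr rfl fun n _ => ?_
      simp only [F, h2, h2', sub_neg_eq_add]
    · intro n _ hn
      rw [Finset.mem_range, not_lt] at hn
      simp only [F, h2]
      rw [coeffInt, if_neg (by omega)]; simp
  · intro n hn
    simp only [F, h2]
    rw [coeffInt_oddTrunc_pow_mul_coeff_eq_zero (hpsi 0)]
    · simp
    · have h5 : Odd (k : ℤ) := by exact_mod_cast hk
      exact h5.sub_even (by exact_mod_cast hn)
  · intro n hn
    simp only [F, h2]
    rw [coeffInt, if_neg (by omega)]; simp

theorem inv_factorial_eq_constH (l : ℕ) : ((l ! : HSeries))⁻¹ = constH (l ! : ℂ)⁻¹ := by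
  rw [map_inv₀, map_natCast]

/-- The leading coefficient of the `1`-point function. -/
theorem coeff_derivAtZero_singleton {psi y : ℕ → PowerSeries ℂ}
    (hpsi : ∀ d n, Odd n → coeff n (psi d) = 0) (hy : ∀ d n, Even n → coeff n (y d) = 0) (j : ℕ)
    {F : PowerSeries ℂ} (hF : derivative ℂ F = expSeries (2 * psi 0) ^ (2 * j + 1))
    (hF0 : constantCoeff F = 0) :
    (derivAtZero (tauAt (weight psi) (sTimeRescaled y)) [j]).coeff (-1) =
      1 / 2 * coeff (2 * j + 1) (F.subst (y 0)) := by
  have hy0 : constantCoeff (y 0) = 0 := by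
    rw [← coeff_zero_eq_constantCoeff_apply]; exact hy 0 0 (by simp)
  -- Without commutators the operator has nonzero energy, so this term vanishes, in accordance with
  -- F(0) = 0.
  have hv0 : vev HSeries (nested (bosonMinus (sTimeRescaled y) (2 * j + 1))
      (dressedBoson (weight psi) (2 * j + 1)) 0) = 0 := by
    rw [nested, dressedBoson, mul_assoc, vev_diagonalElement_mul, boson_mul_diagonalElement
      (weight_ne_zero psi), vev_diagonalElement_mul]
    rw [dressedBoson, mul_assoc, vev_diagonalElement_mul]
    have h1 : HasEnergy (boson HSeries (2 * j + 1) * diagonalElement (weight psi)) _ :=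
      (hasEnergy_boson (by omega)).mul (hasEnergy_diagonalElement _)
    refine h1.vev_eq_zero ?_
    rw [add_zero, neg_ne_zero]
    exact_mod_cast (by omega : (2 * (j : ℤ) + 1) ≠ 0)
  rw [coeff_subst_eq_sum F hy0 (Nat.lt_succ_self _), Finset.sum_range_succ',
    coeff_zero_eq_constantCoeff_apply, hF0, zero_mul, add_zero,
    derivAtZero_tauAt_singleton (weight_ne_zero psi) (sTimeRescaled y) j le_rfl
    (Nat.lt_succ_self _), Finset.sum_range_succ', hv0, mul_zero, add_zero, HahnSeries.coeff_sum,
    Finset.mul_sum]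
  -- The quotient l!/(l+1)! = 1/(l+1) is the factor that integrates F' to F.
  refine Finset.sum_congr rfl fun l _ => ?_
  have h2 := coeff_vev_nested_succ hpsi y (k := 2 * j + 1) ⟨j, rfl⟩ (2 * j + 1) l
  push_cast at h2
  rw [inv_factorial_eq_constH, coeff_constH_mul, h2, coeff_oddTrunc_pow (hy 0) (by omega), ← hF,
    coeff_derivative, Nat.factorial_succ]
  have h3 : (l ! : ℂ) ≠ 0 := by exact_mod_cast Nat.factorial_ne_zero l
  have h4 : ((l : ℂ) + 1) ≠ 0 := by exact_mod_cast Nat.succ_ne_zero l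
  push_cast
  field_simp

/-- The cutoffs l and l + 1 compute the same derivative, so the l-th term is zero. -/
theorem vev_nested_eq_zero {K : Type*} [Field K] [CharZero K] {w : ℕ → K} (hw : ∀ k, w k ≠ 0)
    (s : ℕ → K) (j : ℕ) {N l : ℕ} (hN : 2 * j + 1 ≤ N) (hl : 2 * j + 1 < l) :
    vev K (nested (bosonMinus s N) (dressedBoson w (2 * j + 1)) l) = 0 := by
  have h1 := derivAtZero_tauAt_singleton hw s j hN hl
  have h2 := derivAtZero_tauAt_singleton hw s j hN (hl.trans (Nat.lt_succ_self l))
  rw [Finset.sum_range_succ, ← h1] at h2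
  have h3 : (l ! : K) ≠ 0 := by exact_mod_cast Nat.factorial_ne_zero l
  simpa [h3] using h2

theorem sum_mul_sum_antidiagonal {K : Type*} [Field K] (g h : ℕ → K) {M : ℕ}
    (hg : ∀ p, M ≤ p → g p = 0) (hh : ∀ p, M ≤ p → h p = 0) :
    ∑ l ∈ Finset.range (2 * M), ∑ x ∈ Finset.HasAntidiagonal.antidiagonal l, g x.1 * h x.2 =
      (∑ p ∈ Finset.range M, g p) * ∑ q ∈ Finset.range M, h q := by
  rw [sum_range_antidiagonal (fun p q => g p * h q) le_rfl (fun p q hp => by simp [hg p hp])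
    (fun p q hq => by simp [hh q hq]), Finset.sum_mul_sum]

theorem coeffInt_pow_eq_zero {f : PowerSeries ℂ} (hf : constantCoeff f = 0) {m : ℤ} {l : ℕ}
    (h : m < l) : coeffInt m (f ^ l) = 0 := by
  unfold coeffInt
  split_ifs with h'
  · exact coeff_pow_eq_zero hf (by omega)
  · rfl

/-- The leading coefficient of the connected `2`-point function. -/
theorem coeff_derivAtZero_pair {psi y : ℕ → PowerSeries ℂ}
    (hpsi : ∀ d n, Odd n → coeff n (psi d) = 0) (hy : ∀ d n, Even n → coeff n (y d) = 0)
    (i j : ℕ) :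
    (derivAtZero (tauAt (weight psi) (sTimeRescaled y)) [i, j] -
      derivAtZero (tauAt (weight psi) (sTimeRescaled y)) [i] *
        derivAtZero (tauAt (weight psi) (sTimeRescaled y)) [j]).coeff 0 =
      ∑ n ∈ Finset.range (2 * i + 1 + 1), (n / 2 : ℂ) *
        (coeff (2 * i + 1 - n) ((expSeries (2 * psi 0) ^ (2 * i + 1)).subst (y 0)) *
          coeff (2 * j + 1 + n) ((expSeries (2 * psi 0) ^ (2 * j + 1)).subst (y 0))) := by
  have hy0 : constantCoeff (y 0) = 0 := by
    rw [← coeff_zero_eq_constantCoeff_apply]; exact hy 0 0 (by simp)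
  set w := weight psi with hw
  have hw0 := weight_ne_zero psi
  set s := sTimeRescaled y with hs
  set N := 2 * i + 1 + (2 * j + 1) with hN
  set M := N + 1 with hM
  set A := nested (bosonMinus s N) (dressedBoson w (2 * i + 1)) with hA
  set A' := nested (bosonMinus s N) (dressedBoson w (2 * j + 1)) with hA'
  set Y := oddTrunc (y 0) N with hY
  have hY0 : constantCoeff Y = 0 := constantCoeff_oddTrunc _ _
  set E := expSeries (2 * psi 0) ^ (2 * i + 1) with hE
  set E' := expSeries (2 * psi 0) ^ (2 * j + 1) with hE'
  -- The disconnected product is written as a sum over pairs (p, q), so that it cancels the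
  -- disconnected part of Wick's theorem term by term.
  have hprod := sum_mul_sum_antidiagonal (fun p => (p ! : HSeries)⁻¹ * vev HSeries (A p))
    (fun q => (q ! : HSeries)⁻¹ * vev HSeries (A' q)) (M := M)
    (fun p hp => by
      simp only [hA]; rw [vev_nested_eq_zero hw0 s i (by omega) (by omega), mul_zero])
    (fun q hq => by
      simp only [hA']; rw [vev_nested_eq_zero hw0 s j (by omega) (by omega), mul_zero])
  rw [derivAtZero_tauAt_pair hw0 s i j le_rfl (Λ := 2 * M) (by omega),
    derivAtZero_tauAt_singleton hw0 s i (N := N) (Λ := M) (by omega) (by omega),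
    derivAtZero_tauAt_singleton hw0 s j (N := N) (Λ := M) (by omega) (by omega)]
  rw [← hA, ← hA', ← hprod, ← Finset.sum_sub_distrib, HahnSeries.coeff_sum]
  let G : ℕ → ℕ → ℂ := fun p q => ∑ n ∈ Finset.range (2 * i + 1 + 1), (n / 2 : ℂ) *
    ((coeff p E * coeffInt ((2 * i + 1 : ℕ) - n) (Y ^ p)) *
      (coeff q E' * coeffInt ((2 * j + 1 : ℕ) + n) (Y ^ q)))
  have hG : ∀ l ∈ Finset.range (2 * M),
      (∑ x ∈ Finset.HasAntidiagonal.antidiagonal l, (x.1 ! : HSeries)⁻¹ * (x.2 ! : HSeries)⁻¹ *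
        vev HSeries (A x.1 * A' x.2) - ∑ x ∈ Finset.HasAntidiagonal.antidiagonal l,
        (x.1 ! : HSeries)⁻¹ * vev HSeries (A x.1) *
          ((x.2 ! : HSeries)⁻¹ * vev HSeries (A' x.2))).coeff 0 =
      ∑ x ∈ Finset.HasAntidiagonal.antidiagonal l, G x.1 x.2 := by
    intro l _
    rw [← Finset.sum_sub_distrib, HahnSeries.coeff_sum]
    refine Finset.sum_congr rfl fun x _ => ?_
    have h1 := coeff_vev_nested_mul_nested hpsi y (k := 2 * i + 1) (k' := 2 * j + 1) ⟨i, rfl⟩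
      ⟨j, rfl⟩ N x.1 x.2
    have c1 : (((2 * i + 1 : ℕ) : ℤ)) = 2 * i + 1 := by push_cast; ring
    have c2 : (((2 * j + 1 : ℕ) : ℤ)) = 2 * j + 1 := by push_cast; ring
    have h2 : (x.1 ! : HSeries)⁻¹ * (x.2 ! : HSeries)⁻¹ *
        vev HSeries (A x.1 * A' x.2) - (x.1 ! : HSeries)⁻¹ * vev HSeries (A x.1) *
          ((x.2 ! : HSeries)⁻¹ * vev HSeries (A' x.2)) =
        constH ((x.1 ! : ℂ)⁻¹ * (x.2 ! : ℂ)⁻¹) *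
          (vev HSeries (A x.1 * A' x.2) - vev HSeries (A x.1) * vev HSeries (A' x.2)) := by
      rw [map_mul, ← inv_factorial_eq_constH, ← inv_factorial_eq_constH]; ring
    rw [c1, c2] at h1
    rw [h2, coeff_constH_mul, hA, hA', h1, Finset.mul_sum]
    refine Finset.sum_congr rfl fun n _ => ?_
    have h3 : (x.1 ! : ℂ) ≠ 0 := by exact_mod_cast Nat.factorial_ne_zero _
    have h4 : (x.2 ! : ℂ) ≠ 0 := by exact_mod_cast Nat.factorial_ne_zero _
    rw [c1, c2]
    field_simp
    simp only [hE, hE', hY]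
    ring
  rw [Finset.sum_congr rfl hG, sum_range_antidiagonal G le_rfl]
  · have h1 : ∀ p ∈ Finset.range M, ∑ q ∈ Finset.range M, G p q =
        ∑ n ∈ Finset.range (2 * i + 1 + 1), (n / 2 : ℂ) *
          ((coeff p E * coeffInt ((2 * i + 1 : ℕ) - n) (Y ^ p)) *
            ∑ q ∈ Finset.range M, coeff q E' * coeffInt ((2 * j + 1 : ℕ) + n) (Y ^ q)) := by
      intro p _
      simp only [G]
      rw [Finset.sum_comm]
      simp only [Finset.mul_sum]
    rw [Finset.sum_congr rfl h1, Finset.sum_comm]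
    refine Finset.sum_congr rfl fun n hn => ?_
    rw [Finset.mem_range] at hn
    rw [← Finset.mul_sum, ← Finset.sum_mul]
    -- Summing over the number of commutators pairs the coefficients of the exponential with the
    -- powers of y, which is composition with y.
    congr 2
    · rw [coeff_subst_eq_sum E hy0 (M := M) (by omega)]
      refine Finset.sum_congr rfl fun p _ => ?_
      rw [show ((2 * i + 1 : ℕ) : ℤ) - n = (2 * i + 1 - n : ℕ) by omega, coeffInt_natCast, hY,
        coeff_oddTrunc_pow (hy 0) (by omega)]
    · rw [coeff_subst_eq_sum E' hy0 (M := M) (by omega)]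
      refine Finset.sum_congr rfl fun p _ => ?_
      rw [show ((2 * j + 1 : ℕ) : ℤ) + n = (2 * j + 1 + n : ℕ) by omega, coeffInt_natCast, hY,
        coeff_oddTrunc_pow (hy 0) (by omega)]
  · intro p q hp
    refine Finset.sum_eq_zero fun n hn => ?_
    rw [coeffInt_pow_eq_zero hY0 (l := p) (by omega)]; simp
  · intro p q hq
    refine Finset.sum_eq_zero fun n hn => ?_
    rw [Finset.mem_range] at hn
    rw [coeffInt_pow_eq_zero hY0 (l := q) (by omega)]; simp

end LeadingPair

/-! ### From the connected functions to the coefficients of W_{0,1} and W_{0,2}. -/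

section Correlators

open PowerSeries

theorem univ_finpartition_fin_one :
    (Finset.univ : Finset (Finpartition (Finset.univ : Finset (Fin 1)))) = {⊥} := by decide

theorem univ_finpartition_fin_two :
    (Finset.univ : Finset (Finpartition (Finset.univ : Finset (Fin 2)))) =
      {⊥, Finpartition.indiscrete (by decide)} := by decide

theorem parts_bot_fin_one : (⊥ : Finpartition (Finset.univ : Finset (Fin 1))).parts = {{0}} := by
  decide

theorem parts_bot_fin_two :
    (⊥ : Finpartition (Finset.univ : Finset (Fin 2))).parts = {{0}, {1}} := by
  decide

variable (psi y : ℕ → PowerSeries ℂ)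

theorem HdiscCoeff_singleton {n : ℕ} (i : Fin n) (m : Fin n →₀ ℕ) :
    HdiscCoeff psi y {i} m = if Odd (m i) then
      derivAtZero (tauAt (weight psi) (sTimeRescaled y)) [m i / 2] / (m i : HSeries) else 0 := by
  have h : (List.finRange n).filter (fun j => j ∈ ({i} : Finset (Fin n))) = [i] := by
    simp only [Finset.mem_singleton]
    have h1 := List.filter_eq (l := List.finRange n) i
    simpa [List.count_eq_one_of_mem (List.nodup_finRange n) (List.mem_finRange i), eq_comm] using h1
  rw [HdiscCoeff, h]
  simp

theorem HdiscCoeff_univ_two (m : Fin 2 →₀ ℕ) :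
    HdiscCoeff psi y Finset.univ m = if Odd (m 0) ∧ Odd (m 1) then
      derivAtZero (tauAt (weight psi) (sTimeRescaled y)) [m 0 / 2, m 1 / 2] /
        ((m 0 : HSeries) * (m 1 : HSeries)) else 0 := by
  have h : (List.finRange 2).filter (fun j => j ∈ (Finset.univ : Finset (Fin 2))) = [0, 1] := by
    decide
  rw [HdiscCoeff, h]
  simp [Fin.forall_fin_two]

theorem coeff_Wconn_one (m : Fin 1 →₀ ℕ) :
    MvPowerSeries.coeff m (Wconn psi y 1) = if Odd (m 0) then
      derivAtZero (tauAt (weight psi) (sTimeRescaled y)) [m 0 / 2] else 0 := by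
  have h1 : MvPowerSeries.coeff m (Wconn psi y 1) =
      (∏ i, (m i : HSeries)) * MvPowerSeries.coeff m (Hconn psi y 1) := rfl
  have h2 : MvPowerSeries.coeff m (Hconn psi y 1) =
      ∑ P : Finpartition (Finset.univ : Finset (Fin 1)),
        (-1) ^ (P.parts.card - 1) * ((P.parts.card - 1)! : HSeries) *
          ∏ B ∈ P.parts, HdiscCoeff psi y B m := rfl
  rw [h1, h2, univ_finpartition_fin_one, Finset.sum_singleton, parts_bot_fin_one,
    Finset.prod_singleton, HdiscCoeff_singleton]
  split_ifs with h
  · have h3 : (m 0 : HSeries) ≠ 0 := by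
      rw [Nat.cast_ne_zero]; exact h.pos.ne'
    simp [mul_div_cancel₀ _ h3]
  · simp

theorem coeff_Wconn_two (m : Fin 2 →₀ ℕ) :
    MvPowerSeries.coeff m (Wconn psi y 2) = if Odd (m 0) ∧ Odd (m 1) then
      derivAtZero (tauAt (weight psi) (sTimeRescaled y)) [m 0 / 2, m 1 / 2] -
      derivAtZero (tauAt (weight psi) (sTimeRescaled y)) [m 0 / 2] *
        derivAtZero (tauAt (weight psi) (sTimeRescaled y)) [m 1 / 2] else 0 := by
  have h1 : MvPowerSeries.coeff m (Wconn psi y 2) =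
      (∏ i, (m i : HSeries)) * MvPowerSeries.coeff m (Hconn psi y 2) := rfl
  have h2 : MvPowerSeries.coeff m (Hconn psi y 2) =
      ∑ P : Finpartition (Finset.univ : Finset (Fin 2)),
        (-1) ^ (P.parts.card - 1) * ((P.parts.card - 1)! : HSeries) *
          ∏ B ∈ P.parts, HdiscCoeff psi y B m := rfl
  rw [h1, h2, univ_finpartition_fin_two, Finset.sum_pair (by decide), parts_bot_fin_two,
    Finset.prod_pair (by decide), HdiscCoeff_singleton, HdiscCoeff_singleton,
    Finpartition.indiscrete_parts, Finset.prod_singleton, HdiscCoeff_univ_two, Fin.prod_univ_two,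
    Finset.card_pair (by decide), Finset.card_singleton]
  by_cases h : Odd (m 0) ∧ Odd (m 1)
  · have h3 : (m 0 : HSeries) ≠ 0 := by
      rw [Nat.cast_ne_zero]; exact h.1.pos.ne'
    have h4 : (m 1 : HSeries) ≠ 0 := by
      rw [Nat.cast_ne_zero]; exact h.2.pos.ne'
    rw [if_pos h, if_pos h, if_pos h.1, if_pos h.2]
    field_simp
    simp
    ring
  · rw [if_neg h, if_neg h]
    rw [not_and_or] at h
    rcases h with h | h <;> simp [h]

variable {psi y}

theorem coeff_W_one (hpsi : ∀ d n, Odd n → coeff n (psi d) = 0)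
    (hy : ∀ d n, Even n → coeff n (y d) = 0) (m : Fin 1 →₀ ℕ) {F : PowerSeries ℂ}
    (hF : derivative ℂ F = expSeries (2 * psi 0) ^ m 0) (hF0 : constantCoeff F = 0) :
    MvPowerSeries.coeff m (W psi y 0 1) =
      if Odd (m 0) then 1 / 2 * coeff (m 0) (F.subst (y 0)) else 0 := by
  have h1 : MvPowerSeries.coeff m (W psi y 0 1) =
      (MvPowerSeries.coeff m (Wconn psi y 1)).coeff (2 * ((0 : ℕ) : ℤ) - 2 + (1 : ℕ)) := rfl
  rw [h1, coeff_Wconn_one]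
  split_ifs with h
  · obtain ⟨r, hr⟩ := h
    have h2 : m 0 / 2 = r := by omega
    rw [hr] at hF
    rw [h2, hr, ← coeff_derivAtZero_singleton hpsi hy r hF hF0]
    norm_num
  · rfl

theorem coeff_W_two (hpsi : ∀ d n, Odd n → coeff n (psi d) = 0)
    (hy : ∀ d n, Even n → coeff n (y d) = 0) (m : Fin 2 →₀ ℕ) :
    MvPowerSeries.coeff m (W psi y 0 2) = if Odd (m 0) ∧ Odd (m 1) then
      ∑ n ∈ Finset.range (m 0 + 1), (n / 2 : ℂ) *
        (coeff (m 0 - n) ((expSeries (2 * psi 0) ^ m 0).subst (y 0)) *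
          coeff (m 1 + n) ((expSeries (2 * psi 0) ^ m 1).subst (y 0))) else 0 := by
  have h1 : MvPowerSeries.coeff m (W psi y 0 2) =
      (MvPowerSeries.coeff m (Wconn psi y 2)).coeff (2 * ((0 : ℕ) : ℤ) - 2 + (2 : ℕ)) := rfl
  rw [h1, coeff_Wconn_two]
  split_ifs with h
  · obtain ⟨⟨r, hr⟩, r', hr'⟩ := h
    have h2 : m 0 / 2 = r := by omega
    have h3 : m 1 / 2 = r' := by omega
    rw [h2, h3, hr, hr', ← coeff_derivAtZero_pair hpsi hy r r']
    norm_num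
  · rfl

end Correlators

/-! ### Lagrange inversion. -/

section Lagrange

open PowerSeries

/-- `Q = z X' / X` for `X = z u`, `u v = 1`. -/
def lagrangeQ (u v : PowerSeries ℂ) : PowerSeries ℂ := 1 - X * derivative ℂ v * u

variable {u v : PowerSeries ℂ}

theorem constantCoeff_lagrangeQ : constantCoeff (lagrangeQ u v) = 1 := by
  simp [lagrangeQ]

theorem coeff_X_mul_derivative (f : PowerSeries ℂ) (p : ℕ) :
    coeff p (X * derivative ℂ f) = p * coeff p f := by
  rcases p with _ | p
  · simp
  · rw [coeff_succ_X_mul, coeff_derivative]; push_cast; ring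

theorem derivative_pow_mul (f : PowerSeries ℂ) (p : ℕ) :
    derivative ℂ (f ^ p) * f = (p : PowerSeries ℂ) * (f ^ p * derivative ℂ f) := by
  rcases p with _ | p
  · simp
  · rw [Derivation.leibniz_pow]
    simp only [Nat.add_sub_cancel, smul_eq_mul, nsmul_eq_mul]
    ring

/-- Since Q = 1 - z v'/v, the left side is (p - z d/dz) v^p, which has no term z^p. -/
theorem natCast_mul_lagrangeQ_mul_pow (huv : u * v = 1) (p : ℕ) :
    (p : PowerSeries ℂ) * (lagrangeQ u v * v ^ p) =
      (p : PowerSeries ℂ) * v ^ p - X * derivative ℂ (v ^ p) := by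
  have h := derivative_pow_mul v p
  have h2 : derivative ℂ (v ^ p) = (p : PowerSeries ℂ) * (v ^ p * derivative ℂ v) * u := by
    rw [← h, mul_assoc, mul_comm v, huv, mul_one]
  rw [h2, lagrangeQ]
  ring

theorem natCast_mul_coeff_eq (k p : ℕ) (f : PowerSeries ℂ) :
    (k : ℂ) * coeff p f = coeff p ((k : PowerSeries ℂ) * f) := by
  have h : (k : PowerSeries ℂ) = C (k : ℂ) := by simp
  rw [h, coeff_C_mul]

theorem coeff_lagrangeQ_mul_pow (huv : u * v = 1) (p : ℕ) :
    coeff p (lagrangeQ u v * v ^ p) = if p = 0 then 1 else 0 := by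
  split_ifs with hp
  · subst hp; simp [constantCoeff_lagrangeQ]
  · have h : (p : ℂ) * coeff p (lagrangeQ u v * v ^ p) = 0 := by
      rw [natCast_mul_coeff_eq, natCast_mul_lagrangeQ_mul_pow huv, map_sub, coeff_X_mul_derivative,
        ← natCast_mul_coeff_eq, sub_self]
    exact (mul_eq_zero.1 h).resolve_left (by exact_mod_cast hp)

/-- The coefficient is the residue of X^{k-p} d log X, which is 1 for p = k and 0 otherwise. -/
theorem coeff_lagrangeQ_mul_X_mul_pow_mul_pow (huv : u * v = 1) (p k : ℕ) :
    coeff p (lagrangeQ u v * (X * u) ^ k * v ^ p) = if p = k then 1 else 0 := by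
  have h0 : lagrangeQ u v * (X * u) ^ k * v ^ p = X ^ k * (lagrangeQ u v * u ^ k * v ^ p) := by
    ring
  rw [h0, coeff_X_pow_mul']
  split_ifs with h1 h2 h2
  · subst h2
    have : lagrangeQ u v * u ^ p * v ^ p = lagrangeQ u v := by
      rw [mul_assoc, ← mul_pow, huv, one_pow, mul_one]
    rw [this, Nat.sub_self]; simp [constantCoeff_lagrangeQ]
  · obtain ⟨q, rfl⟩ := Nat.exists_eq_add_of_le h1
    have : lagrangeQ u v * u ^ k * v ^ (k + q) = lagrangeQ u v * v ^ q := by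
      rw [pow_add, mul_assoc, ← mul_assoc (u ^ k), ← mul_pow, huv, one_pow, one_mul]
    rw [this, Nat.add_sub_cancel_left, coeff_lagrangeQ_mul_pow huv, if_neg (by omega)]
  · omega
  · rfl

/-- Lagrange inversion: the expansion of `H` in powers of `X = z u`. -/
theorem lagrange_inversion (huv : u * v = 1) (H : PowerSeries ℂ) {i M : ℕ} (hi : i < M) :
    ∑ k ∈ Finset.range M, coeff i ((X * u) ^ k) * coeff k (lagrangeQ u v * H * v ^ k) =
      coeff i H := by
  -- All the coefficient functionals below M vanish on this remainder. The p-th one sees the lowest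
  -- term z^p with the nonzero factor v(0)^p, so the remainder is divisible by z^M by induction.
  set R := H - ∑ k ∈ Finset.range M, C (coeff k (lagrangeQ u v * H * v ^ k)) * (X * u) ^ k with hR
  have hRc : ∀ p < M, coeff p (lagrangeQ u v * R * v ^ p) = 0 := by
    intro p hp
    have h1 : lagrangeQ u v * R * v ^ p = lagrangeQ u v * H * v ^ p -
        ∑ k ∈ Finset.range M, C (coeff k (lagrangeQ u v * H * v ^ k)) *
          (lagrangeQ u v * (X * u) ^ k * v ^ p) := by
      rw [hR, mul_sub, sub_mul, Finset.mul_sum, Finset.sum_mul]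
      congr 1
      exact Finset.sum_congr rfl fun k _ => by ring
    rw [h1, map_sub, map_sum]
    simp only [coeff_C_mul, coeff_lagrangeQ_mul_X_mul_pow_mul_pow huv]
    simp [hp]
  have hR0 : ∀ p ≤ M, X ^ p ∣ R := by
    intro p
    induction p with
    | zero => simp
    | succ p ih =>
      intro hp
      obtain ⟨S, hS⟩ := ih (by omega)
      have h1 := hRc p (by omega)
      have h2 : lagrangeQ u v * R * v ^ p = X ^ p * (lagrangeQ u v * S * v ^ p) := by
        rw [hS]; ring
      rw [h2, coeff_X_pow_mul', if_pos le_rfl, Nat.sub_self, coeff_zero_eq_constantCoeff_apply,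
        map_mul, map_mul, constantCoeff_lagrangeQ, one_mul, map_pow] at h1
      have h3 : constantCoeff v ≠ 0 := by
        intro h
        have := congrArg constantCoeff huv
        simp [h] at this
      have h4 := (mul_eq_zero.1 h1).resolve_right (pow_ne_zero _ h3)
      rw [hS, pow_succ]
      exact mul_dvd_mul_left _ (X_dvd_iff.2 h4)
  have h := X_pow_dvd_iff.1 (hR0 M le_rfl) i hi
  rw [hR, map_sub, map_sum, sub_eq_zero] at h
  rw [h]
  refine Finset.sum_congr rfl fun k _ => ?_
  rw [coeff_C_mul, mul_comm]

theorem X_mul_derivative_X_mul (huv : u * v = 1) :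
    X * derivative ℂ (X * u) = lagrangeQ u v * (X * u) := by
  have h0 := congrArg (derivative ℂ) huv
  have h1 : v * derivative ℂ u = -(u * derivative ℂ v) := by
    rw [Derivation.leibniz, derivative_one, smul_eq_mul, smul_eq_mul] at h0
    linear_combination h0
  have h : derivative ℂ u = -(u * u * derivative ℂ v) := by
    calc derivative ℂ u = u * v * derivative ℂ u := by rw [huv, one_mul]
      _ = _ := by rw [mul_assoc, h1]; ring
  rw [Derivation.leibniz, h, lagrangeQ, derivative_X]
  simp only [smul_eq_mul]
  ring

theorem X_mul_derivative_X_mul_pow (huv : u * v = 1) (k : ℕ) :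
    X * derivative ℂ ((X * u) ^ k) = (k : PowerSeries ℂ) * (lagrangeQ u v * (X * u) ^ k) := by
  rcases k with _ | k
  · simp
  · rw [Derivation.leibniz_pow]
    simp only [Nat.add_sub_cancel, smul_eq_mul, nsmul_eq_mul]
    have h := X_mul_derivative_X_mul huv
    calc X * (((k + 1 : ℕ) : PowerSeries ℂ) * ((X * u) ^ k * derivative ℂ (X * u))) =
        ((k + 1 : ℕ) : PowerSeries ℂ) * ((X * u) ^ k * (X * derivative ℂ (X * u))) := by ring
      _ = _ := by rw [h]; ring

/-- Integration by parts: the two series differ by (k - z d/dz)(f v^k), which has no term z^k. -/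
theorem coeff_lagrangeQ_mul_mul_pow (huv : u * v = 1) (f : PowerSeries ℂ) (k : ℕ) :
    (k : ℂ) * coeff k (lagrangeQ u v * f * v ^ k) = coeff k (X * (derivative ℂ f * v ^ k)) := by
  have h1 := natCast_mul_lagrangeQ_mul_pow huv k
  have h2 : (k : PowerSeries ℂ) * (lagrangeQ u v * f * v ^ k) =
      (k : PowerSeries ℂ) * (f * v ^ k) - X * derivative ℂ (f * v ^ k) + X * (derivative ℂ f * v ^ k) := by
    rw [Derivation.leibniz, smul_eq_mul, smul_eq_mul]
    linear_combination f * h1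
  rw [natCast_mul_coeff_eq, h2, map_add, map_sub, coeff_X_mul_derivative, natCast_mul_coeff_eq,
    sub_self, zero_add]

end Lagrange

/-! ### The one-point function. -/

section OnePoint

open PowerSeries

theorem coeff_subst_X {n : ℕ} (f : PowerSeries ℂ) (i : Fin n) (e : Fin n →₀ ℕ) :
    MvPowerSeries.coeff e (f.subst (MvPowerSeries.X i : MvPowerSeries (Fin n) ℂ)) =
      if e = Finsupp.single i (e i) then coeff (e i) f else 0 := by
  rw [coeff_subst (HasSubst.X i), finsum_eq_single _ (e i)]
  · rw [MvPowerSeries.coeff_X_pow, smul_eq_mul, mul_ite, mul_one, mul_zero]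
  · intro d hd
    rw [MvPowerSeries.coeff_X_pow, if_neg, smul_zero]
    rintro h
    exact hd (by rw [h]; simp)

theorem constantCoeff_subst_X {n : ℕ} {f : PowerSeries ℂ} (hf : constantCoeff f = 0) (i : Fin n) :
    MvPowerSeries.constantCoeff (f.subst (MvPowerSeries.X i : MvPowerSeries (Fin n) ℂ)) = 0 := by
  rw [← MvPowerSeries.coeff_zero_eq_constantCoeff_apply, coeff_subst_X]
  simpa using hf

/-- `finSuccEquiv` makes z_1 the outer variable: a series in z_1 acquires constant coefficients, and
a series in z_2 becomes a constant. -/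
theorem finSuccEquiv_subst_X_zero (f : PowerSeries ℂ) :
    MvPowerSeries.finSuccEquiv ℂ 1 (f.subst (MvPowerSeries.X 0 : MvPowerSeries (Fin 2) ℂ)) =
      PowerSeries.map MvPowerSeries.C f := by
  ext k x
  rw [MvPowerSeries.coeff_coeff_finSuccEquiv, coeff_subst_X, coeff_map, MvPowerSeries.coeff_C,
    Finsupp.cons_zero]
  exact if_congr (Finsupp.cons_eq_single_zero_iff.trans (by simp)) rfl rfl

theorem finSuccEquiv_subst_X_one (f : PowerSeries ℂ) :
    MvPowerSeries.finSuccEquiv ℂ 1 (f.subst (MvPowerSeries.X 1 : MvPowerSeries (Fin 2) ℂ)) =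
      PowerSeries.C (f.subst (MvPowerSeries.X 0 : MvPowerSeries (Fin 1) ℂ)) := by
  ext k x
  have h1 : (x.cons k : Fin 2 →₀ ℕ) 1 = x 0 := Finsupp.cons_succ 0 k x
  have h2 : x.cons k = Finsupp.single (1 : Fin 2) (x 0) ↔
      x = Finsupp.single 0 (x 0) ∧ k = 0 := Finsupp.cons_eq_single_succ_iff 0
  rw [MvPowerSeries.coeff_coeff_finSuccEquiv, coeff_subst_X, coeff_C, h1]
  by_cases hk : k = 0
  · rw [if_pos hk, coeff_subst_X]
    exact if_congr (h2.trans (by simp [hk])) rfl rfl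
  · rw [if_neg hk, if_neg]
    · simp
    · rw [h2]; tauto

theorem coeff_subst_X_mul_subst_X (f g : PowerSeries ℂ) (e : Fin 2 →₀ ℕ) :
    MvPowerSeries.coeff e (f.subst (MvPowerSeries.X 0 : MvPowerSeries (Fin 2) ℂ) *
      g.subst (MvPowerSeries.X 1 : MvPowerSeries (Fin 2) ℂ)) = coeff (e 0) f * coeff (e 1) g := by
  conv_lhs => rw [← Finsupp.cons_tail e]
  rw [← MvPowerSeries.coeff_coeff_finSuccEquiv, map_mul, finSuccEquiv_subst_X_zero,
    finSuccEquiv_subst_X_one, coeff_mul_C, coeff_map, MvPowerSeries.coeff_C_mul, coeff_subst_X]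
  rw [if_pos]
  · rfl
  · exact (Finsupp.unique_ext (by simp))

theorem coeff_subst_of_even {f g : PowerSeries ℂ} (hf : ∀ n, Odd n → coeff n f = 0)
    (hg : ∀ n, Even n → coeff n g = 0) (N : ℕ) (hN : Odd N) : coeff N (f.subst g) = 0 := by
  have hg0 : constantCoeff g = 0 := by
    rw [← coeff_zero_eq_constantCoeff_apply]; exact hg 0 (by simp)
  rw [coeff_subst_eq_sum f hg0 (Nat.lt_succ_self N)]
  refine Finset.sum_eq_zero fun n _ => ?_
  rcases Nat.even_or_odd n with h | h
  · rw [coeff_eq_zero_of_rescale (f := g ^ n) (p := n), mul_zero]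
    · rw [map_pow, rescale_of_odd hg, neg_pow]
    · exact h.add_odd hN
  · rw [hf n h, zero_mul]

variable (psi y : ℕ → PowerSeries ℂ)

/-- The series `z / X(z) = e^{2 ψ(y(z))}`. -/
def vSer : PowerSeries ℂ := (expSeries (2 * psi 0)).subst (y 0)

/-- The series `X(z) / z = e^{-2 ψ(y(z))}`. -/
def uSer : PowerSeries ℂ := expSeries (-2 * (psi 0).subst (y 0))

theorem Xser_eq : Xser psi y = X * uSer psi y := rfl

variable {psi y}

theorem hasSubst_of_forall_even {f : PowerSeries ℂ} (hf : ∀ n, Even n → coeff n f = 0) :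
    HasSubst f :=
  HasSubst.of_constantCoeff_zero' (by
    rw [← coeff_zero_eq_constantCoeff_apply]; exact hf 0 (by simp))

theorem uSer_mul_vSer (hy : ∀ d n, Even n → coeff n (y d) = 0) : uSer psi y * vSer psi y = 1 := by
  have hy0 : constantCoeff (y 0) = 0 := by
    rw [← coeff_zero_eq_constantCoeff_apply]; exact hy 0 0 (by simp)
  have h2 : (2 * psi 0).subst (y 0) = 2 * (psi 0).subst (y 0) := by
    rw [two_mul, two_mul, subst_add (hasSubst_of_forall_even (hy 0))]
  rw [uSer, vSer, expSeries_subst _ hy0, h2, mul_comm, neg_mul, expSeries_mul_neg]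

theorem subst_expSeries_pow (hy : ∀ d n, Even n → coeff n (y d) = 0) (k : ℕ) :
    (expSeries (2 * psi 0) ^ k).subst (y 0) = vSer psi y ^ k :=
  subst_pow (hasSubst_of_forall_even (hy 0)) _ _

theorem coeff_vSer_pow_eq_zero (hpsi : ∀ d n, Odd n → coeff n (psi d) = 0)
    (hy : ∀ d n, Even n → coeff n (y d) = 0) (k N : ℕ) (hN : Odd N) :
    coeff N (vSer psi y ^ k) = 0 := by
  rw [← subst_expSeries_pow hy]
  refine coeff_subst_of_even (fun n hn => ?_) (hy 0) N hN
  refine coeff_eq_zero_of_rescale (p := 0) ?_ (by simpa using hn)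
  rw [rescale_expSeries_two_mul_pow (hpsi 0)]; simp

theorem coeff_Xser_pow_eq_zero (hpsi : ∀ d n, Odd n → coeff n (psi d) = 0)
    (hy : ∀ d n, Even n → coeff n (y d) = 0) {j n : ℕ} (h : Odd (j + n)) :
    coeff n (Xser psi y ^ j) = 0 := by
  refine coeff_eq_zero_of_rescale (p := j) ?_ h
  rw [map_pow, Xser, map_mul, rescale_expSeries, map_mul,
    rescale_of_even (coeff_subst_of_even (hpsi 0) (hy 0)), rescale_X, map_neg, map_neg, map_ofNat,
    ← mul_pow]
  simp

theorem constantCoeff_Xser : constantCoeff (Xser psi y) = 0 := by simp [Xser]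

theorem hasSubst_Xser_subst_X (n : ℕ) :
    MvPowerSeries.HasSubst fun i => (Xser psi y).subst (MvPowerSeries.X i : MvPowerSeries (Fin n) ℂ) :=
  MvPowerSeries.hasSubst_of_constantCoeff_zero fun i => constantCoeff_subst_X constantCoeff_Xser i

theorem exists_derivative_eq (E : PowerSeries ℂ) :
    ∃ F : PowerSeries ℂ, derivative ℂ F = E ∧ constantCoeff F = 0 := by
  refine ⟨PowerSeries.mk fun n => coeff (n - 1) E / n, ?_, by simp⟩
  ext n
  have : (n : ℂ) + 1 ≠ 0 := by exact_mod_cast Nat.succ_ne_zero n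
  simp [coeff_derivative, this]

/-- From (F(y))' = y' v^k one gets k [z^k] F(y) = [z^k] z y' v^k = k [z^k] Q y v^k. For even k the
series z y' v^k is odd, so the formula holds there as well, with value 0. -/
theorem coeff_W_one_eq (hpsi : ∀ d n, Odd n → coeff n (psi d) = 0)
    (hy : ∀ d n, Even n → coeff n (y d) = 0) (m : Fin 1 →₀ ℕ) :
    MvPowerSeries.coeff m (W psi y 0 1) =
      1 / 2 * coeff (m 0) (lagrangeQ (uSer psi y) (vSer psi y) * y 0 * vSer psi y ^ m 0) := by
  have hy0 : constantCoeff (y 0) = 0 := by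
    rw [← coeff_zero_eq_constantCoeff_apply]; exact hy 0 0 (by simp)
  obtain ⟨F, hF, hF0⟩ := exists_derivative_eq (expSeries (2 * psi 0) ^ m 0)
  rw [coeff_W_one hpsi hy m hF hF0]
  rcases Nat.eq_zero_or_pos (m 0) with h0 | h0
  · rw [h0]; simp [hy0]
  have hm : (m 0 : ℂ) ≠ 0 := by exact_mod_cast h0.ne'
  have h1 := coeff_lagrangeQ_mul_mul_pow (uSer_mul_vSer (psi := psi) hy) (y 0) (m 0)
  have h2 : derivative ℂ (F.subst (y 0)) = derivative ℂ (y 0) * vSer psi y ^ m 0 := by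
    rw [derivative_subst (hasSubst_of_forall_even (hy 0)), hF, subst_expSeries_pow hy, mul_comm]
  have h3 : coeff (m 0) (lagrangeQ (uSer psi y) (vSer psi y) * y 0 * vSer psi y ^ m 0) =
      coeff (m 0) (F.subst (y 0)) := by
    rw [← h2, coeff_X_mul_derivative] at h1
    exact mul_left_cancel₀ hm h1
  split_ifs with h
  · rw [h3]
  · have h4 : coeff (m 0) (X * (derivative ℂ (y 0) * vSer psi y ^ m 0)) = 0 := by
      obtain ⟨k, hk⟩ := Nat.exists_eq_add_of_lt h0
      rw [zero_add] at hk
      rw [hk] at h ⊢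
      rw [coeff_succ_X_mul]
      refine coeff_eq_zero_of_rescale (p := 0) ?_ ?_
      · rw [map_mul, rescale_of_even, rescale_of_even (coeff_vSer_pow_eq_zero hpsi hy _), pow_zero,
          one_mul]
        intro n hn
        rw [coeff_derivative, hy 0 _ hn.add_one, zero_mul]
      · simpa [parity_simps] using h
    rw [h4] at h1
    rw [(mul_eq_zero.1 h1).resolve_left hm, mul_zero]

theorem coeff_fin_one (f : PowerSeries ℂ) (e : Fin 1 →₀ ℕ) :
    MvPowerSeries.coeff e (f.subst (MvPowerSeries.X 0 : MvPowerSeries (Fin 1) ℂ)) =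
      coeff (e 0) f := by
  rw [coeff_subst_X, if_pos]
  exact (Finsupp.unique_ext (by simp))

theorem coeff_prod_subst_X_one (f : PowerSeries ℂ) (d e : Fin 1 →₀ ℕ) :
    MvPowerSeries.coeff e
      (d.prod fun s k => (f.subst (MvPowerSeries.X s : MvPowerSeries (Fin 1) ℂ)) ^ k) =
      coeff (e 0) (f ^ d 0) := by
  rw [Finsupp.prod_fintype _ _ fun _ => pow_zero _, Fin.prod_univ_one, ← subst_pow (HasSubst.X _),
    coeff_fin_one]

theorem WofZ_one (hpsi : ∀ d n, Odd n → coeff n (psi d) = 0)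
    (hy : ∀ d n, Even n → coeff n (y d) = 0) :
    WofZ psi y 0 1 =
      (C (1 / 2 : ℂ) * y 0).subst (MvPowerSeries.X 0 : MvPowerSeries (Fin 1) ℂ) := by
  ext e
  rw [WofZ, MvPowerSeries.coeff_subst (hasSubst_Xser_subst_X 1), coeff_fin_one, coeff_C_mul,
    ← lagrange_inversion (uSer_mul_vSer (psi := psi) hy) (y 0) (Nat.lt_succ_self (e 0)),
    ← Xser_eq, Finset.mul_sum]
  rw [finsum_eq_sum_of_support_subset (s := (Finset.range (e 0 + 1)).image (Finsupp.single 0)),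
    Finset.sum_image fun a _ b _ h => Finsupp.single_injective _ h]
  · refine Finset.sum_congr rfl fun k _ => ?_
    rw [coeff_W_one_eq hpsi hy, coeff_prod_subst_X_one, Finsupp.single_eq_same, smul_eq_mul]
    ring
  · intro d hd
    rw [Finset.mem_coe, Finset.mem_image]
    refine ⟨d 0, ?_, ?_⟩
    · by_contra h
      rw [Finset.mem_range, not_lt] at h
      refine hd ?_
      change _ • MvPowerSeries.coeff e _ = 0
      rw [coeff_prod_subst_X_one, coeff_pow_eq_zero constantCoeff_Xser h, smul_zero]
    · exact (Finsupp.unique_ext (by simp))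

end OnePoint

/-! ### The series of n t^n over odd n. -/

section OddSeries

open PowerSeries

variable (R : Type*) [CommRing R]

/-- The series `∑ n t ^ n` over odd `n`. -/
def oddSeries : PowerSeries R := PowerSeries.mk fun n => if Odd n then (n : R) else 0

theorem coeff_oddSeries (n : ℕ) : coeff n (oddSeries R) = if Odd n then (n : R) else 0 :=
  coeff_mk _ _

/-- At t = z/w the rational function t (1 + t²) / (1 - t²)² is ½ B(z, w); this is where B comes
from. -/
theorem one_sub_X_sq_sq_mul_oddSeries :
    (1 - X ^ 2) ^ 2 * oddSeries R = X * (1 + X ^ 2) := by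
  have h : (1 - X ^ 2) ^ 2 * oddSeries R =
      oddSeries R - X ^ 2 * (oddSeries R + oddSeries R) + X ^ 4 * oddSeries R := by ring
  have h' : (X * (1 + X ^ 2) : PowerSeries R) = X ^ 1 + X ^ 3 := by ring
  rw [h, h']
  ext n
  simp only [map_add, map_sub, coeff_X_pow_mul', coeff_oddSeries, coeff_X_pow]
  rcases n with _ | _ | _ | _ | n
  · simp
  · simp
  · simp [parity_simps]
  · norm_num [show Odd 3 by decide]
  · have h1 : n + 1 + 1 + 1 + 1 - 2 = n + 2 := by omega
    have h2 : n + 1 + 1 + 1 + 1 - 4 = n := by omega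
    rw [h1, h2]
    simp only [← Nat.not_even_iff_odd, parity_simps, if_pos (show 2 ≤ n + 1 + 1 + 1 + 1 by omega),
      if_pos (show 4 ≤ n + 1 + 1 + 1 + 1 by omega)]
    by_cases hn : Even n
    · simp [hn]
    · simp [hn]; ring

variable {R}

theorem one_sub_sq_sq_mul_oddSeries_subst {t : PowerSeries R} (ht : constantCoeff t = 0) :
    (1 - t ^ 2) ^ 2 * (oddSeries R).subst t = t * (1 + t ^ 2) := by
  have hs : HasSubst t := HasSubst.of_constantCoeff_zero' ht
  have h := congrArg (substAlgHom (R := R) hs) (one_sub_X_sq_sq_mul_oddSeries R)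
  simpa only [map_mul, map_sub, map_add, map_one, map_pow, substAlgHom_X, coe_substAlgHom] using h

theorem coeff_subst_mul_eq_sum (f : PowerSeries R) {g : PowerSeries R}
    (hg : constantCoeff g = 0) (H : PowerSeries R) {N M : ℕ} (h : N < M) :
    coeff N (f.subst g * H) = ∑ n ∈ Finset.range M, coeff n f * coeff N (g ^ n * H) := by
  have h1 : X ^ M ∣ f.subst g - ∑ n ∈ Finset.range M, C (coeff n f) * g ^ n := by
    rw [X_pow_dvd_iff]
    intro m hm
    rw [map_sub, coeff_subst_eq_sum f hg hm, map_sum, sub_eq_zero]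
    simp only [coeff_C_mul]
  have h2 := X_pow_dvd_iff.1 (h1.mul_right H) N h
  rw [sub_mul, map_sub, sub_eq_zero, Finset.sum_mul, map_sum] at h2
  simpa only [mul_assoc, coeff_C_mul] using h2

theorem sum_coeff_mul_coeff_X_pow_mul (f H : PowerSeries R) (k : ℕ) :
    ∑ n ∈ Finset.range (k + 1), coeff n f * coeff k (X ^ n * H) = coeff k (f * H) := by
  rw [coeff_mul, Finset.Nat.sum_antidiagonal_eq_sum_range_succ_mk]
  refine Finset.sum_congr rfl fun n hn => ?_
  rw [coeff_X_pow_mul', if_pos (Nat.lt_succ_iff.1 (Finset.mem_range.1 hn))]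

end OddSeries

/-! ### Lagrange inversion in the two variables of the two-point function. -/

section TwoPoint

open PowerSeries

variable {psi y : ℕ → PowerSeries ℂ}

/-- As v is even, a nonzero term requires n, m 0 and m 1 to have equal parity, so restricting to odd
n replaces the oddness condition on both exponents. -/
theorem coeff_W_two_eq (hpsi : ∀ d n, Odd n → coeff n (psi d) = 0)
    (hy : ∀ d n, Even n → coeff n (y d) = 0) (m : Fin 2 →₀ ℕ) {M : ℕ} (hM : m 0 < M) :
    MvPowerSeries.coeff m (W psi y 0 2) =
      ∑ n ∈ Finset.range M, 1 / 2 * coeff n (oddSeries ℂ) *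
        (coeff (m 0) (X ^ n * vSer psi y ^ m 0) * coeff (m 1 + n) (vSer psi y ^ m 1)) := by
  have h1 : ∀ n, coeff n (oddSeries ℂ) *
      (coeff (m 0) (X ^ n * vSer psi y ^ m 0) * coeff (m 1 + n) (vSer psi y ^ m 1)) =
      if Odd (m 0) ∧ Odd (m 1) then
        if n ≤ m 0 then (n : ℂ) * (coeff (m 0 - n) (vSer psi y ^ m 0) *
          coeff (m 1 + n) (vSer psi y ^ m 1)) else 0 else 0 := by
    intro n
    rw [coeff_oddSeries, coeff_X_pow_mul']
    by_cases hn : n ≤ m 0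
    · rw [if_pos hn, if_pos hn]
      by_cases h0 : Odd (m 0 - n)
      · rw [coeff_vSer_pow_eq_zero hpsi hy _ _ h0]; simp
      by_cases h2 : Odd (m 1 + n)
      · rw [coeff_vSer_pow_eq_zero hpsi hy _ _ h2]; simp
      by_cases h3 : Odd n
      · rw [if_pos h3, if_pos]
        rw [Nat.not_odd_iff_even] at h0 h2
        rw [Nat.even_sub hn] at h0
        rw [Nat.even_add] at h2
        simp only [← Nat.not_even_iff_odd] at h3 ⊢
        tauto
      · rw [if_neg h3, if_neg, zero_mul]
        rw [Nat.not_odd_iff_even, Nat.even_sub hn] at h0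
        simp only [← Nat.not_even_iff_odd] at h3 ⊢
        tauto
    · simp [hn]
  rw [coeff_W_two hpsi hy]
  simp only [mul_assoc, h1, subst_expSeries_pow hy]
  split_ifs with h
  · rw [← Finset.sum_subset (Finset.range_subset_range.2 (Nat.succ_le_of_lt hM))]
    · refine Finset.sum_congr rfl fun n hn => ?_
      rw [if_pos (Nat.lt_succ_iff.1 (Finset.mem_range.1 hn))]
      ring
    · intro n _ hn
      rw [if_neg, mul_zero]
      simpa [Nat.lt_succ_iff] using hn
  · simp

theorem coeff_prod_subst_X_two (f : PowerSeries ℂ) (d e : Fin 2 →₀ ℕ) :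
    MvPowerSeries.coeff e
      (d.prod fun s k => (f.subst (MvPowerSeries.X s : MvPowerSeries (Fin 2) ℂ)) ^ k) =
      coeff (e 0) (f ^ d 0) * coeff (e 1) (f ^ d 1) := by
  rw [Finsupp.prod_fintype _ _ fun _ => pow_zero _, Fin.prod_univ_two, ← subst_pow (HasSubst.X _),
    ← subst_pow (HasSubst.X _), coeff_subst_X_mul_subst_X]

theorem finsupp_fin_two_ext {d e : Fin 2 →₀ ℕ} (h0 : d 0 = e 0) (h1 : d 1 = e 1) : d = e :=
  Finsupp.ext (Fin.forall_fin_two.2 ⟨h0, h1⟩)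

/-- The expansion of a double series in powers of `X(z_1)`, `X(z_2)`. -/
theorem coeff_subst_Xser_two (f : MvPowerSeries (Fin 2) ℂ) (e : Fin 2 →₀ ℕ) :
    MvPowerSeries.coeff e (f.subst fun i =>
        (Xser psi y).subst (MvPowerSeries.X i : MvPowerSeries (Fin 2) ℂ)) =
      ∑ a ∈ Finset.range (e 0 + 1), ∑ b ∈ Finset.range (e 1 + 1),
        MvPowerSeries.coeff (Finsupp.equivFunOnFinite.symm ![a, b]) f *
          (coeff (e 0) (Xser psi y ^ a) * coeff (e 1) (Xser psi y ^ b)) := by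
  rw [MvPowerSeries.coeff_subst (hasSubst_Xser_subst_X 2), ← Finset.sum_product'
    (Finset.range (e 0 + 1)) (Finset.range (e 1 + 1)) (fun a b =>
        MvPowerSeries.coeff (Finsupp.equivFunOnFinite.symm ![a, b]) f *
          (coeff (e 0) (Xser psi y ^ a) * coeff (e 1) (Xser psi y ^ b))),
    finsum_eq_sum_of_support_subset (s := (Finset.range (e 0 + 1) ×ˢ Finset.range (e 1 + 1)).image
      fun x => Finsupp.equivFunOnFinite.symm ![x.1, x.2]), Finset.sum_image]
  · refine Finset.sum_congr rfl fun x _ => ?_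
    rw [coeff_prod_subst_X_two, smul_eq_mul]
    rfl
  · rintro ⟨a, b⟩ _ ⟨a', b'⟩ _ h
    have h' := Finsupp.equivFunOnFinite.symm.injective h
    have h0 := congrFun h' 0
    have h1 := congrFun h' 1
    simp only [Matrix.cons_val_zero, Matrix.cons_val_one] at h0 h1
    rw [h0, h1]
  · intro d hd
    have hd' : MvPowerSeries.coeff d f • MvPowerSeries.coeff e (d.prod fun s k =>
      ((Xser psi y).subst (MvPowerSeries.X s : MvPowerSeries (Fin 2) ℂ)) ^ k) ≠ 0 := hd
    rw [coeff_prod_subst_X_two] at hd'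
    rw [Finset.mem_coe, Finset.mem_image]
    refine ⟨(d 0, d 1), ?_, finsupp_fin_two_ext rfl rfl⟩
    rw [Finset.mem_product, Finset.mem_range, Finset.mem_range]
    by_contra h
    rw [not_and_or, not_lt, not_lt] at h
    rcases h with h | h
    · exact hd' (by rw [coeff_pow_eq_zero constantCoeff_Xser h, zero_mul, smul_zero])
    · exact hd' (by rw [coeff_pow_eq_zero constantCoeff_Xser h, mul_zero, smul_zero])

variable (psi y)

/-- The series `Q = z X' / X`. -/
def qSer : PowerSeries ℂ := lagrangeQ (uSer psi y) (vSer psi y)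

/-- The series `∑ [z ^ (b + n)] v ^ b X ^ b`. -/
def tailSer (n : ℕ) : PowerSeries ℂ :=
  (PowerSeries.mk fun b => coeff (b + n) (vSer psi y ^ b)).subst (Xser psi y)

variable {psi y}

theorem qSer_mul_inv : qSer psi y * (qSer psi y)⁻¹ = 1 :=
  PowerSeries.mul_inv_cancel _ (by rw [qSer, constantCoeff_lagrangeQ]; exact one_ne_zero)

/-- The sum over powers of X(z_1) is the Lagrange expansion of z^n / Q; the sum over powers of
X(z_2) is `tailSer`. -/
theorem coeff_WofZ_two (hpsi : ∀ d n, Odd n → coeff n (psi d) = 0)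
    (hy : ∀ d n, Even n → coeff n (y d) = 0) (e : Fin 2 →₀ ℕ) :
    MvPowerSeries.coeff e (WofZ psi y 0 2) =
      ∑ n ∈ Finset.range (e 0 + 1), 1 / 2 * coeff n (oddSeries ℂ) *
        coeff (e 0) (X ^ n * (qSer psi y)⁻¹) * coeff (e 1) (tailSer psi y n) := by
  rw [WofZ, coeff_subst_Xser_two]
  have h1 : ∀ a ∈ Finset.range (e 0 + 1), ∀ b ∈ Finset.range (e 1 + 1),
      MvPowerSeries.coeff (Finsupp.equivFunOnFinite.symm ![a, b]) (W psi y 0 2) =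
      ∑ n ∈ Finset.range (e 0 + 1), 1 / 2 * coeff n (oddSeries ℂ) *
        (coeff a (X ^ n * vSer psi y ^ a) * coeff (b + n) (vSer psi y ^ b)) := fun a ha b _ =>
    coeff_W_two_eq hpsi hy _ (Finset.mem_range.1 ha)
  rw [Finset.sum_congr rfl fun a ha => Finset.sum_congr rfl fun b hb => by
    rw [h1 a ha b hb, Finset.sum_mul]]
  rw [Finset.sum_congr rfl fun a _ => Finset.sum_comm, Finset.sum_comm]
  refine Finset.sum_congr rfl fun n _ => ?_
  rw [tailSer, coeff_subst_eq_sum _ constantCoeff_Xser (Nat.lt_succ_self _),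
    ← lagrange_inversion (uSer_mul_vSer (psi := psi) hy) (X ^ n * (qSer psi y)⁻¹)
      (Nat.lt_succ_self _), ← Xser_eq, mul_assoc, Finset.sum_mul_sum, Finset.mul_sum]
  refine Finset.sum_congr rfl fun a _ => ?_
  rw [Finset.mul_sum]
  refine Finset.sum_congr rfl fun b _ => ?_
  have h2 : lagrangeQ (uSer psi y) (vSer psi y) * (X ^ n * (qSer psi y)⁻¹) * vSer psi y ^ a =
      X ^ n * vSer psi y ^ a := by
    have := qSer_mul_inv (psi := psi) (y := y)
    rw [qSer] at this ⊢
    linear_combination (X ^ n * vSer psi y ^ a) * this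
  rw [h2, coeff_mk]
  ring

/-- This is the Lagrange expansion of z^{-n} / Q, multiplied by X^n to stay within power series: the
first n terms are the principal part in X and the rest is `tailSer`. The summand k = n is 0 because
n ≠ 0, and is kept for symmetry. -/
theorem sum_add_Xser_pow_mul_tailSer (hy : ∀ d n, Even n → coeff n (y d) = 0) {n : ℕ}
    (hn : n ≠ 0) :
    ∑ k ∈ Finset.range (n + 1), C (coeff n (Xser psi y ^ (n - k))) * Xser psi y ^ k +
      tailSer psi y n * Xser psi y ^ n = uSer psi y ^ n * (qSer psi y)⁻¹ := by
  have huv := uSer_mul_vSer (psi := psi) hy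
  have h0 : coeff n (Xser psi y ^ (n - n)) = 0 := by
    rw [Nat.sub_self, pow_zero, coeff_one, if_neg hn]
  rw [Finset.sum_range_succ, h0, map_zero, zero_mul, add_zero]
  ext i
  rw [← lagrange_inversion huv (uSer psi y ^ n * (qSer psi y)⁻¹)
    (show i < n + (i + 1) by omega), Finset.sum_range_add, map_add, map_sum, tailSer,
    coeff_subst_mul_eq_sum _ constantCoeff_Xser _ (Nat.lt_succ_self i), ← Xser_eq]
  have h2 : ∀ k, lagrangeQ (uSer psi y) (vSer psi y) * (uSer psi y ^ n * (qSer psi y)⁻¹) *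
      vSer psi y ^ k = uSer psi y ^ n * vSer psi y ^ k := by
    intro k
    have := qSer_mul_inv (psi := psi) (y := y)
    rw [qSer] at this ⊢
    linear_combination (uSer psi y ^ n * vSer psi y ^ k) * this
  congr 1
  · refine Finset.sum_congr rfl fun k hk => ?_
    have hk' := (Finset.mem_range.1 hk).le
    obtain ⟨q, rfl⟩ := Nat.exists_eq_add_of_le hk'
    have h3 : uSer psi y ^ (k + q) * vSer psi y ^ k = uSer psi y ^ q := by
      rw [pow_add, mul_right_comm, ← mul_pow, huv, one_pow, one_mul]
    rw [coeff_C_mul, h2, h3, Nat.add_sub_cancel_left, Xser_eq, mul_pow (X) (uSer psi y) q,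
      coeff_X_pow_mul', if_pos (by omega), Nat.add_sub_cancel, mul_comm]
  · refine Finset.sum_congr rfl fun b _ => ?_
    have h3 : uSer psi y ^ n * vSer psi y ^ (n + b) = vSer psi y ^ b := by
      rw [pow_add, ← mul_assoc, ← mul_pow, huv, one_pow, one_mul]
    rw [h2, h3, coeff_mk, ← pow_add, mul_comm, add_comm b n]

/-- This is z (X^j)' = j Q X^j divided by Q. Since X^j has the parity of j, keeping odd n is the
same as keeping odd j. -/
theorem sum_oddSeries_mul_coeff (hpsi : ∀ d n, Odd n → coeff n (psi d) = 0)
    (hy : ∀ d n, Even n → coeff n (y d) = 0) (j k : ℕ) :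
    ∑ n ∈ Finset.range (k + 1), coeff n (oddSeries ℂ) * coeff k (X ^ n * (qSer psi y)⁻¹) *
      coeff n (Xser psi y ^ j) = coeff j (oddSeries ℂ) * coeff k (Xser psi y ^ j) := by
  have h1 : ∀ n, coeff n (oddSeries ℂ) * coeff n (Xser psi y ^ j) =
      coeff j (oddSeries ℂ) * coeff n (qSer psi y * Xser psi y ^ j) := by
    intro n
    have h2 := X_mul_derivative_X_mul_pow (uSer_mul_vSer (psi := psi) hy) j
    rw [← Xser_eq] at h2
    have h3 : (n : ℂ) * coeff n (Xser psi y ^ j) = j * coeff n (qSer psi y * Xser psi y ^ j) := by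
      rw [← coeff_X_mul_derivative, h2, natCast_mul_coeff_eq, qSer]
    rw [coeff_oddSeries, coeff_oddSeries]
    by_cases hjn : Odd (j + n)
    · rw [coeff_Xser_pow_eq_zero hpsi hy hjn, mul_zero] at h3 ⊢
      split_ifs
      · exact h3
      · simp
    · rw [Nat.not_odd_iff_even, Nat.even_add] at hjn
      simp only [← Nat.not_even_iff_odd, hjn]
      split_ifs
      · simp
      · exact h3
  have h4 : Xser psi y ^ j = qSer psi y * Xser psi y ^ j * (qSer psi y)⁻¹ := by
    rw [mul_right_comm, qSer_mul_inv, one_mul]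
  conv_rhs => rw [h4]
  rw [← sum_coeff_mul_coeff_X_pow_mul, Finset.mul_sum]
  refine Finset.sum_congr rfl fun n _ => ?_
  rw [mul_right_comm, h1, mul_assoc]

end TwoPoint

/-! ### Expansion in z_1 over a field containing z_2⁻¹. -/

section Expansion

open PowerSeries

variable {psi y : ℕ → PowerSeries ℂ} {L : Type*} [Field L]

/-- In a field where z and X are invertible, the series is z^{-n} / Q minus its principal part in X.
-/
theorem map_tailSer (hy : ∀ d n, Even n → coeff n (y d) = 0) (α : PowerSeries ℂ →+* L)
    (hX : α X ≠ 0) (hu : α (uSer psi y) ≠ 0) {n : ℕ} (hn : n ≠ 0) :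
    α (tailSer psi y n) = (α X)⁻¹ ^ n * α (qSer psi y)⁻¹ -
      ∑ j ∈ Finset.range (n + 1), α (C (coeff n (Xser psi y ^ j))) * (α (Xser psi y))⁻¹ ^ j := by
  have h1 := congrArg α (sum_add_Xser_pow_mul_tailSer (psi := psi) hy hn)
  have hx : α (Xser psi y) = α X * α (uSer psi y) := by rw [Xser_eq, map_mul]
  have hx0 : α (Xser psi y) ≠ 0 := by rw [hx]; exact mul_ne_zero hX hu
  simp only [map_add, map_mul, map_pow, map_sum] at h1
  rw [← Finset.sum_flip fun j => α (C (coeff n (Xser psi y ^ j))) * (α (Xser psi y))⁻¹ ^ j,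
    eq_sub_iff_add_eq]
  refine mul_right_cancel₀ (pow_ne_zero n hx0) ?_
  rw [add_mul, Finset.sum_mul, add_comm]
  have h2 : ∀ k ∈ Finset.range (n + 1), α (C (coeff n (Xser psi y ^ (n - k)))) *
      (α (Xser psi y))⁻¹ ^ (n - k) * α (Xser psi y) ^ n =
      α (C (coeff n (Xser psi y ^ (n - k)))) * α (Xser psi y) ^ k := by
    intro k hk
    obtain ⟨q, rfl⟩ := Nat.exists_eq_add_of_le (Nat.lt_succ_iff.1 (Finset.mem_range.1 hk))
    rw [Nat.add_sub_cancel_left, pow_add, inv_pow]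
    field_simp
  rw [Finset.sum_congr rfl h2, h1, hx, mul_pow, inv_pow]
  field_simp

theorem constantCoeff_C_mul_map_Xser (f : ℂ →+* L) (c : L) :
    constantCoeff (C c * PowerSeries.map f (Xser psi y)) = 0 := by
  rw [map_mul, ← coeff_zero_eq_constantCoeff_apply (PowerSeries.map f _), coeff_map,
    coeff_zero_eq_constantCoeff_apply, constantCoeff_Xser, map_zero, mul_zero]

/-- The expansion of `W_{0,2}` in `z_1`, with coefficients in a field containing `ℂ⟦z_2⟧`. -/
theorem sum_map_tailSer (hpsi : ∀ d n, Odd n → coeff n (psi d) = 0)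
    (hy : ∀ d n, Even n → coeff n (y d) = 0) (α : PowerSeries ℂ →+* L) (hX : α X ≠ 0)
    (hu : α (uSer psi y) ≠ 0) (k : ℕ) :
    2 * ∑ n ∈ Finset.range (k + 1), α (C (1 / 2 * coeff n (oddSeries ℂ) *
        coeff k (X ^ n * (qSer psi y)⁻¹))) * α (tailSer psi y n) =
      coeff k ((oddSeries L).subst (C (α X)⁻¹ * X) * (PowerSeries.map (α.comp C) (qSer psi y)⁻¹ *
          C (α (qSer psi y)⁻¹)) -
        (oddSeries L).subst (C (α (Xser psi y))⁻¹ *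
          PowerSeries.map (α.comp C) (Xser psi y))) := by
  have hG : ∀ n, coeff n (oddSeries L) = α (C (coeff n (oddSeries ℂ))) := by
    intro n
    rw [coeff_oddSeries, coeff_oddSeries]
    split_ifs <;> simp
  have h2 : (2 : L) = α (C 2) := by
    rw [show (C (2 : ℂ) : PowerSeries ℂ) = 2 from map_ofNat C 2, map_ofNat]
  rw [map_sub, coeff_subst_mul_eq_sum _ (by simp) _ (Nat.lt_succ_self k),
    coeff_subst_eq_sum _ (constantCoeff_C_mul_map_Xser _ _) (Nat.lt_succ_self k)]
  have h3 : ∀ n ∈ Finset.range (k + 1), coeff n (oddSeries L) * coeff k ((C (α X)⁻¹ * X) ^ n *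
      (PowerSeries.map (α.comp C) (qSer psi y)⁻¹ * C (α (qSer psi y)⁻¹))) =
      α (C (coeff n (oddSeries ℂ) * coeff k (X ^ n * (qSer psi y)⁻¹))) *
        ((α X)⁻¹ ^ n * α (qSer psi y)⁻¹) := by
    intro n _
    have e : (C (α X)⁻¹ * X) ^ n *
      (PowerSeries.map (α.comp C) (qSer psi y)⁻¹ * C (α (qSer psi y)⁻¹)) =
      C ((α X)⁻¹ ^ n * α (qSer psi y)⁻¹) *
        PowerSeries.map (α.comp C) (X ^ n * (qSer psi y)⁻¹) := by
      simp only [map_mul, map_pow, PowerSeries.map_X]; ring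
    rw [e, coeff_C_mul, coeff_map, hG, RingHom.comp_apply, map_mul C (coeff n (oddSeries ℂ)),
      map_mul α (C _)]
    ring
  have h4 : ∀ j ∈ Finset.range (k + 1), coeff j (oddSeries L) * coeff k ((C (α (Xser psi y))⁻¹ *
      PowerSeries.map (α.comp C) (Xser psi y)) ^ j) =
      ∑ n ∈ Finset.range (k + 1), α (C (coeff n (oddSeries ℂ) *
        coeff k (X ^ n * (qSer psi y)⁻¹))) *
        (α (C (coeff n (Xser psi y ^ j))) * (α (Xser psi y))⁻¹ ^ j) := by
    intro j _
    have e := congrArg (fun c => α (C c)) (sum_oddSeries_mul_coeff hpsi hy j k)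
    simp only [map_sum, map_mul] at e
    rw [mul_pow, ← map_pow C, ← map_pow (PowerSeries.map _), coeff_C_mul, coeff_map, hG]
    simp only [RingHom.comp_apply, map_mul, ← mul_assoc, ← Finset.sum_mul]
    rw [e]
    ring
  rw [Finset.sum_congr rfl h3, Finset.sum_congr rfl h4, Finset.sum_comm, ← Finset.sum_sub_distrib,
    Finset.mul_sum]
  refine Finset.sum_congr rfl fun n hn => ?_
  rw [← Finset.mul_sum, ← mul_sub]
  -- Even n carry weight 0. For odd n the sum over j stops at n, because X^j starts at z^j, and n ≠
  -- 0 allows `map_tailSer`.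
  by_cases hodd : Odd n
  · have e : ∑ j ∈ Finset.range (k + 1), α (C (coeff n (Xser psi y ^ j))) *
        (α (Xser psi y))⁻¹ ^ j = ∑ j ∈ Finset.range (n + 1), α (C (coeff n (Xser psi y ^ j))) *
        (α (Xser psi y))⁻¹ ^ j := by
      refine (Finset.sum_subset (Finset.range_subset_range.2 ?_) fun j _ hj => ?_).symm
      · exact Nat.succ_le_of_lt (Finset.mem_range.1 hn)
      · rw [Finset.mem_range, not_lt] at hj
        rw [coeff_pow_eq_zero constantCoeff_Xser hj]; simp
    rw [e, ← map_tailSer hy α hX hu hodd.pos.ne', ← mul_assoc, h2, ← map_mul α (C 2),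
      ← map_mul C]
    congr 3
    ring
  · rw [coeff_oddSeries, if_neg hodd]; simp

end Expansion

/-! ### The identities in the fraction field. -/

section Fractions

open PowerSeries

instance charZero_frac (n : ℕ) : CharZero (Frac n) :=
  charZero_of_injective_ringHom
    ((algebraMap (MvPowerSeries (Fin n) ℂ) (Frac n)).comp MvPowerSeries.C).injective

/-- The substitution `z ↦ z_i` as a ring homomorphism into the field of fractions. -/
def atZHom {n : ℕ} (i : Fin n) : PowerSeries ℂ →+* Frac n :=
  (algebraMap (MvPowerSeries (Fin n) ℂ) (Frac n)).comp
    (substAlgHom (R := ℂ) (HasSubst.X (S := ℂ) i)).toRingHom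

theorem atZHom_apply {n : ℕ} (i : Fin n) (f : PowerSeries ℂ) : atZHom i f = atZ f i := by
  simp [atZHom, atZ, coe_substAlgHom]

theorem subst_X_ne_zero {n : ℕ} (i : Fin n) {f : PowerSeries ℂ} (hf : f ≠ 0) :
    f.subst (MvPowerSeries.X i : MvPowerSeries (Fin n) ℂ) ≠ 0 := by
  intro h
  refine hf (PowerSeries.ext fun k => ?_)
  have := coeff_subst_X f i (Finsupp.single i k)
  rw [h] at this
  simpa using this.symm

theorem atZHom_ne_zero {n : ℕ} (i : Fin n) {f : PowerSeries ℂ} (hf : f ≠ 0) : atZHom i f ≠ 0 := by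
  rw [atZHom_apply, atZ, Ne, IsFractionRing.to_map_eq_zero_iff]
  exact subst_X_ne_zero i hf

/-- The monomial z_1² tells the two apart. It is applied to z² and X², whose differences are the
denominators of the two functions B. -/
theorem atZHom_zero_ne_atZHom_one {f : PowerSeries ℂ} (hf : coeff 2 f ≠ 0) :
    (atZHom 0 f : Frac 2) ≠ atZHom 1 f := by
  rw [atZHom_apply, atZHom_apply, atZ, atZ]
  intro h
  have h1 := congrArg (MvPowerSeries.coeff (Finsupp.single (0 : Fin 2) 2))
    (IsFractionRing.injective _ (Frac 2) h)
  rw [coeff_subst_X, coeff_subst_X, if_pos (by simp), if_neg] at h1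
  · exact hf (by simpa using h1)
  · intro h2
    simpa using congrArg (fun e => e 0) h2

/-- The embedding of `ℂ⟦z_1, z_2⟧` into the power series in `z_1` over the fractions in `z_2`. -/
def expandFirst : MvPowerSeries (Fin 2) ℂ →+* PowerSeries (Frac 1) :=
  (PowerSeries.map (algebraMap (MvPowerSeries (Fin 1) ℂ) (Frac 1))).comp
    (MvPowerSeries.finSuccEquiv ℂ 1).toRingEquiv.toRingHom

theorem expandFirst_apply (f : MvPowerSeries (Fin 2) ℂ) : expandFirst f =
    PowerSeries.map (algebraMap (MvPowerSeries (Fin 1) ℂ) (Frac 1))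
      (MvPowerSeries.finSuccEquiv ℂ 1 f) := rfl

theorem expandFirst_injective : Function.Injective expandFirst := by
  intro f g h
  rw [expandFirst_apply, expandFirst_apply] at h
  exact (MvPowerSeries.finSuccEquiv ℂ 1).injective
    (PowerSeries.map_injective _ (IsFractionRing.injective _ _) h)

theorem atZHom_C {n : ℕ} (i : Fin n) (c : ℂ) :
    atZHom i (C c) = algebraMap (MvPowerSeries (Fin n) ℂ) (Frac n) (MvPowerSeries.C c) := by
  rw [atZHom_apply, atZ, PowerSeries.subst_C]

theorem expandFirst_subst_X_zero (f : PowerSeries ℂ) :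
    expandFirst (f.subst (MvPowerSeries.X 0 : MvPowerSeries (Fin 2) ℂ)) =
      PowerSeries.map ((atZHom 0).comp C) f := by
  rw [expandFirst_apply, finSuccEquiv_subst_X_zero]
  ext k
  simp only [coeff_map, RingHom.comp_apply, atZHom_C]

theorem expandFirst_subst_X_one (f : PowerSeries ℂ) :
    expandFirst (f.subst (MvPowerSeries.X 1 : MvPowerSeries (Fin 2) ℂ)) =
      C (atZHom 0 f) := by
  rw [expandFirst_apply, finSuccEquiv_subst_X_one, PowerSeries.map_C, atZHom_apply, atZ]

variable {psi y : ℕ → PowerSeries ℂ}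

theorem coeff_finSuccEquiv_WofZ (hpsi : ∀ d n, Odd n → coeff n (psi d) = 0)
    (hy : ∀ d n, Even n → coeff n (y d) = 0) (k : ℕ) :
    coeff k (MvPowerSeries.finSuccEquiv ℂ 1 (WofZ psi y 0 2)) =
      ∑ n ∈ Finset.range (k + 1), MvPowerSeries.C (1 / 2 * coeff n (oddSeries ℂ) *
        coeff k (X ^ n * (qSer psi y)⁻¹)) *
          (tailSer psi y n).subst (MvPowerSeries.X 0 : MvPowerSeries (Fin 1) ℂ) := by
  ext x
  rw [MvPowerSeries.coeff_coeff_finSuccEquiv, coeff_WofZ_two hpsi hy, map_sum]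
  simp only [MvPowerSeries.coeff_C_mul, coeff_fin_one]
  rfl

theorem two_mul_expandFirst_WofZ (hpsi : ∀ d n, Odd n → coeff n (psi d) = 0)
    (hy : ∀ d n, Even n → coeff n (y d) = 0) :
    2 * expandFirst (WofZ psi y 0 2) =
      (oddSeries (Frac 1)).subst (C (atZHom 0 X)⁻¹ * X : PowerSeries (Frac 1)) *
        (PowerSeries.map ((atZHom 0).comp C) (qSer psi y)⁻¹ * C (atZHom 0 (qSer psi y)⁻¹)) -
      (oddSeries (Frac 1)).subst (C (atZHom 0 (Xser psi y))⁻¹ *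
          PowerSeries.map ((atZHom 0).comp C) (Xser psi y)) := by
  ext k
  have hu : uSer psi y ≠ 0 := left_ne_zero_of_mul_eq_one (uSer_mul_vSer hy)
  rw [← sum_map_tailSer hpsi hy (atZHom 0) (atZHom_ne_zero 0 X_ne_zero) (atZHom_ne_zero 0 hu) k]
  have h2 : (2 : PowerSeries (Frac 1)) = C 2 := (map_ofNat C 2).symm
  rw [h2, coeff_C_mul, expandFirst_apply, coeff_map, coeff_finSuccEquiv_WofZ hpsi hy, map_sum]
  simp only [map_mul (algebraMap (MvPowerSeries (Fin 1) ℂ) (Frac 1)), ← atZHom_C (0 : Fin 1),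
    atZHom_apply]
  rfl

/-- The formula for `W_{0,2}` with denominators cleared. -/
theorem four_mul_WofZ_two (hpsi : ∀ d n, Odd n → coeff n (psi d) = 0)
    (hy : ∀ d n, Even n → coeff n (y d) = 0) (z w x t q r : MvPowerSeries (Fin 2) ℂ)
    (hz : z = (X : PowerSeries ℂ).subst (MvPowerSeries.X 0 : MvPowerSeries (Fin 2) ℂ))
    (hw : w = (X : PowerSeries ℂ).subst (MvPowerSeries.X 1 : MvPowerSeries (Fin 2) ℂ))
    (hx : x = (Xser psi y).subst (MvPowerSeries.X 0 : MvPowerSeries (Fin 2) ℂ))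
    (ht : t = (Xser psi y).subst (MvPowerSeries.X 1 : MvPowerSeries (Fin 2) ℂ))
    (hq : q = (qSer psi y).subst (MvPowerSeries.X 0 : MvPowerSeries (Fin 2) ℂ))
    (hr : r = (qSer psi y).subst (MvPowerSeries.X 1 : MvPowerSeries (Fin 2) ℂ)) :
    2 * WofZ psi y 0 2 * (q * r) * ((w ^ 2 - z ^ 2) ^ 2 * (t ^ 2 - x ^ 2) ^ 2) =
      z * w * (w ^ 2 + z ^ 2) * (t ^ 2 - x ^ 2) ^ 2 -
        q * r * (x * t * (t ^ 2 + x ^ 2)) * (w ^ 2 - z ^ 2) ^ 2 := by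
  apply expandFirst_injective
  have hU := two_mul_expandFirst_WofZ hpsi hy
  have hq' : PowerSeries.map ((atZHom (0 : Fin 1)).comp C) (qSer psi y) *
      PowerSeries.map ((atZHom (0 : Fin 1)).comp C) (qSer psi y)⁻¹ = 1 := by
    rw [← map_mul, qSer_mul_inv, map_one]
  have hr' : C (atZHom (0 : Fin 1) (qSer psi y)) * C (atZHom (0 : Fin 1) (qSer psi y)⁻¹) = 1 := by
    rw [← map_mul, ← map_mul, qSer_mul_inv, map_one, map_one]
  have hu : uSer psi y ≠ 0 := left_ne_zero_of_mul_eq_one (uSer_mul_vSer hy)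
  have hX : C (atZHom (0 : Fin 1) X) * C (atZHom (0 : Fin 1) X)⁻¹ = 1 := by
    rw [← map_mul, mul_inv_cancel₀ (atZHom_ne_zero 0 X_ne_zero), map_one]
  have hxs : Xser psi y ≠ 0 := mul_ne_zero X_ne_zero hu
  have hT : C (atZHom (0 : Fin 1) (Xser psi y)) * C (atZHom (0 : Fin 1) (Xser psi y))⁻¹ = 1 := by
    rw [← map_mul, mul_inv_cancel₀ (atZHom_ne_zero 0 hxs), map_one]
  have hG := one_sub_sq_sq_mul_oddSeries_subst
    (t := (C (atZHom (0 : Fin 1) X)⁻¹ * X : PowerSeries (Frac 1))) (by simp)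
  have hH := one_sub_sq_sq_mul_oddSeries_subst
    (t := C (atZHom (0 : Fin 1) (Xser psi y))⁻¹ *
      PowerSeries.map ((atZHom (0 : Fin 1)).comp C) (Xser psi y)) (constantCoeff_C_mul_map_Xser _ _)
  simp only [map_mul expandFirst, map_sub expandFirst, map_add expandFirst, map_pow expandFirst,
    map_ofNat expandFirst]
  rw [hz, hw, hx, ht, hq, hr]
  simp only [expandFirst_subst_X_zero, expandFirst_subst_X_one, PowerSeries.map_X]
  rw [hU]
  generalize (oddSeries (Frac 1)).subst (C (atZHom (0 : Fin 1) X)⁻¹ * X : PowerSeries (Frac 1)) = G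
    at hG ⊢
  generalize (oddSeries (Frac 1)).subst (C (atZHom (0 : Fin 1) (Xser psi y))⁻¹ *
      PowerSeries.map ((atZHom (0 : Fin 1)).comp C) (Xser psi y)) = H at hH ⊢
  generalize PowerSeries.map ((atZHom (0 : Fin 1)).comp C) (qSer psi y) = a at hq' ⊢
  generalize PowerSeries.map ((atZHom (0 : Fin 1)).comp C) (qSer psi y)⁻¹ = a' at hq' ⊢
  generalize C (atZHom (0 : Fin 1) (qSer psi y)) = b at hr' ⊢
  generalize C (atZHom (0 : Fin 1) (qSer psi y)⁻¹) = b' at hr' ⊢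
  generalize PowerSeries.map ((atZHom (0 : Fin 1)).comp C) (Xser psi y) = x at hH ⊢
  generalize C (atZHom (0 : Fin 1) (Xser psi y)) = t at hT ⊢
  generalize C (atZHom (0 : Fin 1) (Xser psi y))⁻¹ = t' at hT hH ⊢
  generalize C (atZHom (0 : Fin 1) X) = w at hX ⊢
  generalize C (atZHom (0 : Fin 1) X)⁻¹ = w' at hX hG ⊢
  generalize (X : PowerSeries (Frac 1)) = z at hG ⊢
  -- As w' inverts w, the closed form of the series at w' z becomes polynomial after multiplication
  -- by w^4.
  have e1 : (w ^ 2 - z ^ 2) ^ 2 * G = z * w * (w ^ 2 + z ^ 2) := by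
    have f1 : w ^ 2 - z ^ 2 = w ^ 2 * (1 - (w' * z) ^ 2) := by
      linear_combination (z ^ 2 * (w * w' + 1)) * hX
    have f2 : w ^ 2 + z ^ 2 = w ^ 2 * (1 + (w' * z) ^ 2) := by
      linear_combination (-z ^ 2 * (w * w' + 1)) * hX
    have f3 : z = w * (w' * z) := by linear_combination (-z) * hX
    calc (w ^ 2 - z ^ 2) ^ 2 * G = w ^ 4 * ((1 - (w' * z) ^ 2) ^ 2 * G) := by rw [f1]; ring
      _ = w * (w * (w' * z)) * (w ^ 2 * (1 + (w' * z) ^ 2)) := by rw [hG]; ring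
      _ = _ := by rw [← f2, ← f3]; ring
  have e2 : (t ^ 2 - x ^ 2) ^ 2 * H = x * t * (t ^ 2 + x ^ 2) := by
    have f1 : t ^ 2 - x ^ 2 = t ^ 2 * (1 - (t' * x) ^ 2) := by
      linear_combination (x ^ 2 * (t * t' + 1)) * hT
    have f2 : t ^ 2 + x ^ 2 = t ^ 2 * (1 + (t' * x) ^ 2) := by
      linear_combination (-x ^ 2 * (t * t' + 1)) * hT
    have f3 : x = t * (t' * x) := by linear_combination (-x) * hT
    calc (t ^ 2 - x ^ 2) ^ 2 * H = t ^ 4 * ((1 - (t' * x) ^ 2) ^ 2 * H) := by rw [f1]; ring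
      _ = t * (t * (t' * x)) * (t ^ 2 * (1 + (t' * x) ^ 2)) := by rw [hH]; ring
      _ = _ := by rw [← f2, ← f3]; ring
  calc (G * (a' * b') - H) * (a * b) * ((w ^ 2 - z ^ 2) ^ 2 * (t ^ 2 - x ^ 2) ^ 2) =
      ((w ^ 2 - z ^ 2) ^ 2 * G) * ((a * a') * (b * b')) * (t ^ 2 - x ^ 2) ^ 2 -
        a * b * ((t ^ 2 - x ^ 2) ^ 2 * H) * (w ^ 2 - z ^ 2) ^ 2 := by ring
    _ = _ := by rw [e1, e2, hq', hr']; ring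

theorem Q_eq (hy : ∀ d n, Even n → coeff n (y d) = 0) {n : ℕ} (i : Fin n) :
    Q psi y i = atZHom i (qSer psi y) := by
  have hu : uSer psi y ≠ 0 := left_ne_zero_of_mul_eq_one (uSer_mul_vSer hy)
  have hx0 : atZHom i (Xser psi y) ≠ 0 := atZHom_ne_zero i (mul_ne_zero X_ne_zero hu)
  have h := congrArg (atZHom i) (X_mul_derivative_X_mul (uSer_mul_vSer (psi := psi) hy))
  rw [← Xser_eq, map_mul (atZHom i), map_mul (atZHom i)] at h
  rw [Q, zVar, dlogX, XVar, ← atZHom_apply, ← atZHom_apply, ← atZHom_apply, ← mul_div_assoc, h,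
    mul_div_cancel_right₀ _ hx0, qSer]

theorem algebraMap_WofZ_two (hpsi : ∀ d n, Odd n → coeff n (psi d) = 0)
    (hy : ∀ d n, Even n → coeff n (y d) = 0) :
    algebraMap (MvPowerSeries (Fin 2) ℂ) (Frac 2) (WofZ psi y 0 2) =
      1 / (4 * Q psi y 0 * Q psi y 1) * B (zVar 0) (zVar 1) -
        1 / 4 * B (XVar psi y 0) (XVar psi y 1) := by
  have hu : uSer psi y ≠ 0 := left_ne_zero_of_mul_eq_one (uSer_mul_vSer hy)
  have hq : qSer psi y ≠ 0 := left_ne_zero_of_mul_eq_one qSer_mul_inv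
  have hq0 := atZHom_ne_zero (0 : Fin 2) hq
  have hq1 := atZHom_ne_zero (1 : Fin 2) hq
  have hz : (atZHom 0 X : Frac 2) ^ 2 ≠ atZHom 1 X ^ 2 := by
    rw [← map_pow, ← map_pow]
    exact atZHom_zero_ne_atZHom_one (by simp)
  have hx : (atZHom 0 (Xser psi y) : Frac 2) ^ 2 ≠ atZHom 1 (Xser psi y) ^ 2 := by
    rw [← map_pow, ← map_pow]
    refine atZHom_zero_ne_atZHom_one ?_
    have h0 := congrArg constantCoeff (uSer_mul_vSer (psi := psi) hy)
    rw [Xser_eq, mul_pow, coeff_X_pow_mul', if_pos le_rfl, Nat.sub_self,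
      coeff_zero_eq_constantCoeff_apply, map_pow]
    rw [map_mul, map_one] at h0
    exact pow_ne_zero 2 (left_ne_zero_of_mul_eq_one h0)
  have h := congrArg (algebraMap (MvPowerSeries (Fin 2) ℂ) (Frac 2))
    (four_mul_WofZ_two hpsi hy _ _ _ _ _ _ rfl rfl rfl rfl rfl rfl)
  simp only [map_mul (algebraMap (MvPowerSeries (Fin 2) ℂ) (Frac 2)),
    map_sub (algebraMap (MvPowerSeries (Fin 2) ℂ) (Frac 2)),
    map_add (algebraMap (MvPowerSeries (Fin 2) ℂ) (Frac 2)),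
    map_pow (algebraMap (MvPowerSeries (Fin 2) ℂ) (Frac 2)),
    map_ofNat (algebraMap (MvPowerSeries (Fin 2) ℂ) (Frac 2))] at h
  simp only [← atZ.eq_def, ← atZHom_apply] at h
  rw [Q_eq hy, Q_eq hy, zVar, zVar, XVar, XVar, ← atZHom_apply, ← atZHom_apply, ← atZHom_apply,
    ← atZHom_apply]
  generalize algebraMap (MvPowerSeries (Fin 2) ℂ) (Frac 2) (WofZ psi y 0 2) = U at h ⊢
  generalize (atZHom 0 (qSer psi y) : Frac 2) = q at *
  generalize (atZHom 1 (qSer psi y) : Frac 2) = r at *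
  generalize (atZHom 0 (Xser psi y) : Frac 2) = x at *
  generalize (atZHom 1 (Xser psi y) : Frac 2) = t at *
  generalize (atZHom 0 X : Frac 2) = z at *
  generalize (atZHom 1 X : Frac 2) = w at *
  have hz1 : z - w ≠ 0 := fun h => hz (by rw [sub_eq_zero.1 h])
  have hz2 : z + w ≠ 0 := fun h => hz (by rw [eq_neg_of_add_eq_zero_left h, neg_sq])
  have hx1 : x - t ≠ 0 := fun h => hx (by rw [sub_eq_zero.1 h])
  have hx2 : x + t ≠ 0 := fun h => hx (by rw [eq_neg_of_add_eq_zero_left h, neg_sq])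
  rw [B, B]
  field_simp
  linear_combination 2 * h

theorem dlogX_eq {n : ℕ} (i : Fin n) :
    dlogX psi y i = Q psi y i / zVar i := by
  rw [Q, mul_div_cancel_left₀]
  rw [zVar, ← atZHom_apply]
  exact atZHom_ne_zero i X_ne_zero

/-- Doubling -¼ B(X_1, X_2) cancels the shift, and d log X_i = Q_i dz_i / z_i removes the factors
Q_i and the numerators z_1 z_2 of B(z_1, z_2). -/
theorem omega_two (hpsi : ∀ d n, Odd n → coeff n (psi d) = 0)
    (hy : ∀ d n, Even n → coeff n (y d) = 0) :
    omega psi y 0 2 =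
      1 / 2 * (1 / (zVar 0 - zVar 1) ^ 2 + 1 / (zVar 0 + zVar 1) ^ 2) := by
  have hq : qSer psi y ≠ 0 := left_ne_zero_of_mul_eq_one qSer_mul_inv
  have hq0 : Q psi y (0 : Fin 2) ≠ 0 := by rw [Q_eq hy]; exact atZHom_ne_zero _ hq
  have hq1 : Q psi y (1 : Fin 2) ≠ 0 := by rw [Q_eq hy]; exact atZHom_ne_zero _ hq
  have hz0 : (zVar 0 : Frac 2) ≠ 0 := by
    rw [zVar, ← atZHom_apply]; exact atZHom_ne_zero _ X_ne_zero
  have hz1 : (zVar 1 : Frac 2) ≠ 0 := by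
    rw [zVar, ← atZHom_apply]; exact atZHom_ne_zero _ X_ne_zero
  rw [omega, algebraMap_WofZ_two hpsi hy, omegaShift, Fin.prod_univ_two, dlogX_eq, dlogX_eq]
  generalize B (XVar psi y (0 : Fin 2)) (XVar psi y 1) = b
  rw [B]
  have h2 : ((2 : Frac 2) ^ (1 - ((0 : ℕ) : ℤ))) = 2 := by simp
  rw [h2]
  generalize (zVar 0 : Frac 2) - zVar 1 = s
  generalize (zVar 0 : Frac 2) + zVar 1 = s'
  calc _ = (zVar 0 * zVar 1 / s ^ 2 + zVar 0 * zVar 1 / s' ^ 2) / (zVar 0 * zVar 1) / 2 := by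
        field_simp; ring
    _ = _ := by rw [add_div, div_div, div_div]; field_simp

theorem algebraMap_WofZ_one (hpsi : ∀ d n, Odd n → coeff n (psi d) = 0)
    (hy : ∀ d n, Even n → coeff n (y d) = 0) :
    algebraMap (MvPowerSeries (Fin 1) ℂ) (Frac 1) (WofZ psi y 0 1) = atZ (y 0) 0 / 2 := by
  have h : algebraMap (MvPowerSeries (Fin 1) ℂ) (Frac 1) (WofZ psi y 0 1) =
      atZHom 0 (C (1 / 2 : ℂ) * y 0) := by rw [WofZ_one hpsi hy, atZHom_apply, atZ]
  have h2 : (2 : Frac 1) * atZHom 0 (C (1 / 2 : ℂ)) = 1 := by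
    have : (2 : Frac 1) = atZHom 0 (C (2 : ℂ)) := by
      rw [show (C (2 : ℂ) : PowerSeries ℂ) = 2 from map_ofNat C 2, map_ofNat]
    rw [this, ← map_mul, ← map_mul]; simp
  rw [h, map_mul, atZHom_apply 0 (y 0), eq_div_iff two_ne_zero]
  linear_combination (atZ (y 0) 0) * h2

end Fractions

end
end BKP

theorem mainTheorem7 (psi y : ℕ → PowerSeries ℂ)
    (hpsi : ∀ d n, Odd n → PowerSeries.coeff n (psi d) = 0)
    (hy : ∀ d n, Even n → PowerSeries.coeff n (y d) = 0) :
    algebraMap (MvPowerSeries (Fin 1) ℂ) (BKP.Frac 1) (BKP.WofZ psi y 0 1) =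
        BKP.atZ (y 0) 0 / 2 ∧
    algebraMap (MvPowerSeries (Fin 2) ℂ) (BKP.Frac 2) (BKP.WofZ psi y 0 2) =
        1 / (4 * BKP.Q psi y 0 * BKP.Q psi y 1) * BKP.B (BKP.zVar 0) (BKP.zVar 1) -
          1 / 4 * BKP.B (BKP.XVar psi y 0) (BKP.XVar psi y 1) ∧
    BKP.omega psi y 0 1 = BKP.atZ (y 0) 0 * BKP.dlogX psi y 0 ∧
    BKP.omega psi y 0 2 =
        1 / 2 * (1 / (BKP.zVar 0 - BKP.zVar 1) ^ 2 + 1 / (BKP.zVar 0 + BKP.zVar 1) ^ 2) := by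
  refine ⟨BKP.algebraMap_WofZ_one hpsi hy, BKP.algebraMap_WofZ_two hpsi hy, ?_,
    BKP.omega_two hpsi hy⟩
  have h2 : ((2 : BKP.Frac 1) ^ (1 - ((0 : ℕ) : ℤ))) = 2 := by simp
  have h3 : BKP.omegaShift psi y 0 1 = 0 := rfl
  rw [BKP.omega, BKP.algebraMap_WofZ_one hpsi hy, h3, h2, Fin.prod_univ_one, add_zero,
    mul_div_cancel₀ _ two_ne_zero]
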